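/- Let $n\ge 1$ and let $(M,\omega)$ be an $n$-plectic manifold: $M$ is a smooth manifold and $\omega\in\Omega^{n+1}(M)$ is closed with $T_mM\to\bigwedge^nT_m^*M$, $v\mapsto i_v\omega_m$, injective for every $m\in M$. For multivector fields put $i_{X_1\wedge\dots\wedge X_r}\alpha=i_{X_r}\cdots i_{X_1}\alpha$, extended linearly, and $L_X\alpha=d(i_X\alpha)-(-1)^r\,i_X d\alpha$ for $X$ of tensor degree $r$, extended linearly in $X$. A multivector field $X$ is a semi-Hamiltonian multivector field associated to a form $f$ if $i_X\omega=-df$. A form $f\in\Omega(M)$ is Hamiltonian if there are multivector fields $X$ and $Y$ with $i_X\omega=-df$ and $i_Y\omega=-f$; $H(M)$ denotes the set of Hamiltonian forms. A Hamiltonian form that is homogeneous of tensor degree $r$ has symmetric degree $\deg f=n-r$. Write $e(f)=(-1)^{\deg f}$, $e(f,g)=(-1)^{\deg f\,\deg g}$, and let $e(s;f_1,f_2,f_3)$ be the Koszul sign of a permutation $s$, given by $f_1\otimes f_2\otimes f_3=e(s;f_1,f_2,f_3)\,f_{s_1}\otimes f_{s_2}\otimes f_{s_3}$. For homogeneous $f_1,f_2\in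 H(M)$ with associated semi-Hamiltonian multivector fields $X_1,X_2$ let $$D_2(f_1,f_2)=e(f_1)\,L_{X_1}f_2+e(f_1,f_2)\,e(f_2)\,L_{X_2}f_1,$$ extended to $H(M)$ by linearity. Let $Sh(2,1)$ be the set of permutations $s$ of $\{1,2,3\}$ with $s_1<s_2$. Then $D_2(f_1,f_2)$ does not depend on the choice of $X_1,X_2$ and is again a Hamiltonian form. For any three homogeneous $f_1,f_2,f_3\in H(M)$, and any semi-Hamiltonian multivector fields $X_{D_2}(f_i,f_j)$ associated to $D_2(f_i,f_j)$, $$\sum_{s\in Sh(2,1)}e(s;f_1,f_2,f_3)\,D_2\bigl(D_2(f_{s_1},f_{s_2}),f_{s_3}\bigr) =-\tfrac12\sum_{s\in Sh(2,1)}e(s;f_1,f_2,f_3)\,e(f_{s_1})\,e(f_{s_2})\,L_{X_{D_2}(f_{s_1},f_{s_2})}f_{s_3}.$$ The graded Jacobi identity fails in general: there are an $n$-plectic manifold, which may be taken to be some $\mathbb R^d$ with an $n$-plectic form, and homogeneous Hamiltonian forms $f_1,f_2,f_3$ on it for which the left-hand side is not zero. -/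

import Mathlib

open scoped Manifold

noncomputable section

namespace NPlectic

universe u v

/-! ### Signs and shuffles -/

/-- The set `Sh(p,q)` of shuffle permutations `s` of `p + q` letters:
`s 0 < ⋯ < s (p-1)` and `s p < ⋯ < s (p+q-1)`. -/
def shuffles (p q : ℕ) : Finset (Equiv.Perm (Fin (p + q))) :=
  Finset.univ.filter fun s =>
    StrictMono (fun i : Fin p => s (Fin.castAdd q i)) ∧
      StrictMono (fun j : Fin q => s (Fin.natAdd p j))

/-- The sign `e(v) = (-1)^deg v`. -/
def sgn (a : ℤ) : ℝ := (-1) ^ a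

/-- The sign `e(v, w) = (-1)^(deg v * deg w)`. -/
def sgn₂ (a b : ℤ) : ℝ := (-1) ^ (a * b)

/-- The Koszul sign `e(s; v_1, …, v_k)`, defined by
`v_1 ⊗ ⋯ ⊗ v_k = e(s; v_1, …, v_k) v_{s_1} ⊗ ⋯ ⊗ v_{s_k}`, as a function of the degrees:
each pair of letters whose order is reversed contributes the sign `e(v, w)`. -/
def koszulSign {k : ℕ} (s : Equiv.Perm (Fin k)) (deg : Fin k → ℤ) : ℝ :=
  ∏ p : Fin k × Fin k,
    if p.1 < p.2 ∧ s p.2 < s p.1 then sgn₂ (deg (s p.1)) (deg (s p.2)) else 1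

/-! ### Contraction of an alternating form along a multivector -/

theorem append_update_left {V : Type u} {r k : ℕ} (w : Fin r → V) (z : Fin k → V) (i : Fin r) (x : V) :
    Fin.append (Function.update w i x) z
      = Function.update (Fin.append w z) (Fin.castAdd k i) x := by
  ext j
  refine Fin.addCases (fun j => ?_) (fun j => ?_) j
  · by_cases h : j = i
    · subst h; simp
    · have : Fin.castAdd k j ≠ Fin.castAdd k i := fun h' => h (Fin.castAdd_injective r k h')
      simp [h, this]
  · have : Fin.natAdd r j ≠ Fin.castAdd k i := by
      intro h'; have := congrArg Fin.val h'; simp at this; omega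
    simp [this]

theorem append_update_right {V : Type u} {r k : ℕ} (w : Fin r → V) (z : Fin k → V) (i : Fin k) (x : V) :
    Fin.append w (Function.update z i x)
      = Function.update (Fin.append w z) (Fin.natAdd r i) x := by
  ext j
  refine Fin.addCases (fun j => ?_) (fun j => ?_) j
  · have : Fin.castAdd k j ≠ Fin.natAdd r i := by
      intro h'; have := congrArg Fin.val h'; simp at this; omega
    simp [this]
  · by_cases h : j = i
    · subst h; simp
    · have : Fin.natAdd r j ≠ Fin.natAdd r i := fun h' => h (Fin.natAdd_injective k r h')
      simp [h, this]

section Contraction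

variable {V : Type u} [AddCommGroup V] [Module ℝ V] [TopologicalSpace V]

/-- Repeated contraction `i_{w_r} ⋯ i_{w_1} α`, that is `z ↦ α (w_1, …, w_r, z_1, …, z_k)`. -/
def contractTuple {r k : ℕ} (α : V [⋀^Fin (r + k)]→L[ℝ] ℝ) (w : Fin r → V) :
    V [⋀^Fin k]→L[ℝ] ℝ where
  toFun z := α (Fin.append w z)
  map_update_add' := by
    intro inst z i x y
    obtain rfl := Subsingleton.elim inst (instDecidableEqFin k)
    simp only [append_update_right]
    exact α.map_update_add _ _ _ _
  map_update_smul' := by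
    intro inst z i c x
    obtain rfl := Subsingleton.elim inst (instDecidableEqFin k)
    simp only [append_update_right]
    exact α.map_update_smul _ _ _ _
  map_eq_zero_of_eq' z i j hz hij :=
    α.map_eq_zero_of_eq (Fin.append w z) (by simpa using hz)
      (fun h => hij (Fin.natAdd_injective k r h))
  cont := by
    refine α.cont.comp (continuous_pi fun j => ?_)
    refine Fin.addCases (fun j => ?_) (fun j => ?_) j
    · simpa using continuous_const
    · simpa using continuous_apply j

variable [IsTopologicalAddGroup V] [ContinuousSMul ℝ V]

/-- Repeated contraction of `α`, as an alternating function of the contracting vectors. -/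
def contractAlternating {r k : ℕ} (α : V [⋀^Fin (r + k)]→L[ℝ] ℝ) :
    V [⋀^Fin r]→ₗ[ℝ] (V [⋀^Fin k]→L[ℝ] ℝ) where
  toFun w := contractTuple α w
  map_update_add' := by
    intro inst w i x y
    obtain rfl := Subsingleton.elim inst (instDecidableEqFin r)
    ext z
    change α _ = α _ + α _
    simp only [append_update_left]
    exact α.map_update_add _ _ _ _
  map_update_smul' := by
    intro inst w i c x
    obtain rfl := Subsingleton.elim inst (instDecidableEqFin r)
    ext z
    change α _ = c • α _
    simp only [append_update_left]
    exact α.map_update_smul _ _ _ _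
  map_eq_zero_of_eq' w i j hw hij := by
    ext z
    exact α.map_eq_zero_of_eq (Fin.append w z) (by simpa using hw)
      (fun h => hij (Fin.castAdd_injective r k h))

/-- The contraction `i_x α` of an `(r+k)`-form along an `r`-vector: the linear extension of
`i_{w_1 ∧ ⋯ ∧ w_r} α = i_{w_r} ⋯ i_{w_1} α`. -/
def contract {r k : ℕ} (x : ⋀[ℝ]^r V) (α : V [⋀^Fin (r + k)]→L[ℝ] ℝ) : V [⋀^Fin k]→L[ℝ] ℝ :=
  exteriorPower.alternatingMapLinearEquiv (contractAlternating α) x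

end Contraction

/-! ### Differential forms and multivector fields on a manifold -/

section Manifold

variable (E : Type u) [NormedAddCommGroup E] [NormedSpace ℝ E]
  (M : Type v) [TopologicalSpace M] [ChartedSpace E M]

/-- Not necessarily smooth sections of `⋀^r T^*M`. -/
abbrev FormSection (r : ℕ) : Type (max u v) :=
  (m : M) → TangentSpace 𝓘(ℝ, E) m [⋀^Fin r]→L[ℝ] ℝ

/-- Not necessarily smooth sections of `⋀^r TM`. -/
abbrev MultivectorSection (r : ℕ) : Type (max u v) :=
  (m : M) → ⋀[ℝ]^r (TangentSpace 𝓘(ℝ, E) m)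

/-- Families of sections of `⋀^r T^*M`, one for each `r`. As these vanish for `r > dim M`, the
product over all `r` is the direct sum, and the smooth elements are the forms in `Ω(M)`. -/
abbrev Form : Type (max u v) := (r : ℕ) → FormSection E M r

/-- Families of sections of `⋀^r TM`, one for each `r`; the smooth elements are the
multivector fields in `𝔛(M)`. -/
abbrev Multivector : Type (max u v) := (r : ℕ) → MultivectorSection E M r

variable {E M}

/-- The expression of an `r`-form in the preferred chart at `x`. -/
def FormSection.inChart {r : ℕ} (α : FormSection E M r) (x : M) : E → E [⋀^Fin r]→L[ℝ] ℝ :=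
  fun y => (α ((extChartAt 𝓘(ℝ, E) x).symm y)).compContinuousLinearMap
    (mfderiv 𝓘(ℝ, E) 𝓘(ℝ, E) (extChartAt 𝓘(ℝ, E) x).symm y)

/-- The expression of an `r`-vector field in the preferred chart at `x`. -/
def MultivectorSection.inChart {r : ℕ} (X : MultivectorSection E M r) (x : M) : E → ⋀[ℝ]^r E :=
  fun y => exteriorPower.map r
    (mfderiv 𝓘(ℝ, E) 𝓘(ℝ, E) (extChartAt 𝓘(ℝ, E) x)
      ((extChartAt 𝓘(ℝ, E) x).symm y)).toLinearMap
    (X ((extChartAt 𝓘(ℝ, E) x).symm y))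

/-- Smoothness of an `r`-form. -/
def FormSection.IsSmooth {r : ℕ} (α : FormSection E M r) : Prop :=
  ∀ x : M, ContDiffOn ℝ (⊤ : ℕ∞) (α.inChart x) (extChartAt 𝓘(ℝ, E) x).target

/-- Smoothness of an `r`-vector field: in charts, all its coordinates, that is its pairings with
constant `r`-forms on `E`, are smooth. -/
def MultivectorSection.IsSmooth {r : ℕ} (X : MultivectorSection E M r) : Prop :=
  ∀ (x : M) (l : E [⋀^Fin r]→ₗ[ℝ] ℝ),
    ContDiffOn ℝ (⊤ : ℕ∞) (fun y => exteriorPower.alternatingMapLinearEquiv l (X.inChart x y))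
      (extChartAt 𝓘(ℝ, E) x).target

/-- The exterior derivative of an `r`-form, computed at `m` in the preferred chart at `m`. -/
def FormSection.d {r : ℕ} (α : FormSection E M r) : FormSection E M (r + 1) :=
  fun m => (extDeriv (α.inChart m) (extChartAt 𝓘(ℝ, E) m m)).compContinuousLinearMap
    (mfderiv 𝓘(ℝ, E) 𝓘(ℝ, E) (extChartAt 𝓘(ℝ, E) m) m)

/-- Smoothness of an element of `Ω(M)`. -/
def Form.IsSmooth (α : Form E M) : Prop := ∀ r, FormSection.IsSmooth (α r)

/-- Smoothness of an element of `𝔛(M)`. -/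
def Multivector.IsSmooth (X : Multivector E M) : Prop := ∀ r, MultivectorSection.IsSmooth (X r)

/-- `α` is homogeneous of tensor degree `r`. -/
def Form.IsHomogeneous (r : ℕ) (α : Form E M) : Prop := ∀ k, k ≠ r → α k = 0

/-- The homogeneous component of `α` of tensor degree `r`. -/
def Form.component (α : Form E M) (r : ℕ) : Form E M := Pi.single r (α r)

/-- The exterior derivative on `Ω(M)`. -/
def Form.d (α : Form E M) : Form E M
  | 0 => 0
  | r + 1 => FormSection.d (α r)

/-- The contraction `i_X α`. The sum runs over all degrees `r` in which `⋀^r TM` may be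
nonzero. -/
def Form.contract (X : Multivector E M) (α : Form E M) : Form E M :=
  fun k m => ∑ r ∈ Finset.range (Module.finrank ℝ E + 1), NPlectic.contract (X r m) (α (r + k) m)

/-- The Lie derivative `L_X α`, which is `d (i_X α) - (-1)^r i_X (d α)` if `X` is homogeneous of
tensor degree `r`, extended to all `X` by linearity. -/
def Form.lieDeriv (X : Multivector E M) (α : Form E M) : Form E M :=
  Form.d (Form.contract X α)
    - Form.contract (fun r => (-1 : ℝ) ^ r • X r : Multivector E M) (Form.d α)

/-! ### `n`-plectic manifolds and Hamiltonian forms -/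

/-- `ω` is an `n`-plectic form: smooth, closed, and `v ↦ i_v ω_m` is injective on each `T_m M`. -/
structure IsNPlectic {n : ℕ} (ω : FormSection E M (n + 1)) : Prop where
  one_le : 1 ≤ n
  smooth : FormSection.IsSmooth ω
  closed : FormSection.d ω = 0
  nondegenerate : ∀ m : M, Function.Injective
    (fun v : TangentSpace 𝓘(ℝ, E) m => (ω m).toAlternatingMap.curryLeft v)

/-- A homogeneous form of tensor degree `r`, as an element of `Ω(M)`. -/
def FormSection.toForm {r : ℕ} (α : FormSection E M r) : Form E M := Pi.single r α

variable {n : ℕ} (ω : FormSection E M (n + 1))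

/-- First fundamental equation `i_X ω = -df`: `X` is a semi-Hamiltonian multivector field
associated to `f`. -/
def IsSemiHamiltonianField (f : Form E M) (X : Multivector E M) : Prop :=
  Multivector.IsSmooth X ∧ Form.contract X ω.toForm = -Form.d f

/-- Second fundamental equation `i_Y ω = -f`: `Y` is a Hamiltonian multivector field
associated to `f`. -/
def IsHamiltonianField (f : Form E M) (Y : Multivector E M) : Prop :=
  Multivector.IsSmooth Y ∧ Form.contract Y ω.toForm = -f

/-- `f` is a Hamiltonian form. -/
def IsHamiltonian (f : Form E M) : Prop :=
  Form.IsSmooth f ∧ (∃ X, IsSemiHamiltonianField ω f X) ∧ ∃ Y, IsHamiltonianField ω f Y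

open Classical in
/-- A choice of a semi-Hamiltonian multivector field associated to `f` (zero if there is none,
which does not happen for a Hamiltonian form). -/
def semiHamiltonianField (f : Form E M) : Multivector E M :=
  if h : ∃ X, IsSemiHamiltonianField ω f X then h.choose else 0

/-- The symmetric degree `n - r` of a form of tensor degree `r`. -/
def symDeg (n r : ℕ) : ℤ := (n : ℤ) - (r : ℤ)

/-- The strong homotopy Lie 2-bracket, which is
`D₂(f, g) = e(f) L_{X_f} g + e(f,g) e(g) L_{X_g} f` for homogeneous `f`, `g`, extended by linearity;
the signs refer to the symmetric degree. -/
def D₂ (f g : Form E M) : Form E M :=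
  ∑ a ∈ Finset.range (Module.finrank ℝ E + 1), ∑ b ∈ Finset.range (Module.finrank ℝ E + 1),
    (sgn (symDeg n a) •
        Form.lieDeriv (semiHamiltonianField ω (f.component a)) (g.component b)
      + (sgn₂ (symDeg n a) (symDeg n b) * sgn (symDeg n b)) •
        Form.lieDeriv (semiHamiltonianField ω (g.component b)) (f.component a))

/-- The graded Jacobi expression
`∑_{s ∈ Sh(2,1)} e(s; f₁, f₂, f₃) D₂(D₂(f_{s₁}, f_{s₂}), f_{s₃})`
of homogeneous forms `f i` of tensor degrees `a i`. -/
def jacobiator (a : Fin 3 → ℕ) (f : Fin 3 → Form E M) : Form E M :=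
  ∑ s ∈ shuffles 2 1, koszulSign s (fun i => symDeg n (a i)) •
    D₂ ω (D₂ ω (f (s 0)) (f (s 1))) (f (s 2))

end Manifold

end NPlectic

end

open scoped Manifold

noncomputable section

namespace NPlectic

universe u v

/-! ### The exterior algebra -/

section ExteriorAlgebra

open CliffordAlgebra (involute contractLeft)

variable {V : Type u} [AddCommGroup V] [Module ℝ V]

/-! Let r be the symmetric degree of f. If i_X ω = -df and i_Y ω = -f, then X may be taken of degree
r and Y of degree r + 1, and the signs only see parities. Two facts of Cartan calculus carry the
argument: contractions commute up to sign, and the derived bracket [[d, i_X], i_Y] is again a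
contraction, namely along the Schouten bracket of X and Y (`contract_schoutenBracket`).

Independence of choices: if i_T ω = 0, then i_T kills f = -i_Y ω and df = -i_X ω because
contractions commute, so L_T f = 0 (`CartanCalculus.lie_eq_zero`). The Lie derivative of a
Hamiltonian form along X thus depends only on i_X ω.

Closure: for semi-Hamiltonian X and Y of f and g, the derived bracket applied to ω is d i_X i_Y ω,
since ω, i_X ω and i_Y ω are closed. On the other hand d D₂(f, g) = 2 d i_X i_Y ω
(`CartanCalculus.d_bracket`), so -2 times the Schouten bracket is a semi-Hamiltonian field of D₂(f,
g). Likewise L_X g is, up to sign, the contraction of ω along the Schouten bracket of X with a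
Hamiltonian field of g, which gives the second fundamental equation.

Jacobi expression: on Hamiltonian forms, the Lie derivative along any X_{D₂}(f, g) is therefore
twice a signed commutator of L_X and L_Y. Let S be the sum on the right-hand side without the factor
-1/2. As e(D₂(f_i, f_j)) = -e(f_i) e(f_j), the terms with L_{X_{D₂}(f_i, f_j)} f_k add up to -S. The
terms with L_{X_k} D₂(f_i, f_j) expand into six double Lie derivatives, which regroup to S/2. The
total is -S/2 (`CartanCalculus.jacobi`).

Failure: on the plane with area form, the constant 1 has semi-Hamiltonian field 0, yet its Lie
derivative along a function h, a multivector field of degree zero, is dh. A pair of forms whose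
2-bracket has such a field 4y makes the expression equal to 2 dy (`PlaneArea.jacobiator_ne_zero`).

To avoid casts between degrees, a multivector is treated as one element of the exterior algebra and
a form as one functional on it; then i_X α is z ↦ α(X z), and d is a sum of partial derivatives
composed with `contractLeft`. -/

theorem ι_mul_eq_involute_mul_ι (v : V) (y : ExteriorAlgebra ℝ V) :
    ExteriorAlgebra.ι ℝ v * y = involute y * ExteriorAlgebra.ι ℝ v := by
  induction y using CliffordAlgebra.left_induction with
  | algebraMap r =>
    rw [AlgHom.commutes]
    exact (Algebra.commutes r _).symm
  | add x y hx hy => rw [mul_add, hx, hy, map_add, add_mul]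
  | ι_mul x m hx =>
    have h := eq_neg_of_add_eq_zero_left (ExteriorAlgebra.ι_add_mul_swap (R := ℝ) v m)
    rw [map_mul, CliffordAlgebra.involute_ι, neg_mul, neg_mul, mul_assoc, ← hx, ← mul_assoc,
      ← mul_assoc]
    change ExteriorAlgebra.ι ℝ v * ExteriorAlgebra.ι ℝ m * x = _
    rw [h, neg_mul]

theorem mul_comm_of_even {y : ExteriorAlgebra ℝ V} (hy : involute y = y)
    (x : ExteriorAlgebra ℝ V) : y * x = x * y := by
  induction x using CliffordAlgebra.left_induction with
  | algebraMap r => exact (Algebra.commutes r _).symm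
  | add a b ha hb => rw [mul_add, ha, hb, add_mul]
  | ι_mul x m hx =>
    have h := ι_mul_eq_involute_mul_ι m y
    rw [hy] at h
    rw [← mul_assoc, mul_assoc _ x y, ← hx, ← mul_assoc]
    exact congrArg (· * x) h.symm

theorem mul_eq_involute_mul_of_odd {y : ExteriorAlgebra ℝ V} (hy : involute y = -y)
    (x : ExteriorAlgebra ℝ V) : y * x = involute x * y := by
  induction x using CliffordAlgebra.left_induction with
  | algebraMap r => rw [AlgHom.commutes]; exact (Algebra.commutes r _).symm
  | add a b ha hb => rw [mul_add, ha, hb, map_add, add_mul]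
  | ι_mul x m hx =>
    have h := ι_mul_eq_involute_mul_ι m y
    rw [hy] at h
    rw [map_mul, CliffordAlgebra.involute_ι, mul_assoc, ← hx, ← mul_assoc, ← mul_assoc, neg_mul]
    change y * ExteriorAlgebra.ι ℝ m * x = -(ExteriorAlgebra.ι ℝ m * y) * x
    rw [h, neg_mul, neg_mul, neg_mul, neg_neg]

/-- This antiderivation rule is what makes the commutator of e ∧ with i_X a contraction, along e ⌟ X
up to sign. -/
theorem contractLeft_mul (e : Module.Dual ℝ V) (x z : ExteriorAlgebra ℝ V) :
    contractLeft e (x * z) = contractLeft e x * z + involute x * contractLeft e z := by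
  induction x using CliffordAlgebra.left_induction with
  | algebraMap r =>
    rw [CliffordAlgebra.contractLeft_algebraMap_mul, CliffordAlgebra.contractLeft_algebraMap,
      AlgHom.commutes, zero_mul, zero_add]
  | add a b ha hb => rw [add_mul, map_add, ha, hb, map_add, map_add, add_mul, add_mul]; abel
  | ι_mul x m hx =>
    rw [mul_assoc, CliffordAlgebra.contractLeft_ι_mul, hx, CliffordAlgebra.contractLeft_ι_mul,
      map_mul, CliffordAlgebra.involute_ι, sub_mul, smul_mul_assoc, mul_add, mul_assoc, neg_mul,
      neg_mul, mul_assoc]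
    abel

theorem involute_contractLeft (e : Module.Dual ℝ V) (x : ExteriorAlgebra ℝ V) :
    involute (contractLeft e x) = -contractLeft e (involute x) := by
  induction x using CliffordAlgebra.left_induction with
  | algebraMap r => simp
  | add a b ha hb => rw [map_add, map_add, ha, hb, map_add, map_add, neg_add]
  | ι_mul x m hx =>
    simp only [CliffordAlgebra.contractLeft_ι_mul, map_sub, map_smul, map_mul,
      CliffordAlgebra.involute_ι, hx, neg_mul, map_neg]
    rw [mul_neg]
    abel

theorem involute_ιMulti {k : ℕ} (v : Fin k → V) :
    involute (ExteriorAlgebra.ιMulti ℝ k v) = (-1 : ℝ) ^ k • ExteriorAlgebra.ιMulti ℝ k v := by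
  have := CliffordAlgebra.involute_prod_map_ι (Q := (0 : QuadraticForm ℝ V)) (List.ofFn v)
  rw [ExteriorAlgebra.ιMulti_apply]
  rw [List.map_ofFn, List.length_ofFn] at this
  exact this

theorem involute_of_mem {k : ℕ} {x : ExteriorAlgebra ℝ V} (hx : x ∈ ⋀[ℝ]^k V) :
    involute x = (-1 : ℝ) ^ k • x := by
  rw [← ExteriorAlgebra.ιMulti_span_fixedDegree] at hx
  induction hx using Submodule.span_induction with
  | mem x h => obtain ⟨v, rfl⟩ := h; exact involute_ιMulti v
  | zero => simp
  | add x y _ _ hx hy => rw [map_add, hx, hy, smul_add]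
  | smul c x _ hx => rw [map_smul, hx, smul_comm]

/-- The alternating sum is the one in the formula for `extDeriv`, which allows d to be written
through `contractLeft`. -/
theorem contractLeft_ιMulti (e : Module.Dual ℝ V) {k : ℕ} (v : Fin (k + 1) → V) :
    contractLeft e (ExteriorAlgebra.ιMulti ℝ (k + 1) v) =
      ∑ i : Fin (k + 1), ((-1 : ℝ) ^ (i : ℕ) * e (v i)) •
        ExteriorAlgebra.ιMulti ℝ k (i.removeNth v) := by
  induction k with
  | zero =>
    rw [ExteriorAlgebra.ιMulti_succ_apply]
    refine (CliffordAlgebra.contractLeft_ι_mul _ _ _).trans ?_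
    simp
  | succ k ih =>
    rw [ExteriorAlgebra.ιMulti_succ_apply]
    refine (CliffordAlgebra.contractLeft_ι_mul _ _ _).trans ?_
    have h0 : (0 : Fin (k + 2)).removeNth v = Matrix.vecTail v := rfl
    rw [ih, Fin.sum_univ_succ (n := k + 1), sub_eq_add_neg, Fin.val_zero, pow_zero, one_mul, h0,
      Finset.mul_sum, ← Finset.sum_neg_distrib]
    congr 1
    refine Finset.sum_congr rfl fun i _ => ?_
    have h1 : Matrix.vecTail (i.succ.removeNth v) = i.removeNth (Matrix.vecTail v) := by
      ext j
      simp [Matrix.vecTail, Fin.removeNth]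
    rw [ExteriorAlgebra.ιMulti_succ_apply (i.succ.removeNth v), h1, mul_smul_comm, ← neg_smul]
    have h2 : i.succ.removeNth v 0 = v 0 := by simp [Fin.removeNth]
    rw [h2, Fin.val_succ, pow_succ]
    congr 1
    simp [Matrix.vecTail]

instance finite_exteriorAlgebra [Module.Finite ℝ V] : Module.Finite ℝ (ExteriorAlgebra ℝ V) :=
  Module.Finite.of_basis ((Module.finBasis ℝ V).ExteriorAlgebra)

/-- Justifies the cutoff at `finrank` in `total` and in `Form.contract`. -/
theorem exteriorPower_eq_zero [Module.Finite ℝ V] {k : ℕ} (hk : Module.finrank ℝ V < k)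
    (x : ⋀[ℝ]^k V) : x = 0 := by
  have : Module.finrank ℝ (⋀[ℝ]^k V) = 0 := by
    rw [exteriorPower.finrank_eq, Nat.choose_eq_zero_of_lt hk]
  exact Subsingleton.elim (h := Module.finrank_zero_iff.1 this) _ _

theorem coe_exteriorPower_map {W : Type v} [AddCommGroup W] [Module ℝ W] {k : ℕ} (f : V →ₗ[ℝ] W)
    (x : ⋀[ℝ]^k V) :
    (exteriorPower.map k f x : ExteriorAlgebra ℝ W) = ExteriorAlgebra.map f x := by
  have : (⋀[ℝ]^k W).subtype ∘ₗ exteriorPower.map k f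
      = (ExteriorAlgebra.map f).toLinearMap ∘ₗ (⋀[ℝ]^k V).subtype := by
    apply exteriorPower.linearMap_ext
    ext v
    simp [ExteriorAlgebra.map_apply_ιMulti]
  exact LinearMap.congr_fun this x

end ExteriorAlgebra

/-! ### Multivectors as elements of the exterior algebra -/

section Total

open CliffordAlgebra (involute)

variable {V : Type u} [AddCommGroup V] [Module ℝ V]

/-- The multivector with the given homogeneous components. -/
def total (X : (r : ℕ) → ⋀[ℝ]^r V) : ExteriorAlgebra ℝ V :=
  ∑ r ∈ Finset.range (Module.finrank ℝ V + 1), (X r : ExteriorAlgebra ℝ V)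

/-- The homogeneous components of a multivector. -/
def components (x : ExteriorAlgebra ℝ V) (r : ℕ) : ⋀[ℝ]^r V :=
  DirectSum.decompose (fun r => ⋀[ℝ]^r V) x r

theorem total_map {W : Type v} [AddCommGroup W] [Module ℝ W] (f : V →ₗ[ℝ] W)
    (h : Module.finrank ℝ V = Module.finrank ℝ W) (X : (r : ℕ) → ⋀[ℝ]^r V) :
    total (fun r => exteriorPower.map r f (X r)) = ExteriorAlgebra.map f (total X) := by
  simp only [total, map_sum, coe_exteriorPower_map, h]

theorem total_neg_one_pow (X : (r : ℕ) → ⋀[ℝ]^r V) :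
    total (fun r => (-1 : ℝ) ^ r • X r) = involute (total X) := by
  simp only [total, map_sum]
  refine Finset.sum_congr rfl fun r _ => ?_
  rw [involute_of_mem (X r).2]
  rfl

theorem linearMap_ext_ιMulti {N : Type*} [AddCommGroup N] [Module ℝ N]
    {f g : ExteriorAlgebra ℝ V →ₗ[ℝ] N}
    (h : ∀ (k : ℕ) (v : Fin k → V),
      f (ExteriorAlgebra.ιMulti ℝ k v) = g (ExteriorAlgebra.ιMulti ℝ k v)) : f = g :=
  ExteriorAlgebra.lhom_ext fun k => AlternatingMap.ext fun v => h k v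

variable [Module.Finite ℝ V]

theorem total_components (x : ExteriorAlgebra ℝ V) : total (components x) = x := by
  classical
  conv_rhs => rw [← DirectSum.sum_support_decompose (fun r => ⋀[ℝ]^r V) x]
  refine (Finset.sum_subset (fun r hr => ?_) fun r _ hr => ?_).symm
  · rw [Finset.mem_range]
    by_contra h
    exact (DFinsupp.mem_support_iff.1 hr) (exteriorPower_eq_zero (by omega) _)
  · rw [DFinsupp.notMem_support_iff] at hr
    simp only [components]
    rw [hr]
    rfl

theorem components_total (X : (r : ℕ) → ⋀[ℝ]^r V) : components (total X) = X := by
  funext k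
  simp only [components, total]
  rw [DirectSum.decompose_sum, DFinsupp.finsetSum_apply]
  by_cases hk : k < Module.finrank ℝ V + 1
  · rw [Finset.sum_eq_single k]
    · rw [DirectSum.decompose_coe, DirectSum.of_eq_same]
    · intro r _ hr
      rw [DirectSum.decompose_coe, DirectSum.of_eq_of_ne _ _ _ hr.symm]
    · intro h
      exact absurd (Finset.mem_range.2 hk) h
  · rw [exteriorPower_eq_zero (by omega) (X k)]
    exact exteriorPower_eq_zero (by omega) _

theorem total_injective : Function.Injective (total : ((r : ℕ) → ⋀[ℝ]^r V) → _) :=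
  Function.LeftInverse.injective components_total

end Total

/-! ### Forms as functionals on the exterior algebra -/

section Pairing

open CliffordAlgebra (involute contractLeft)

variable {V : Type u} [AddCommGroup V] [Module ℝ V] [TopologicalSpace V]

/-- The linear functional on the exterior algebra given by a family of alternating forms. -/
def pairing (α : (r : ℕ) → V [⋀^Fin r]→L[ℝ] ℝ) : ExteriorAlgebra ℝ V →ₗ[ℝ] ℝ :=
  ExteriorAlgebra.liftAlternating fun r => (α r).toAlternatingMap

@[simp]
theorem pairing_ιMulti (α : (r : ℕ) → V [⋀^Fin r]→L[ℝ] ℝ) {k : ℕ} (v : Fin k → V) :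
    pairing α (ExteriorAlgebra.ιMulti ℝ k v) = α k v :=
  ExteriorAlgebra.liftAlternating_apply_ιMulti _ _

theorem pairing_injective :
    Function.Injective (pairing : ((r : ℕ) → V [⋀^Fin r]→L[ℝ] ℝ) → _) := fun α β h => by
  funext r
  ext v
  rw [← pairing_ιMulti, h, pairing_ιMulti]

theorem pairing_neg_one_pow (α : (r : ℕ) → V [⋀^Fin r]→L[ℝ] ℝ) (x : ExteriorAlgebra ℝ V) :
    pairing (fun r => (-1 : ℝ) ^ r • α r) x = pairing α (involute x) := by
  have : pairing (fun r => (-1 : ℝ) ^ r • α r) = pairing α ∘ₗ involute.toLinearMap := by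
    refine linearMap_ext_ιMulti fun k v => ?_
    rw [LinearMap.comp_apply, AlgHom.toLinearMap_apply, involute_ιMulti, map_smul, pairing_ιMulti,
      pairing_ιMulti]
    rfl
  rw [this]
  rfl

theorem pairing_compContinuousLinearMap {W : Type v} [AddCommGroup W] [Module ℝ W]
    [TopologicalSpace W] (α : (r : ℕ) → V [⋀^Fin r]→L[ℝ] ℝ) (f : W →L[ℝ] V)
    (z : ExteriorAlgebra ℝ W) :
    pairing (fun r => (α r).compContinuousLinearMap f) z
      = pairing α (ExteriorAlgebra.map f.toLinearMap z) := by
  suffices pairing (fun r => (α r).compContinuousLinearMap f)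
      = pairing α ∘ₗ (ExteriorAlgebra.map f.toLinearMap).toLinearMap by rw [this]; rfl
  refine linearMap_ext_ιMulti fun k v => ?_
  rw [LinearMap.comp_apply, AlgHom.toLinearMap_apply, ExteriorAlgebra.map_apply_ιMulti,
    pairing_ιMulti, pairing_ιMulti]
  rfl

/-- Contraction becomes precomposition with left multiplication, so the index r + k disappears from
the types. By linearity in x it suffices to check decomposable multivectors. -/
theorem contract_apply (α : (r : ℕ) → V [⋀^Fin r]→L[ℝ] ℝ) {r k : ℕ} (x : ⋀[ℝ]^r V)
    (v : Fin k → V) :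
    contract x (α (r + k)) v = pairing α (x * ExteriorAlgebra.ιMulti ℝ k v) := by
  let ev : (V [⋀^Fin k]→L[ℝ] ℝ) →ₗ[ℝ] ℝ :=
    { toFun := fun β => β v, map_add' := fun _ _ => rfl, map_smul' := fun _ _ => rfl }
  have : ev ∘ₗ exteriorPower.alternatingMapLinearEquiv (contractAlternating (α (r + k)))
      = pairing α ∘ₗ LinearMap.mulRight ℝ (ExteriorAlgebra.ιMulti ℝ k v)
        ∘ₗ (⋀[ℝ]^r V).subtype := by
    apply exteriorPower.linearMap_ext
    ext w
    simp only [LinearMap.compAlternatingMap_apply, LinearMap.comp_apply, Submodule.subtype_apply,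
      exteriorPower.ιMulti_apply_coe, LinearMap.mulRight_apply, ExteriorAlgebra.ιMulti_mul_ιMulti,
      pairing_ιMulti, exteriorPower.alternatingMapLinearEquiv_apply_ιMulti]
    rfl
  exact LinearMap.congr_fun this x

theorem pairing_contract (X : (r : ℕ) → ⋀[ℝ]^r V) (α : (r : ℕ) → V [⋀^Fin r]→L[ℝ] ℝ)
    (z : ExteriorAlgebra ℝ V) :
    pairing (fun k => ∑ r ∈ Finset.range (Module.finrank ℝ V + 1), contract (X r) (α (r + k))) z
      = pairing α (total X * z) := by
  suffices pairing (fun k => ∑ r ∈ Finset.range (Module.finrank ℝ V + 1),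
      contract (X r) (α (r + k))) = pairing α ∘ₗ LinearMap.mulLeft ℝ (total X) by
    rw [this]; rfl
  refine linearMap_ext_ιMulti fun k v => ?_
  rw [pairing_ιMulti, LinearMap.comp_apply, LinearMap.mulLeft_apply, total, Finset.sum_mul, map_sum,
    ContinuousAlternatingMap.sum_apply]
  exact Finset.sum_congr rfl fun r _ => contract_apply α (X r) v

end Pairing

/-! ### Calculus of functions with values in finite-dimensional spaces without a norm -/

section WeakCalculus

variable {E : Type u} [NormedAddCommGroup E] [NormedSpace ℝ E]
  {W : Type v} [AddCommGroup W] [Module ℝ W] [Module.Finite ℝ W]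

/-- The directional derivative of a function with values in a finite-dimensional space. -/
def weakDeriv (X : E → W) (y v : E) : W :=
  ∑ i, fderiv ℝ (fun y' => (Module.finBasis ℝ W).coord i (X y')) y v • Module.finBasis ℝ W i

theorem dual_apply_eq_sum (φ : W →ₗ[ℝ] ℝ) (x : W) :
    φ x = ∑ i, (Module.finBasis ℝ W).coord i x * φ (Module.finBasis ℝ W i) := by
  conv_lhs => rw [← (Module.finBasis ℝ W).sum_repr x, map_sum]
  refine Finset.sum_congr rfl fun i _ => ?_
  rw [map_smul, smul_eq_mul, Module.Basis.coord_apply]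

/-- `weakDeriv` uses a basis because the exterior algebra is not given a norm; testing against
functionals characterizes it without the basis. -/
theorem apply_weakDeriv {X : E → W} {y : E}
    (hX : ∀ φ : W →ₗ[ℝ] ℝ, DifferentiableAt ℝ (fun y' => φ (X y')) y) (v : E) (φ : W →ₗ[ℝ] ℝ) :
    φ (weakDeriv X y v) = fderiv ℝ (fun y' => φ (X y')) y v := by
  have h : (fun y' => φ (X y')) = fun y' => ∑ i,
      (Module.finBasis ℝ W).coord i (X y') * φ (Module.finBasis ℝ W i) :=
    funext fun y' => dual_apply_eq_sum φ (X y')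
  rw [h, fderiv_fun_sum fun i _ => (hX _).mul_const _]
  simp only [weakDeriv, map_sum, map_smul, sum_apply]
  refine Finset.sum_congr rfl fun i _ => ?_
  rw [fderiv_mul_const (hX _)]
  simp [mul_comm]

theorem differentiableAt_dual_apply {A : E → W →ₗ[ℝ] ℝ} {X : E → W} {y : E}
    (hA : ∀ z, DifferentiableAt ℝ (fun y' => A y' z) y)
    (hX : ∀ φ : W →ₗ[ℝ] ℝ, DifferentiableAt ℝ (fun y' => φ (X y')) y) :
    DifferentiableAt ℝ (fun y' => A y' (X y')) y := by
  have h : (fun y' => A y' (X y')) = fun y' => ∑ i,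
      (Module.finBasis ℝ W).coord i (X y') * A y' (Module.finBasis ℝ W i) :=
    funext fun y' => dual_apply_eq_sum (A y') (X y')
  rw [h]
  exact DifferentiableAt.fun_sum fun i _ => (hX _).mul (hA _)

/-- Product rule for an evaluation, obtained by expanding X in a basis of W so that only scalar
functions are differentiated. -/
theorem fderiv_dual_apply {A : E → W →ₗ[ℝ] ℝ} {X : E → W} {y : E}
    (hA : ∀ z, DifferentiableAt ℝ (fun y' => A y' z) y)
    (hX : ∀ φ : W →ₗ[ℝ] ℝ, DifferentiableAt ℝ (fun y' => φ (X y')) y) (v : E) :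
    fderiv ℝ (fun y' => A y' (X y')) y v
      = fderiv ℝ (fun y' => A y' (X y)) y v + A y (weakDeriv X y v) := by
  have h : (fun y' => A y' (X y')) = fun y' => ∑ i,
      (Module.finBasis ℝ W).coord i (X y') * A y' (Module.finBasis ℝ W i) :=
    funext fun y' => dual_apply_eq_sum (A y') (X y')
  have h' : (fun y' => A y' (X y)) = fun y' => ∑ i,
      (Module.finBasis ℝ W).coord i (X y) * A y' (Module.finBasis ℝ W i) :=
    funext fun y' => dual_apply_eq_sum (A y') (X y)
  rw [h, h', fderiv_fun_sum fun i _ => (hX _).fun_mul (hA _), fderiv_fun_sum fun i _ =>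
    (hA _).const_mul _]
  simp only [weakDeriv, map_sum, map_smul, sum_apply]
  rw [← Finset.sum_add_distrib]
  refine Finset.sum_congr rfl fun i _ => ?_
  rw [fderiv_fun_mul (hX _) (hA _), fderiv_const_mul (hA _)]
  simp [mul_comm]

theorem contDiffOn_dual_apply {A : E → W →ₗ[ℝ] ℝ} {X : E → W} {s : Set E} {n : WithTop ℕ∞}
    (hA : ∀ z, ContDiffOn ℝ n (fun y' => A y' z) s)
    (hX : ∀ φ : W →ₗ[ℝ] ℝ, ContDiffOn ℝ n (fun y' => φ (X y')) s) :
    ContDiffOn ℝ n (fun y' => A y' (X y')) s := by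
  have h : (fun y' => A y' (X y')) = fun y' => ∑ i,
      (Module.finBasis ℝ W).coord i (X y') * A y' (Module.finBasis ℝ W i) :=
    funext fun y' => dual_apply_eq_sum (A y') (X y')
  rw [h]
  exact ContDiffOn.sum fun i _ => (hX _).mul (hA _)

theorem contDiffOn_fderiv_apply {g : E → ℝ} {s : Set E} (hs : IsOpen s)
    (hg : ContDiffOn ℝ (⊤ : ℕ∞) g s) (v : E) :
    ContDiffOn ℝ (⊤ : ℕ∞) (fun y => fderiv ℝ g y v) s :=
  (hg.fderiv_of_isOpen hs (by simp)).clm_apply contDiffOn_const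

theorem contDiffOn_weakDeriv {X : E → W} {s : Set E} (hs : IsOpen s)
    (hX : ∀ φ : W →ₗ[ℝ] ℝ, ContDiffOn ℝ (⊤ : ℕ∞) (fun y' => φ (X y')) s) (v : E)
    (φ : W →ₗ[ℝ] ℝ) : ContDiffOn ℝ (⊤ : ℕ∞) (fun y => φ (weakDeriv X y v)) s := by
  simp only [weakDeriv, map_sum, map_smul, smul_eq_mul]
  exact ContDiffOn.sum fun i _ => (contDiffOn_fderiv_apply hs (hX _) v).mul contDiffOn_const

theorem weakDeriv_linearMap {W' : Type*} [AddCommGroup W'] [Module ℝ W'] [Module.Finite ℝ W']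
    {X : E → W} {y : E} (hX : ∀ φ : W →ₗ[ℝ] ℝ, DifferentiableAt ℝ (fun y' => φ (X y')) y)
    (P : W →ₗ[ℝ] W') (v : E) : weakDeriv (fun y' => P (X y')) y v = P (weakDeriv X y v) := by
  refine (Module.forall_dual_apply_eq_zero_iff ℝ _).1 (fun φ => ?_) |> sub_eq_zero.1
  rw [map_sub, apply_weakDeriv (fun ψ => hX (ψ ∘ₗ P))]
  exact sub_eq_zero.2 (apply_weakDeriv hX v (φ ∘ₗ P)).symm

theorem weakDeriv_congr {X Y : E → W} {y : E} (h : X =ᶠ[nhds y] Y) (v : E) :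
    weakDeriv X y v = weakDeriv Y y v := by
  unfold weakDeriv
  refine Finset.sum_congr rfl fun i _ => ?_
  rw [Filter.EventuallyEq.fderiv_eq (h.mono fun y' hy' => congrArg _ hy')]

end WeakCalculus

/-! ### Smoothness of families of alternating forms -/

section WeakForm

variable {E : Type u} [NormedAddCommGroup E] [NormedSpace ℝ E]

/-- Decomposable multivectors span the exterior algebra, so a regularity property stable under
linear combinations passes from the values of forms on tuples of vectors to all pairings. -/
theorem pairing_family_induction {P : (E → ℝ) → Prop}
    (hadd : ∀ f g, P f → P g → P (fun y => f y + g y))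
    (hsmul : ∀ (c : ℝ) f, P f → P (fun y => c * f y)) (α : E → (r : ℕ) → E [⋀^Fin r]→L[ℝ] ℝ)
    (h : ∀ r v, P (fun y => α y r v)) (z : ExteriorAlgebra ℝ E) : P fun y => pairing (α y) z := by
  have hz : z ∈ Submodule.span ℝ
      (Set.range fun x : Σ n, (Fin n → E) => ExteriorAlgebra.ιMulti ℝ x.1 x.2) := by
    rw [ExteriorAlgebra.ιMulti_span]; trivial
  induction hz using Submodule.span_induction with
  | mem x hx => obtain ⟨⟨r, v⟩, rfl⟩ := hx; simpa using h r v
  -- The zero function is obtained as zero times a member of the family.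
  | zero => simpa using hsmul 0 _ (h 0 0)
  | add x y _ _ hx hy => simpa using hadd _ _ hx hy
  | smul c x _ hx => simpa using hsmul c _ hx

variable [FiniteDimensional ℝ E]

/-- The values of an alternating form on the tuples of vectors of a basis. -/
def evalBasis (r : ℕ) :
    (E [⋀^Fin r]→L[ℝ] ℝ) →ₗ[ℝ] ((Fin r → Fin (Module.finrank ℝ E)) → ℝ) where
  toFun α c := α fun i => Module.finBasis ℝ E (c i)
  map_add' _ _ := rfl
  map_smul' _ _ := rfl

theorem evalBasis_injective (r : ℕ) : Function.Injective (evalBasis (E := E) r) := fun _ _ h =>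
  ContinuousAlternatingMap.toAlternatingMap_injective
    (Module.Basis.ext_alternating (Module.finBasis ℝ E) fun c _ => congrFun h c)

/-- Evaluation on tuples of basis vectors is a linear injection into a finite-dimensional space. Its
linear left inverse is continuous, so regularity can be tested on values. -/
theorem contDiffOn_alternating_iff {r : ℕ} {n : WithTop ℕ∞} {α : E → E [⋀^Fin r]→L[ℝ] ℝ}
    {s : Set E} : ContDiffOn ℝ n α s ↔ ∀ v, ContDiffOn ℝ n (fun y => α y v) s := by
  constructor
  · intro h v
    exact (ContinuousAlternatingMap.apply ℝ E ℝ v).contDiff.comp_contDiffOn h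
  · intro h
    obtain ⟨S, hS⟩ := (evalBasis (E := E) r).exists_leftInverse_of_injective
      (LinearMap.ker_eq_bot.2 (evalBasis_injective r))
    have : α = fun y => S.toContinuousLinearMap (evalBasis r (α y)) :=
      funext fun y => (LinearMap.congr_fun hS (α y)).symm
    rw [this]
    exact S.toContinuousLinearMap.contDiff.comp_contDiffOn
      (contDiffOn_pi.2 fun c => h _)

theorem contDiffOn_pairing_iff {n : WithTop ℕ∞} {α : E → (r : ℕ) → E [⋀^Fin r]→L[ℝ] ℝ}
    {s : Set E} : (∀ r, ContDiffOn ℝ n (fun y => α y r) s) ↔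
      ∀ z, ContDiffOn ℝ n (fun y => pairing (α y) z) s := by
  constructor
  · intro h
    refine pairing_family_induction (P := fun f => ContDiffOn ℝ n f s) (fun f g => ContDiffOn.add)
      (fun c f hf => contDiffOn_const.mul hf) α fun r v => ?_
    exact contDiffOn_alternating_iff.1 (h r) v
  · intro h r
    refine contDiffOn_alternating_iff.2 fun v => ?_
    simpa using h (ExteriorAlgebra.ιMulti ℝ r v)

/-- The exterior derivative in terms of the pairing with the exterior algebra. -/
theorem pairing_extDeriv {α : E → (r : ℕ) → E [⋀^Fin r]→L[ℝ] ℝ} {y : E}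
    (h : ∀ r, DifferentiableAt ℝ (fun y => α y r) y) (β : (r : ℕ) → E [⋀^Fin r]→L[ℝ] ℝ)
    (h0 : β 0 = 0) (hβ : ∀ r, β (r + 1) = extDeriv (fun y => α y r) y)
    (z : ExteriorAlgebra ℝ E) :
    pairing β z = ∑ i, fderiv ℝ (fun y' => pairing (α y')
      (CliffordAlgebra.contractLeft ((Module.finBasis ℝ E).coord i) z)) y
        (Module.finBasis ℝ E i) := by
  have hd : ∀ z, DifferentiableAt ℝ (fun y' => pairing (α y') z) y :=
    pairing_family_induction (P := fun f => DifferentiableAt ℝ f y) (fun f g hf hg => hf.add hg)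
      (fun c f hf => hf.const_mul c) α fun r v =>
        (ContinuousAlternatingMap.apply ℝ E ℝ v).differentiableAt.comp y (h r)
  -- The derivative in direction v is again a functional on the exterior algebra, so both sides can
  -- be compared on decomposable multivectors.
  let D : E → ExteriorAlgebra ℝ E →ₗ[ℝ] ℝ := fun v =>
    { toFun := fun z => fderiv ℝ (fun y' => pairing (α y') z) y v
      map_add' := fun z w => by
        simp only [map_add]
        rw [fderiv_fun_add (hd z) (hd w)]
        rfl
      map_smul' := fun c z => by
        simp only [map_smul, smul_eq_mul]
        rw [fderiv_const_mul (hd z)]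
        rfl }
  suffices pairing β = ∑ i, D (Module.finBasis ℝ E i) ∘ₗ
      CliffordAlgebra.contractLeft ((Module.finBasis ℝ E).coord i) by
    rw [this]; simp [D]
  refine linearMap_ext_ιMulti fun k v => ?_
  rw [pairing_ιMulti, LinearMap.sum_apply]
  cases k with
  | zero =>
    rw [h0, ExteriorAlgebra.ιMulti_zero_apply]
    symm
    refine Finset.sum_eq_zero fun i _ => ?_
    rw [LinearMap.comp_apply]
    erw [CliffordAlgebra.contractLeft_one]
    simp
  | succ k =>
    rw [hβ, extDeriv_apply (h k)]
    simp only [LinearMap.comp_apply, contractLeft_ιMulti, map_sum, map_smul]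
    rw [Finset.sum_comm]
    refine Finset.sum_congr rfl fun j _ => ?_
    -- Expanding the direction of differentiation in the basis produces the sum over i on the right.
    have hv : v j = ∑ i, (Module.finBasis ℝ E).coord i (v j) • Module.finBasis ℝ E i := by
      simp
    conv_lhs => rw [hv]
    rw [map_sum, Finset.smul_sum]
    refine Finset.sum_congr rfl fun i _ => ?_
    simp only [D, LinearMap.coe_mk, AddHom.coe_mk, pairing_ιMulti, map_smul, mul_smul]
    simp

end WeakForm

/-! ### Forms and multivector fields in charts -/

section Charts

variable {E : Type u} [NormedAddCommGroup E] [NormedSpace ℝ E]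
  {M : Type v} [TopologicalSpace M] [ChartedSpace E M]

theorem minSmoothness_two_le : minSmoothness ℝ 2 ≤ ((⊤ : ℕ∞) : WithTop ℕ∞) := by
  rw [minSmoothness_of_isRCLikeNormedField]
  exact WithTop.coe_le_coe.2 (le_top (a := (2 : ℕ∞)))

/-- The derivative of the preferred chart at `x`, at the point `m`. -/
def chartDeriv (x m : M) : E →L[ℝ] E :=
  mfderiv 𝓘(ℝ, E) 𝓘(ℝ, E) (extChartAt 𝓘(ℝ, E) x) m

/-- The derivative of the inverse of the preferred chart at `x`, at the point `y`. -/
def chartSymmDeriv (x : M) (y : E) : E →L[ℝ] E :=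
  mfderiv 𝓘(ℝ, E) 𝓘(ℝ, E) (extChartAt 𝓘(ℝ, E) x).symm y

section

variable [IsManifold 𝓘(ℝ, E) (⊤ : ℕ∞) M]

theorem chartDeriv_comp_chartSymmDeriv {x : M} {y : E} (hy : y ∈ (extChartAt 𝓘(ℝ, E) x).target) :
    chartDeriv x ((extChartAt 𝓘(ℝ, E) x).symm y) ∘L chartSymmDeriv x y
      = ContinuousLinearMap.id ℝ E := by
  have := mfderiv_extChartAt_comp_mfderivWithin_extChartAt_symm (I := 𝓘(ℝ, E)) hy
  rw [ModelWithCorners.range_eq_univ, mfderivWithin_univ] at this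
  exact this

theorem chartSymmDeriv_comp_chartDeriv {x : M} {y : E} (hy : y ∈ (extChartAt 𝓘(ℝ, E) x).target) :
    chartSymmDeriv x y ∘L chartDeriv x ((extChartAt 𝓘(ℝ, E) x).symm y)
      = ContinuousLinearMap.id ℝ E := by
  have := mfderivWithin_extChartAt_symm_comp_mfderiv_extChartAt (I := 𝓘(ℝ, E)) hy
  rw [ModelWithCorners.range_eq_univ, mfderivWithin_univ] at this
  exact this

theorem fderiv_coordChange {x x' : M} {y : E} (hy : y ∈ (extChartAt 𝓘(ℝ, E) x').target)
    (hx : (extChartAt 𝓘(ℝ, E) x').symm y ∈ (extChartAt 𝓘(ℝ, E) x).source) :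
    fderiv ℝ (extChartAt 𝓘(ℝ, E) x ∘ (extChartAt 𝓘(ℝ, E) x').symm) y
      = chartDeriv x ((extChartAt 𝓘(ℝ, E) x').symm y) ∘L chartSymmDeriv x' y := by
  rw [← mfderiv_eq_fderiv]
  have h1 : MDifferentiableAt 𝓘(ℝ, E) 𝓘(ℝ, E) (extChartAt 𝓘(ℝ, E) x').symm y := by
    have := mdifferentiableWithinAt_extChartAt_symm (I := 𝓘(ℝ, E)) hy
    rwa [ModelWithCorners.range_eq_univ, mdifferentiableWithinAt_univ] at this
  have h2 : MDifferentiableAt 𝓘(ℝ, E) 𝓘(ℝ, E) (extChartAt 𝓘(ℝ, E) x)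
      ((extChartAt 𝓘(ℝ, E) x').symm y) :=
    mdifferentiableAt_extChartAt (by rwa [extChartAt_source] at hx)
  exact mfderiv_comp y h2 h1

theorem contDiffAt_coordChange {x x' : M} {y : E} (hy : y ∈ (extChartAt 𝓘(ℝ, E) x').target)
    (hx : (extChartAt 𝓘(ℝ, E) x').symm y ∈ (extChartAt 𝓘(ℝ, E) x).source) :
    ContDiffAt ℝ (⊤ : ℕ∞) (extChartAt 𝓘(ℝ, E) x ∘ (extChartAt 𝓘(ℝ, E) x').symm) y := by
  have := contDiffWithinAt_ext_coord_change (I := 𝓘(ℝ, E)) (n := (⊤ : ℕ∞)) x x' (y := y)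
    ⟨hy, hx⟩
  rwa [ModelWithCorners.range_eq_univ, contDiffWithinAt_univ] at this

end

variable {r : ℕ}

/-- The value of a form at a point, in the model space. -/
def FormSection.toModel (α : FormSection E M r) (m : M) : E [⋀^Fin r]→L[ℝ] ℝ := α m

theorem FormSection.inChart_apply (α : FormSection E M r) (x : M) (y : E) :
    α.inChart x y = (α.toModel ((extChartAt 𝓘(ℝ, E) x).symm y)).compContinuousLinearMap
      (chartSymmDeriv x y) := rfl

theorem FormSection.toModel_d (α : FormSection E M r) (m : M) :
    α.d.toModel m = (extDeriv (α.inChart m) (extChartAt 𝓘(ℝ, E) m m)).compContinuousLinearMap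
      (chartDeriv m m) := rfl

/-- Both chart expressions pull back the same form at the same point; by the chain rule the
derivatives of the chart at x cancel. -/
theorem FormSection.inChart_eq_pullback [IsManifold 𝓘(ℝ, E) (⊤ : ℕ∞) M] (α : FormSection E M r)
    {x x' : M} {y : E} (hy : y ∈ (extChartAt 𝓘(ℝ, E) x').target)
    (hx : (extChartAt 𝓘(ℝ, E) x').symm y ∈ (extChartAt 𝓘(ℝ, E) x).source) :
    α.inChart x' y = (α.inChart x
      ((extChartAt 𝓘(ℝ, E) x ∘ (extChartAt 𝓘(ℝ, E) x').symm) y)).compContinuousLinearMap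
        (fderiv ℝ (extChartAt 𝓘(ℝ, E) x ∘ (extChartAt 𝓘(ℝ, E) x').symm) y) := by
  rw [fderiv_coordChange hy hx, inChart_apply, inChart_apply, Function.comp_apply]
  set m := (extChartAt 𝓘(ℝ, E) x').symm y
  have hm := chartSymmDeriv_comp_chartDeriv ((extChartAt 𝓘(ℝ, E) x).map_source hx)
  rw [(extChartAt 𝓘(ℝ, E) x).left_inv hx] at hm ⊢
  ext v
  simp only [ContinuousAlternatingMap.compContinuousLinearMap_apply]
  congr 1
  funext i
  exact (DFunLike.congr_fun hm (chartSymmDeriv x' y (v i))).symm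

/-- The exterior derivative may be computed in any chart. -/
theorem FormSection.inChart_d [IsManifold 𝓘(ℝ, E) (⊤ : ℕ∞) M] (α : FormSection E M r)
    {x : M} {y : E} (hy : y ∈ (extChartAt 𝓘(ℝ, E) x).target)
    (hα : DifferentiableAt ℝ (α.inChart x) y) : α.d.inChart x y = extDeriv (α.inChart x) y := by
  rw [inChart_apply, toModel_d]
  set m := (extChartAt 𝓘(ℝ, E) x).symm y with hm
  have hms : m ∈ (extChartAt 𝓘(ℝ, E) x).source := (extChartAt 𝓘(ℝ, E) x).map_target hy
  have hmm : m ∈ (extChartAt 𝓘(ℝ, E) m).source := mem_extChartAt_source m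
  have hmt : extChartAt 𝓘(ℝ, E) m m ∈ (extChartAt 𝓘(ℝ, E) m).target := mem_extChartAt_target m
  have hmi : (extChartAt 𝓘(ℝ, E) m).symm (extChartAt 𝓘(ℝ, E) m m) = m :=
    (extChartAt 𝓘(ℝ, E) m).left_inv hmm
  have hyy : (extChartAt 𝓘(ℝ, E) x ∘ (extChartAt 𝓘(ℝ, E) m).symm) (extChartAt 𝓘(ℝ, E) m m) = y := by
    rw [Function.comp_apply, hmi, hm, (extChartAt 𝓘(ℝ, E) x).right_inv hy]
  have hev : α.inChart m =ᶠ[nhds (extChartAt 𝓘(ℝ, E) m m)] fun y' => (α.inChart x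
      ((extChartAt 𝓘(ℝ, E) x ∘ (extChartAt 𝓘(ℝ, E) m).symm) y')).compContinuousLinearMap
        (fderiv ℝ (extChartAt 𝓘(ℝ, E) x ∘ (extChartAt 𝓘(ℝ, E) m).symm) y') := by
    have h1 : ∀ᶠ y' in nhds (extChartAt 𝓘(ℝ, E) m m), y' ∈ (extChartAt 𝓘(ℝ, E) m).target :=
      extChartAt_target_mem_nhds m
    have h2 : ∀ᶠ y' in nhds (extChartAt 𝓘(ℝ, E) m m),
        (extChartAt 𝓘(ℝ, E) m).symm y' ∈ (extChartAt 𝓘(ℝ, E) x).source :=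
      (continuousAt_extChartAt_symm m).eventually_mem
        (by rw [hmi]; exact (isOpen_extChartAt_source x).mem_nhds hms)
    filter_upwards [h1, h2] with y' h1 h2
    exact α.inChart_eq_pullback h1 h2
  -- The derivative is defined in the preferred chart at m; naturality under the coordinate change,
  -- which has the two derivatives required, moves it to the chart at x.
  rw [hev.extDeriv_eq, extDeriv_pullback (r := (⊤ : ℕ∞)) (by rwa [hyy])
    (contDiffAt_coordChange hmt (by rwa [hmi])) minSmoothness_two_le, hyy,
    fderiv_coordChange hmt (by rwa [hmi]), hmi]
  have h1 := chartSymmDeriv_comp_chartDeriv hmt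
  have h2 := chartDeriv_comp_chartSymmDeriv hy
  rw [hmi] at h1
  rw [← hm] at h2
  ext v
  simp only [ContinuousAlternatingMap.compContinuousLinearMap_apply]
  congr 1
  funext i
  have h3 := DFunLike.congr_fun h1 (chartSymmDeriv x y (v i))
  have h4 := DFunLike.congr_fun h2 (v i)
  simp only [ContinuousLinearMap.comp_apply, ContinuousLinearMap.id_apply, Function.comp_apply]
    at h3 h4 ⊢
  rw [h3, h4]

end Charts

/-! ### Forms and multivector fields as functions into the exterior algebra and its dual -/

section LocalExpressions

open CliffordAlgebra (involute contractLeft)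

variable {E : Type u} [NormedAddCommGroup E] [NormedSpace ℝ E]
  {M : Type v} [TopologicalSpace M] [ChartedSpace E M]

/-- The value of a form at a point, as a functional on the exterior algebra. -/
def Form.pair (α : Form E M) (m : M) : ExteriorAlgebra ℝ E →ₗ[ℝ] ℝ :=
  pairing fun r => (α r).toModel m

/-- The value of a multivector field at a point, in the model space. -/
def MultivectorSection.toModel {r : ℕ} (X : MultivectorSection E M r) (m : M) : ⋀[ℝ]^r E := X m

theorem MultivectorSection.inChart_apply {r : ℕ} (X : MultivectorSection E M r) (x : M) (y : E) :
    X.inChart x y = exteriorPower.map r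
      (chartDeriv x ((extChartAt 𝓘(ℝ, E) x).symm y)).toLinearMap
        (X.toModel ((extChartAt 𝓘(ℝ, E) x).symm y)) := by
  with_unfolding_all rfl

/-- The value of a multivector field at a point, as an element of the exterior algebra. -/
def Multivector.tot (X : Multivector E M) (m : M) : ExteriorAlgebra ℝ E :=
  total fun r => (X r).toModel m

/-- The expression of a form in the preferred chart at `x`. -/
def Form.loc (α : Form E M) (x : M) (y : E) : ExteriorAlgebra ℝ E →ₗ[ℝ] ℝ :=
  pairing fun r => (α r).inChart x y

/-- The expression of a multivector field in the preferred chart at `x`. -/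
def Multivector.loc (X : Multivector E M) (x : M) (y : E) : ExteriorAlgebra ℝ E :=
  total fun r => (X r).inChart x y

theorem Form.loc_apply (α : Form E M) (x : M) (y : E) (z : ExteriorAlgebra ℝ E) :
    α.loc x y z = α.pair ((extChartAt 𝓘(ℝ, E) x).symm y)
      (ExteriorAlgebra.map (chartSymmDeriv x y).toLinearMap z) :=
  pairing_compContinuousLinearMap _ _ _

theorem Multivector.loc_eq (X : Multivector E M) (x : M) (y : E) :
    X.loc x y = ExteriorAlgebra.map
      (chartDeriv x ((extChartAt 𝓘(ℝ, E) x).symm y)).toLinearMap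
        (X.tot ((extChartAt 𝓘(ℝ, E) x).symm y)) := by
  simp only [Multivector.loc, MultivectorSection.inChart_apply]
  exact total_map _ rfl _

theorem Form.ext_pair {α β : Form E M} (h : ∀ m z, α.pair m z = β.pair m z) : α = β := by
  funext r m
  exact congrFun (pairing_injective (LinearMap.ext (h m))) r

theorem Form.pair_contract (X : Multivector E M) (α : Form E M) (m : M)
    (z : ExteriorAlgebra ℝ E) :
    (Form.contract X α).pair m z = α.pair m (X.tot m * z) :=
  pairing_contract (fun r => (X r).toModel m) (fun r => (α r).toModel m) z

theorem Form.pair_add (α β : Form E M) (m : M) (z : ExteriorAlgebra ℝ E) :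
    (α + β).pair m z = α.pair m z + β.pair m z := by
  suffices (α + β).pair m = α.pair m + β.pair m by rw [this]; rfl
  refine linearMap_ext_ιMulti fun k v => ?_
  simp only [Form.pair, LinearMap.add_apply, pairing_ιMulti]
  rfl

theorem Form.pair_smul (c : ℝ) (α : Form E M) (m : M) (z : ExteriorAlgebra ℝ E) :
    (c • α).pair m z = c * α.pair m z := by
  suffices (c • α).pair m = c • α.pair m by rw [this]; rfl
  refine linearMap_ext_ιMulti fun k v => ?_
  simp only [Form.pair, LinearMap.smul_apply, pairing_ιMulti]
  rfl

theorem Multivector.tot_add (X Y : Multivector E M) (m : M) :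
    (X + Y).tot m = X.tot m + Y.tot m := by
  simp only [Multivector.tot, total, ← Finset.sum_add_distrib]
  rfl

theorem Multivector.tot_smul (c : ℝ) (X : Multivector E M) (m : M) :
    (c • X).tot m = c • X.tot m := by
  simp only [Multivector.tot, total, Finset.smul_sum]
  rfl

/-- The parity operator on forms. -/
def Form.flip (α : Form E M) : Form E M := fun r => (-1 : ℝ) ^ r • α r

/-- The parity operator on multivector fields. -/
def Multivector.flip (X : Multivector E M) : Multivector E M := fun r => (-1 : ℝ) ^ r • X r

theorem Form.pair_flip (α : Form E M) (m : M) (z : ExteriorAlgebra ℝ E) :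
    α.flip.pair m z = α.pair m (involute z) :=
  pairing_neg_one_pow (fun r => (α r).toModel m) z

theorem Multivector.tot_flip (X : Multivector E M) (m : M) : X.flip.tot m = involute (X.tot m) :=
  total_neg_one_pow fun r => (X r).toModel m

theorem Form.loc_add (α β : Form E M) (x : M) (y : E) (z : ExteriorAlgebra ℝ E) :
    (α + β).loc x y z = α.loc x y z + β.loc x y z := by
  simp only [Form.loc_apply, Form.pair_add]

theorem Form.loc_smul (c : ℝ) (α : Form E M) (x : M) (y : E) (z : ExteriorAlgebra ℝ E) :
    (c • α).loc x y z = c * α.loc x y z := by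
  simp only [Form.loc_apply, Form.pair_smul]

theorem Form.contract_add (X : Multivector E M) (α β : Form E M) :
    Form.contract X (α + β) = Form.contract X α + Form.contract X β :=
  Form.ext_pair fun m z => by simp only [Form.pair_contract, Form.pair_add]

theorem Form.contract_smul (X : Multivector E M) (c : ℝ) (α : Form E M) :
    Form.contract X (c • α) = c • Form.contract X α :=
  Form.ext_pair fun m z => by simp only [Form.pair_contract, Form.pair_smul]

theorem Form.add_contract (X Y : Multivector E M) (α : Form E M) :
    Form.contract (X + Y) α = Form.contract X α + Form.contract Y α :=
  Form.ext_pair fun m z => by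
    simp only [Form.pair_contract, Form.pair_add, Multivector.tot_add, add_mul, map_add]

theorem Form.smul_contract (c : ℝ) (X : Multivector E M) (α : Form E M) :
    Form.contract (c • X) α = c • Form.contract X α :=
  Form.ext_pair fun m z => by
    simp only [Form.pair_contract, Form.pair_smul, Multivector.tot_smul, smul_mul_assoc, map_smul,
      smul_eq_mul]

theorem Form.flip_contract (X : Multivector E M) (α : Form E M) :
    (Form.contract X α).flip = Form.contract X.flip α.flip :=
  Form.ext_pair fun m z => by
    simp only [Form.pair_contract, Form.pair_flip, Multivector.tot_flip, map_mul,
      CliffordAlgebra.involute_involute]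

theorem Form.IsSmooth.differentiableAt {α : Form E M} (hα : α.IsSmooth) {x : M} {y : E}
    (hy : y ∈ (extChartAt 𝓘(ℝ, E) x).target) (r : ℕ) : DifferentiableAt ℝ ((α r).inChart x) y :=
  ((hα r x).differentiableOn (by simp)).differentiableAt
    ((isOpen_extChartAt_target x).mem_nhds hy)

theorem Form.lieDeriv_eq (X : Multivector E M) (α : Form E M) :
    Form.lieDeriv X α = Form.d (Form.contract X α) - Form.contract X.flip (Form.d α) := rfl

section

variable [FiniteDimensional ℝ E]

theorem Multivector.ext_tot {X Y : Multivector E M} (h : ∀ m, X.tot m = Y.tot m) : X = Y := by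
  funext r m
  exact congrFun (total_injective (V := E) (h m)) r

theorem Form.isSmooth_iff (α : Form E M) : α.IsSmooth ↔
    ∀ x z, ContDiffOn ℝ (⊤ : ℕ∞) (fun y => α.loc x y z) (extChartAt 𝓘(ℝ, E) x).target :=
  ⟨fun h x => contDiffOn_pairing_iff.1 fun r => h r x,
    fun h r x => contDiffOn_pairing_iff.2 (h x) r⟩

theorem Form.IsSmooth.differentiableAt_loc {α : Form E M} (hα : α.IsSmooth) {x : M} {y : E}
    (hy : y ∈ (extChartAt 𝓘(ℝ, E) x).target) (z : ExteriorAlgebra ℝ E) :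
    DifferentiableAt ℝ (fun y => α.loc x y z) y :=
  (((Form.isSmooth_iff α).1 hα x z).differentiableOn (by simp)).differentiableAt
    ((isOpen_extChartAt_target x).mem_nhds hy)

theorem Form.IsSmooth.add {α β : Form E M} (hα : α.IsSmooth) (hβ : β.IsSmooth) :
    (α + β).IsSmooth := by
  rw [Form.isSmooth_iff] at *
  intro x z
  simp only [Form.loc_add]
  exact (hα x z).add (hβ x z)

theorem Form.IsSmooth.smul {α : Form E M} (hα : α.IsSmooth) (c : ℝ) : (c • α).IsSmooth := by
  rw [Form.isSmooth_iff] at *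
  intro x z
  simp only [Form.loc_smul]
  exact contDiffOn_const.mul (hα x z)

theorem Form.isSmooth_zero : (0 : Form E M).IsSmooth := by
  rw [Form.isSmooth_iff]
  intro x z
  have : ∀ y, (0 : Form E M).loc x y z = 0 := fun y => by
    simpa using Form.loc_smul 0 (0 : Form E M) x y z
  simp only [this]
  exact contDiffOn_const

/-- A functional on the exterior algebra restricts to each degree, and a functional on one degree
extends by composition with the projection to that degree. -/
theorem Multivector.isSmooth_iff (X : Multivector E M) : X.IsSmooth ↔
    ∀ (x : M) (φ : ExteriorAlgebra ℝ E →ₗ[ℝ] ℝ),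
      ContDiffOn ℝ (⊤ : ℕ∞) (fun y => φ (X.loc x y)) (extChartAt 𝓘(ℝ, E) x).target := by
  constructor
  · intro h x φ
    simp only [Multivector.loc, total, map_sum]
    refine ContDiffOn.sum fun r _ => ?_
    convert h r x (φ.compAlternatingMap (ExteriorAlgebra.ιMulti ℝ r)) using 2 with y
    have : φ ∘ₗ (⋀[ℝ]^r E).subtype = exteriorPower.alternatingMapLinearEquiv
        (φ.compAlternatingMap (ExteriorAlgebra.ιMulti ℝ r)) := by
      apply exteriorPower.linearMap_ext
      ext v
      simp
    exact LinearMap.congr_fun this _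
  · intro h r x l
    let P : ExteriorAlgebra ℝ E →ₗ[ℝ] ⋀[ℝ]^r E :=
      DirectSum.component ℝ ℕ (fun r => ⋀[ℝ]^r E) r ∘ₗ
        (DirectSum.decomposeLinearEquiv fun r => ⋀[ℝ]^r E).toLinearMap
    convert h x (exteriorPower.alternatingMapLinearEquiv l ∘ₗ P) using 2 with y
    rw [LinearMap.comp_apply]
    congr 1
    exact (congrFun (components_total (V := E) fun r => (X r).inChart x y) r).symm

end

/-- The exterior derivative of a function with values in the dual of the exterior algebra. -/
def dualExtDeriv [FiniteDimensional ℝ E] (A : E → ExteriorAlgebra ℝ E →ₗ[ℝ] ℝ) (y : E)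
    (z : ExteriorAlgebra ℝ E) : ℝ :=
  ∑ i, fderiv ℝ (fun y' => A y' (contractLeft ((Module.finBasis ℝ E).coord i) z)) y
    (Module.finBasis ℝ E i)

theorem dualExtDeriv_congr [FiniteDimensional ℝ E] {A B : E → ExteriorAlgebra ℝ E →ₗ[ℝ] ℝ} {y : E}
    (h : ∀ᶠ y' in nhds y, ∀ z, A y' z = B y' z) (z : ExteriorAlgebra ℝ E) :
    dualExtDeriv A y z = dualExtDeriv B y z := by
  refine Finset.sum_congr rfl fun i _ => ?_
  rw [Filter.EventuallyEq.fderiv_eq (h.mono fun y' hy' => hy' _)]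

variable [IsManifold 𝓘(ℝ, E) (⊤ : ℕ∞) M]

theorem map_chartSymmDeriv_chartDeriv {x : M} {y : E} (hy : y ∈ (extChartAt 𝓘(ℝ, E) x).target)
    (z : ExteriorAlgebra ℝ E) :
    ExteriorAlgebra.map (chartSymmDeriv x y).toLinearMap (ExteriorAlgebra.map
      (chartDeriv x ((extChartAt 𝓘(ℝ, E) x).symm y)).toLinearMap z) = z := by
  rw [← AlgHom.comp_apply, ExteriorAlgebra.map_comp_map]
  have := congrArg ContinuousLinearMap.toLinearMap (chartSymmDeriv_comp_chartDeriv hy)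
  rw [ContinuousLinearMap.toLinearMap_comp] at this
  rw [this]
  exact AlgHom.congr_fun (ExteriorAlgebra.map_id (R := ℝ) (M := E)) z

theorem Form.loc_contract (X : Multivector E M) (α : Form E M) {x : M} {y : E}
    (hy : y ∈ (extChartAt 𝓘(ℝ, E) x).target) (z : ExteriorAlgebra ℝ E) :
    (Form.contract X α).loc x y z = α.loc x y (X.loc x y * z) := by
  rw [Form.loc_apply, Form.loc_apply, Form.pair_contract, Multivector.loc_eq,
    map_mul (ExteriorAlgebra.map _), map_chartSymmDeriv_chartDeriv hy]

/-- Two forms agree if they do in charts. -/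
theorem Form.ext_loc {α β : Form E M}
    (h : ∀ m z, α.loc m (extChartAt 𝓘(ℝ, E) m m) z = β.loc m (extChartAt 𝓘(ℝ, E) m m) z) :
    α = β := by
  refine Form.ext_pair fun m z => ?_
  have h1 := h m (ExteriorAlgebra.map (chartDeriv m m).toLinearMap z)
  have h2 := map_chartSymmDeriv_chartDeriv (mem_extChartAt_target (I := 𝓘(ℝ, E)) m) z
  rw [Form.loc_apply, Form.loc_apply] at h1
  rw [extChartAt_to_inv] at h1 h2
  rwa [h2] at h1

/-- The definition of d uses a different chart at every point, so `inChart_d` is needed to express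
it in the single chart at m near m before d² = 0 on the model space applies. -/
theorem FormSection.d_d {r : ℕ} {α : FormSection E M r} (hα : α.IsSmooth) : α.d.d = 0 := by
  funext m
  have hm := mem_extChartAt_target (I := 𝓘(ℝ, E)) m
  have hev : α.d.inChart m =ᶠ[nhds (extChartAt 𝓘(ℝ, E) m m)] extDeriv (α.inChart m) := by
    filter_upwards [extChartAt_target_mem_nhds (I := 𝓘(ℝ, E)) m] with y hy
    exact α.inChart_d hy (((hα m).differentiableOn (by simp)).differentiableAt
      ((isOpen_extChartAt_target m).mem_nhds hy))
  have h : α.d.d.toModel m = 0 := by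
    rw [FormSection.toModel_d, hev.extDeriv_eq, extDeriv_extDeriv_apply
      ((hα m).contDiffAt ((isOpen_extChartAt_target m).mem_nhds hm)) minSmoothness_two_le]
    rfl
  exact h

variable [FiniteDimensional ℝ E]

theorem Form.loc_d {α : Form E M} {x : M} {y : E} (hy : y ∈ (extChartAt 𝓘(ℝ, E) x).target)
    (hα : ∀ r, DifferentiableAt ℝ ((α r).inChart x) y) (z : ExteriorAlgebra ℝ E) :
    (Form.d α).loc x y z = dualExtDeriv (α.loc x) y z := by
  refine pairing_extDeriv (α := fun y r => (α r).inChart x y) hα _ ?_ (fun r => ?_) z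
  · rfl
  · exact (α r).inChart_d hy (hα r)

theorem Form.IsSmooth.d {α : Form E M} (hα : α.IsSmooth) : (Form.d α).IsSmooth := by
  rw [Form.isSmooth_iff]
  intro x z
  refine ContDiffOn.congr ?_ fun y hy => Form.loc_d hy (hα.differentiableAt hy) z
  refine ContDiffOn.sum fun i _ => ?_
  exact contDiffOn_fderiv_apply (isOpen_extChartAt_target x) ((Form.isSmooth_iff α).1 hα x _) _

theorem Form.IsSmooth.contract {α : Form E M} (hα : α.IsSmooth) {X : Multivector E M}
    (hX : X.IsSmooth) : (Form.contract X α).IsSmooth := by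
  rw [Form.isSmooth_iff] at hα ⊢
  rw [Multivector.isSmooth_iff] at hX
  intro x z
  refine ContDiffOn.congr ?_ fun y hy => Form.loc_contract X α hy z
  exact contDiffOn_dual_apply (hα x) fun φ => hX x (φ ∘ₗ LinearMap.mulRight ℝ z)

theorem Form.d_add {α β : Form E M} (hα : α.IsSmooth) (hβ : β.IsSmooth) :
    Form.d (α + β) = Form.d α + Form.d β := by
  refine Form.ext_loc fun m z => ?_
  have hm := mem_extChartAt_target (I := 𝓘(ℝ, E)) m
  rw [Form.loc_d hm ((hα.add hβ).differentiableAt hm), Form.loc_add,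
    Form.loc_d hm (hα.differentiableAt hm), Form.loc_d hm (hβ.differentiableAt hm)]
  simp only [dualExtDeriv, ← Finset.sum_add_distrib, Form.loc_add]
  refine Finset.sum_congr rfl fun i _ => ?_
  rw [fderiv_fun_add (hα.differentiableAt_loc hm _) (hβ.differentiableAt_loc hm _)]
  rfl

theorem Form.d_smul {α : Form E M} (hα : α.IsSmooth) (c : ℝ) :
    Form.d (c • α) = c • Form.d α := by
  refine Form.ext_loc fun m z => ?_
  have hm := mem_extChartAt_target (I := 𝓘(ℝ, E)) m
  rw [Form.loc_d hm ((hα.smul c).differentiableAt hm), Form.loc_smul,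
    Form.loc_d hm (hα.differentiableAt hm)]
  simp only [dualExtDeriv, Finset.mul_sum, Form.loc_smul]
  refine Finset.sum_congr rfl fun i _ => ?_
  rw [fderiv_const_mul (hα.differentiableAt_loc hm _)]
  rfl

theorem Form.d_zero : Form.d (0 : Form E M) = 0 := by
  simpa using Form.d_smul (Form.isSmooth_zero (E := E) (M := M)) 0

theorem Form.d_d {α : Form E M} (hα : α.IsSmooth) : Form.d (Form.d α) = 0 := by
  funext r
  match r with
  | 0 => rfl
  | 1 => exact congrFun (Form.d_zero (E := E) (M := M)) 1
  | r + 2 => exact FormSection.d_d (hα r)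

end LocalExpressions

/-! ### The Schouten bracket -/

section Signs

theorem sgn_mul_self (a : ℤ) : sgn a * sgn a = 1 := by
  rw [sgn, ← mul_zpow]; simp

theorem sgn_add (a b : ℤ) : sgn (a + b) = sgn a * sgn b :=
  zpow_add₀ (by norm_num) a b

theorem sgn_neg (a : ℤ) : sgn (-a) = sgn a := by
  rw [sgn, zpow_neg, ← inv_zpow]; norm_num [sgn]

theorem sgn_sub (a b : ℤ) : sgn (a - b) = sgn a * sgn b := by
  rw [sub_eq_add_neg, sgn_add, sgn_neg]

@[simp]
theorem sgn_one : sgn 1 = -1 := by simp [sgn]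

theorem sgn_eq_or (a : ℤ) : sgn a = 1 ∨ sgn a = -1 := by
  rcases Int.even_or_odd a with h | h
  · exact Or.inl h.neg_one_zpow
  · exact Or.inr h.neg_one_zpow

theorem sgn_mul_comm (a b : ℤ) : sgn (a * b) = sgn (b * a) := by rw [mul_comm]

end Signs

section Algebra

open CliffordAlgebra (involute contractLeft)

variable {V : Type u} [AddCommGroup V] [Module ℝ V]

/-- An even factor commutes with everything, and an odd one passes x at the cost of replacing x by
`involute x`. Parities alone fix the sign; homogeneity in degree is not required. -/
theorem mul_comm_of_parity {r s : ℤ} {x y : ExteriorAlgebra ℝ V} (hx : involute x = sgn r • x)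
    (hy : involute y = sgn s • y) : x * y = sgn (r * s) • (y * x) := by
  rcases Int.even_or_odd s with h | h
  · have h1 : sgn s = 1 := h.neg_one_zpow
    have h2 : sgn (r * s) = 1 := (h.mul_left r).neg_one_zpow
    rw [h1, one_smul] at hy
    rw [h2, one_smul, mul_comm_of_even hy]
  · have h1 : sgn s = -1 := h.neg_one_zpow
    have h2 : sgn (r * s) = sgn r := by
      obtain ⟨k, rfl⟩ := h
      rw [show r * (2 * k + 1) = r * k + r * k + r by ring, sgn_add, sgn_add, sgn_mul_self, one_mul]
    rw [h1, neg_one_smul] at hy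
    rw [h2, mul_eq_involute_mul_of_odd hy, hx, smul_mul_assoc, smul_smul, sgn_mul_self, one_smul]

theorem involute_contractLeft_of_parity {r : ℤ} {x : ExteriorAlgebra ℝ V}
    (hx : involute x = sgn r • x) (e : Module.Dual ℝ V) :
    involute (contractLeft e x) = sgn (r - 1) • contractLeft e x := by
  rw [involute_contractLeft, hx, map_smul, sgn_sub, sgn_one, mul_neg_one, neg_smul]

theorem involute_map {W : Type v} [AddCommGroup W] [Module ℝ W] (f : V →ₗ[ℝ] W)
    (x : ExteriorAlgebra ℝ V) :
    involute (ExteriorAlgebra.map f x) = ExteriorAlgebra.map f (involute x) := by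
  induction x using CliffordAlgebra.left_induction with
  | algebraMap r => rw [AlgHom.commutes, AlgHom.commutes, AlgHom.commutes, AlgHom.commutes]
  | add x y hx hy => rw [map_add, map_add, hx, hy, map_add, map_add]
  | ι_mul x m hx =>
    have h : ExteriorAlgebra.map f (CliffordAlgebra.ι 0 m) = CliffordAlgebra.ι 0 (f m) :=
      ExteriorAlgebra.map_apply_ι f m
    rw [map_mul, map_mul, map_mul, map_mul, hx, CliffordAlgebra.involute_ι, map_neg, h,
      CliffordAlgebra.involute_ι]

/-- The derived bracket has vanishing symbol: with e ∧ in place of d, the commutator with i_X is a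
contraction along e ⌟ X up to sign, and contractions commute up to sign. Hence the derived bracket
does not differentiate the form. -/
theorem contractLeft_identity {r s : ℤ} {X Y : ExteriorAlgebra ℝ V} (hX : involute X = sgn r • X)
    (hY : involute Y = sgn s • Y) (e : Module.Dual ℝ V) (a : ExteriorAlgebra ℝ V →ₗ[ℝ] ℝ)
    (z : ExteriorAlgebra ℝ V) :
    a (Y * (X * contractLeft e z)) - sgn r * a (Y * contractLeft e (X * z))
      - sgn ((r - 1) * s) * (a (X * contractLeft e (Y * z))
        - sgn r * a (contractLeft e (X * (Y * z)))) = 0 := by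
  have hXY : ∀ w, a (X * (Y * w)) = sgn (r * s) * a (Y * (X * w)) := fun w => by
    rw [← mul_assoc, mul_comm_of_parity hX hY, smul_mul_assoc, map_smul, mul_assoc, smul_eq_mul]
  have hX' : a (contractLeft e X * (Y * z))
      = sgn ((r - 1) * s) * a (Y * (contractLeft e X * z)) := by
    rw [← mul_assoc, mul_comm_of_parity (involute_contractLeft_of_parity hX e) hY, smul_mul_assoc,
      map_smul, mul_assoc, smul_eq_mul]
  have hs : sgn ((r - 1) * s) = sgn (r * s) * sgn s := by rw [sub_mul, one_mul, sgn_sub]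
  simp only [contractLeft_mul, hX, hY, mul_add, map_add, smul_mul_assoc, mul_smul_comm, map_smul,
    smul_eq_mul, hXY, hX']
  rw [hs]
  have h1 := sgn_mul_self r
  have h2 := sgn_mul_self s
  have h3 := sgn_mul_self (r * s)
  generalize sgn (r * s) = c at *
  generalize sgn r = p at *
  generalize sgn s = q at *
  generalize a (Y * (X * contractLeft e z)) = m₁
  generalize a (Y * (contractLeft e X * z)) = m₂
  generalize a (X * (contractLeft e Y * z)) = m₃
  have h4 : (c * q) * (c * q) = 1 := by linear_combination q ^ 2 * h3 + h2
  linear_combination (-m₁ + m₁ * (c * q) ^ 2 + c * q * m₃) * h1 + p * m₂ * h4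

/-- Here X' and Y' stand for derivatives of X and Y. By the antiderivation rule the terms containing
e ⌟ z cancel; what remains is multiplication by Y' (e ⌟ X) and X' (e ⌟ Y), the summands of the
Schouten bracket. -/
theorem contractLeft_derivative_identity {r s : ℤ} {X Y X' Y' : ExteriorAlgebra ℝ V}
    (hX : involute X = sgn r • X) (hX' : involute X' = sgn r • X') (hY : involute Y = sgn s • Y)
    (e : Module.Dual ℝ V) (a : ExteriorAlgebra ℝ V →ₗ[ℝ] ℝ) (z : ExteriorAlgebra ℝ V) :
    a (Y' * (X * contractLeft e z)) + a (Y * (X' * contractLeft e z))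
      - sgn r * a (Y' * contractLeft e (X * z))
      - sgn ((r - 1) * s) * a (X' * contractLeft e (Y * z))
      = -(sgn r * a (Y' * contractLeft e X * z)
        + sgn ((r - 1) * s) * a (X' * contractLeft e Y * z)) := by
  have hXY : ∀ w, a (X' * (Y * w)) = sgn (r * s) * a (Y * (X' * w)) := fun w => by
    rw [← mul_assoc, mul_comm_of_parity hX' hY, smul_mul_assoc, map_smul, mul_assoc, smul_eq_mul]
  have hs : sgn ((r - 1) * s) = sgn (r * s) * sgn s := by rw [sub_mul, one_mul, sgn_sub]
  simp only [contractLeft_mul, hX, hY, mul_add, map_add, smul_mul_assoc, mul_smul_comm, map_smul,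
    smul_eq_mul, hXY, mul_assoc]
  rw [hs]
  have h1 := sgn_mul_self r
  have h2 := sgn_mul_self s
  have h3 := sgn_mul_self (r * s)
  generalize sgn (r * s) = c at *
  generalize sgn r = p at *
  generalize sgn s = q at *
  linear_combination (-a (Y' * (X * contractLeft e z))) * h1
    + (-a (Y * (X' * contractLeft e z))) * (q ^ 2 * h3 + h2)

end Algebra

/-! ### The Schouten bracket in a chart -/

section LocalBracket

open CliffordAlgebra (involute contractLeft)

variable {E : Type u} [NormedAddCommGroup E] [NormedSpace ℝ E]

theorem exists_fderiv_eq {A : E → ExteriorAlgebra ℝ E →ₗ[ℝ] ℝ} {y : E}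
    (hA : ∀ z, DifferentiableAt ℝ (fun y' => A y' z) y) (v : E) :
    ∃ a : ExteriorAlgebra ℝ E →ₗ[ℝ] ℝ, ∀ z, fderiv ℝ (fun y' => A y' z) y v = a z :=
  ⟨{ toFun := fun z => fderiv ℝ (fun y' => A y' z) y v
     map_add' := fun z w => by
        simp only [map_add]
        rw [fderiv_fun_add (hA z) (hA w)]
        rfl
     map_smul' := fun c z => by
        simp only [map_smul, smul_eq_mul]
        rw [fderiv_const_mul (hA z)]
        rfl }, fun _ => rfl⟩

variable [FiniteDimensional ℝ E]

/-- The Schouten bracket of two multivector fields of parities `r` and `s`, in a chart. -/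
def localBracket (r s : ℤ) (X Y : E → ExteriorAlgebra ℝ E) (y : E) : ExteriorAlgebra ℝ E :=
  -∑ i, (sgn r • (weakDeriv Y y (Module.finBasis ℝ E i)
        * contractLeft ((Module.finBasis ℝ E).coord i) (X y))
      + sgn ((r - 1) * s) • (weakDeriv X y (Module.finBasis ℝ E i)
        * contractLeft ((Module.finBasis ℝ E).coord i) (Y y)))

theorem weakDeriv_mul_const {X : E → ExteriorAlgebra ℝ E} {y : E}
    (hX : ∀ φ : ExteriorAlgebra ℝ E →ₗ[ℝ] ℝ, DifferentiableAt ℝ (fun y' => φ (X y')) y)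
    (w : ExteriorAlgebra ℝ E) (v : E) :
    weakDeriv (fun y' => X y' * w) y v = weakDeriv X y v * w :=
  weakDeriv_linearMap hX (LinearMap.mulRight ℝ w) v

theorem involute_weakDeriv {r : ℤ} {X : E → ExteriorAlgebra ℝ E} {y : E}
    (hX : ∀ φ : ExteriorAlgebra ℝ E →ₗ[ℝ] ℝ, DifferentiableAt ℝ (fun y' => φ (X y')) y)
    (hr : ∀ᶠ y' in nhds y, involute (X y') = sgn r • X y') (v : E) :
    involute (weakDeriv X y v) = sgn r • weakDeriv X y v := by
  have h1 := weakDeriv_linearMap hX involute.toLinearMap v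
  have h2 := weakDeriv_linearMap hX (sgn r • LinearMap.id) v
  simp only [AlgHom.toLinearMap_apply, LinearMap.smul_apply, LinearMap.id_apply] at h1 h2
  rw [← h1, ← h2]
  exact weakDeriv_congr hr v

/-- The derived bracket `[[d, i_X], i_Y]` is the contraction along the Schouten bracket. -/
theorem dualExtDeriv_bracket {r s : ℤ} {A : E → ExteriorAlgebra ℝ E →ₗ[ℝ] ℝ}
    {X Y : E → ExteriorAlgebra ℝ E} {y : E}
    (hA : ∀ z, DifferentiableAt ℝ (fun y' => A y' z) y)
    (hX : ∀ φ : ExteriorAlgebra ℝ E →ₗ[ℝ] ℝ, DifferentiableAt ℝ (fun y' => φ (X y')) y)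
    (hY : ∀ φ : ExteriorAlgebra ℝ E →ₗ[ℝ] ℝ, DifferentiableAt ℝ (fun y' => φ (Y y')) y)
    (hr : ∀ᶠ y' in nhds y, involute (X y') = sgn r • X y')
    (hs : involute (Y y) = sgn s • Y y) (z : ExteriorAlgebra ℝ E) :
    dualExtDeriv (fun y' => A y' ∘ₗ LinearMap.mulLeft ℝ (Y y') ∘ₗ LinearMap.mulLeft ℝ (X y')) y z
      - sgn r * dualExtDeriv (fun y' => A y' ∘ₗ LinearMap.mulLeft ℝ (Y y')) y (X y * z)
      - sgn ((r - 1) * s) *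
        (dualExtDeriv (fun y' => A y' ∘ₗ LinearMap.mulLeft ℝ (X y')) y (Y y * z)
          - sgn r * dualExtDeriv A y (X y * (Y y * z)))
      = A y (localBracket r s X Y y * z) := by
  simp only [dualExtDeriv, localBracket, neg_mul, Finset.sum_mul, map_neg, map_sum, Finset.mul_sum,
    ← Finset.sum_sub_distrib, ← Finset.sum_neg_distrib]
  refine Finset.sum_congr rfl fun i _ => ?_
  set v := Module.finBasis ℝ E i
  set e := (Module.finBasis ℝ E).coord i
  obtain ⟨a, ha⟩ := exists_fderiv_eq hA v
  have hY' : ∀ w (φ : ExteriorAlgebra ℝ E →ₗ[ℝ] ℝ),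
      DifferentiableAt ℝ (fun y' => φ (Y y' * w)) y :=
    fun w φ => hY (φ ∘ₗ LinearMap.mulRight ℝ w)
  have hX' : ∀ w (φ : ExteriorAlgebra ℝ E →ₗ[ℝ] ℝ),
      DifferentiableAt ℝ (fun y' => φ (X y' * w)) y :=
    fun w φ => hX (φ ∘ₗ LinearMap.mulRight ℝ w)
  have hAY : ∀ w, DifferentiableAt ℝ (fun y' => (A y' ∘ₗ LinearMap.mulLeft ℝ (Y y')) w) y :=
    fun w => differentiableAt_dual_apply (A := A) (X := fun y' => Y y' * w) hA (hY' w)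
  have dY : ∀ w, fderiv ℝ (fun y' => (A y' ∘ₗ LinearMap.mulLeft ℝ (Y y')) w) y v
      = a (Y y * w) + A y (weakDeriv Y y v * w) := fun w => by
    have := fderiv_dual_apply hA (hY' w) v
    rw [ha, weakDeriv_mul_const hY] at this
    exact this
  have dX : ∀ w, fderiv ℝ (fun y' => (A y' ∘ₗ LinearMap.mulLeft ℝ (X y')) w) y v
      = a (X y * w) + A y (weakDeriv X y v * w) := fun w => by
    have := fderiv_dual_apply hA (hX' w) v
    rw [ha, weakDeriv_mul_const hX] at this
    exact this
  have dYX : ∀ w, fderiv ℝ (fun y' =>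
      (A y' ∘ₗ LinearMap.mulLeft ℝ (Y y') ∘ₗ LinearMap.mulLeft ℝ (X y')) w) y v
      = a (Y y * (X y * w)) + A y (weakDeriv Y y v * (X y * w))
        + A y (Y y * (weakDeriv X y v * w)) := fun w => by
    have := fderiv_dual_apply hAY (hX' w) v
    rw [dY, weakDeriv_mul_const hX] at this
    exact this
  rw [dYX, dY, dX, ha]
  -- `h1` removes all terms in which A is differentiated; `h2` collects those in which X or Y is.
  have h1 := contractLeft_identity hr.self_of_nhds hs e a z
  have h2 := contractLeft_derivative_identity (Y' := weakDeriv Y y v) hr.self_of_nhds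
    (involute_weakDeriv hX hr v) hs e (A y) z
  simp only [add_mul, map_add, smul_mul_assoc, map_smul, smul_eq_mul]
  linear_combination h1 + h2

theorem involute_localBracket {r s : ℤ} {X Y : E → ExteriorAlgebra ℝ E} {y : E}
    (hX : ∀ φ : ExteriorAlgebra ℝ E →ₗ[ℝ] ℝ, DifferentiableAt ℝ (fun y' => φ (X y')) y)
    (hY : ∀ φ : ExteriorAlgebra ℝ E →ₗ[ℝ] ℝ, DifferentiableAt ℝ (fun y' => φ (Y y')) y)
    (hr : ∀ᶠ y' in nhds y, involute (X y') = sgn r • X y')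
    (hs : ∀ᶠ y' in nhds y, involute (Y y') = sgn s • Y y') :
    involute (localBracket r s X Y y) = sgn (r + s - 1) • localBracket r s X Y y := by
  simp only [localBracket, map_neg, map_sum, map_add, map_smul, map_mul, smul_neg, Finset.smul_sum]
  congr 1
  refine Finset.sum_congr rfl fun i _ => ?_
  rw [involute_weakDeriv hX hr, involute_weakDeriv hY hs,
    involute_contractLeft_of_parity hr.self_of_nhds, involute_contractLeft_of_parity hs.self_of_nhds]
  simp only [smul_mul_smul_comm, smul_add, sgn_sub, sgn_add]
  module

theorem contDiffOn_localBracket (r s : ℤ) {X Y : E → ExteriorAlgebra ℝ E} {U : Set E}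
    (hU : IsOpen U)
    (hX : ∀ φ : ExteriorAlgebra ℝ E →ₗ[ℝ] ℝ, ContDiffOn ℝ (⊤ : ℕ∞) (fun y' => φ (X y')) U)
    (hY : ∀ φ : ExteriorAlgebra ℝ E →ₗ[ℝ] ℝ, ContDiffOn ℝ (⊤ : ℕ∞) (fun y' => φ (Y y')) U)
    (φ : ExteriorAlgebra ℝ E →ₗ[ℝ] ℝ) :
    ContDiffOn ℝ (⊤ : ℕ∞) (fun y => φ (localBracket r s X Y y)) U := by
  have key : ∀ (F G : E → ExteriorAlgebra ℝ E),
      (∀ φ : ExteriorAlgebra ℝ E →ₗ[ℝ] ℝ, ContDiffOn ℝ (⊤ : ℕ∞) (fun y' => φ (F y')) U) →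
      (∀ φ : ExteriorAlgebra ℝ E →ₗ[ℝ] ℝ, ContDiffOn ℝ (⊤ : ℕ∞) (fun y' => φ (G y')) U) →
      ContDiffOn ℝ (⊤ : ℕ∞) (fun y => φ (F y * G y)) U := fun F G hF hG =>
    contDiffOn_dual_apply (A := fun y => φ ∘ₗ LinearMap.mulLeft ℝ (F y))
      (fun z => hF (φ ∘ₗ LinearMap.mulRight ℝ z)) hG
  simp only [localBracket, map_neg, map_sum, map_add, map_smul, smul_eq_mul]
  refine ContDiffOn.neg (ContDiffOn.sum fun i _ => ContDiffOn.add ?_ ?_)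
  · exact contDiffOn_const.mul (key _ _ (contDiffOn_weakDeriv hU hY _)
      fun ψ => hX (ψ ∘ₗ contractLeft _))
  · exact contDiffOn_const.mul (key _ _ (contDiffOn_weakDeriv hU hX _)
      fun ψ => hY (ψ ∘ₗ contractLeft _))

end LocalBracket

/-! ### Regularity tested by pairings, and constant forms as functionals -/

section WeakDifferentiability

variable {E : Type u} [NormedAddCommGroup E] [NormedSpace ℝ E] [FiniteDimensional ℝ E]

theorem differentiableAt_alternating_iff {r : ℕ} {α : E → E [⋀^Fin r]→L[ℝ] ℝ} {y : E} :
    DifferentiableAt ℝ α y ↔ ∀ v, DifferentiableAt ℝ (fun y => α y v) y := by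
  constructor
  · intro h v
    exact (ContinuousAlternatingMap.apply ℝ E ℝ v).differentiableAt.comp y h
  · intro h
    obtain ⟨S, hS⟩ := (evalBasis (E := E) r).exists_leftInverse_of_injective
      (LinearMap.ker_eq_bot.2 (evalBasis_injective r))
    have : α = fun y => S.toContinuousLinearMap (evalBasis r (α y)) :=
      funext fun y => (LinearMap.congr_fun hS (α y)).symm
    rw [this]
    exact S.toContinuousLinearMap.differentiableAt.comp y (differentiableAt_pi.2 fun c => h _)

theorem differentiableAt_pairing_iff {α : E → (r : ℕ) → E [⋀^Fin r]→L[ℝ] ℝ} {y : E} :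
    (∀ r, DifferentiableAt ℝ (fun y => α y r) y) ↔
      ∀ z, DifferentiableAt ℝ (fun y => pairing (α y) z) y := by
  constructor
  · intro h
    exact pairing_family_induction (P := fun f => DifferentiableAt ℝ f y)
      (fun f g hf hg => hf.add hg) (fun c f hf => hf.const_mul c) α
      fun r => differentiableAt_alternating_iff.1 (h r)
  · intro h r
    refine differentiableAt_alternating_iff.2 fun v => ?_
    simpa using h (ExteriorAlgebra.ιMulti ℝ r v)

theorem continuous_alternatingMap {r : ℕ} (f : E [⋀^Fin r]→ₗ[ℝ] ℝ) : Continuous f := by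
  let b := Module.finBasis ℝ E
  have h : ∀ v, f v = ∑ c : Fin r → Fin (Module.finrank ℝ E),
      (∏ i, b.coord (c i) (v i)) * f (fun i => b (c i)) := fun v => by
    have hv : v = fun i => ∑ j, b.coord j (v i) • b j := funext fun i => by simp
    conv_lhs => rw [hv]
    refine (f.toMultilinearMap.map_sum fun i j => b.coord j (v i) • b j).trans ?_
    refine Finset.sum_congr rfl fun c _ => ?_
    exact f.toMultilinearMap.map_smul_univ (fun i => b.coord (c i) (v i)) fun i => b (c i)
  have h' : (f : (Fin r → E) → ℝ) = fun v => ∑ c : Fin r → Fin (Module.finrank ℝ E),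
      (∏ i, b.coord (c i) (v i)) * f (fun i => b (c i)) := funext h
  rw [h']
  refine continuous_finsetSum _ fun c _ => Continuous.mul (continuous_finsetProd _ fun i _ => ?_)
    continuous_const
  exact (LinearMap.continuous_of_finiteDimensional (b.coord (c i))).comp (continuous_apply i)

/-- Alternating maps on a finite-dimensional space are continuous, so every functional comes from
constant forms. Constant forms therefore separate multivectors. -/
theorem pairing_surjective (φ : ExteriorAlgebra ℝ E →ₗ[ℝ] ℝ) :
    ∃ l : (r : ℕ) → E [⋀^Fin r]→L[ℝ] ℝ, pairing l = φ := by
  refine ⟨fun r => { φ.compAlternatingMap (ExteriorAlgebra.ιMulti ℝ r) with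
    cont := continuous_alternatingMap (φ.compAlternatingMap (ExteriorAlgebra.ιMulti ℝ r)) },
    linearMap_ext_ιMulti fun k v => ?_⟩
  rw [pairing_ιMulti]
  rfl

end WeakDifferentiability

/-! ### The Schouten bracket on a manifold -/

section Bracket

open CliffordAlgebra (involute contractLeft)

variable {E : Type u} [NormedAddCommGroup E] [NormedSpace ℝ E]
  {M : Type v} [TopologicalSpace M] [ChartedSpace E M]

theorem Multivector.involute_tot {X : Multivector E M} {r : ℤ} (hX : X.flip = sgn r • X) (m : M) :
    involute (X.tot m) = sgn r • X.tot m := by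
  rw [← Multivector.tot_flip, hX, Multivector.tot_smul]

theorem Multivector.involute_loc {X : Multivector E M} {r : ℤ} (hX : X.flip = sgn r • X) (x : M)
    (y : E) : involute (X.loc x y) = sgn r • X.loc x y := by
  rw [Multivector.loc_eq, involute_map, Multivector.involute_tot hX, map_smul]

/-- The form with constant coefficients in the preferred chart at `x`. -/
def constForm (x : M) (l : (r : ℕ) → E [⋀^Fin r]→L[ℝ] ℝ) : Form E M := fun r m =>
  ((l r).compContinuousLinearMap (chartDeriv x m) : E [⋀^Fin r]→L[ℝ] ℝ)

/-- The derived bracket `[[d, i_X], i_Y]` of contractions along multivector fields of parities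
`r` and `s`. -/
def derivedBracket (r s : ℤ) (X Y : Multivector E M) (α : Form E M) : Form E M :=
  (Form.d (Form.contract X (Form.contract Y α))
      - sgn r • Form.contract X (Form.d (Form.contract Y α)))
    - sgn ((r - 1) * s) • (Form.contract Y (Form.d (Form.contract X α))
      - sgn r • Form.contract Y (Form.contract X (Form.d α)))

theorem contract_comm_of_parity {r s : ℤ} {X Y : Multivector E M} (hr : X.flip = sgn r • X)
    (hs : Y.flip = sgn s • Y) (α : Form E M) :
    Form.contract X (Form.contract Y α) = sgn (r * s) • Form.contract Y (Form.contract X α) :=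
  Form.ext_pair fun m z => by
    rw [Form.pair_smul, Form.pair_contract, Form.pair_contract, Form.pair_contract,
      Form.pair_contract, ← mul_assoc, ← mul_assoc, mul_comm_of_parity
      (Multivector.involute_tot hs m) (Multivector.involute_tot hr m), smul_mul_assoc, map_smul,
      mul_comm s r, smul_eq_mul]

theorem Form.loc_sub (α β : Form E M) (x : M) (y : E) (z : ExteriorAlgebra ℝ E) :
    (α - β).loc x y z = α.loc x y z - β.loc x y z := by
  have : α - β = α + (-1 : ℝ) • β := by rw [neg_one_smul ℝ β, sub_eq_add_neg]
  rw [this, Form.loc_add, Form.loc_smul]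
  ring

section

variable [FiniteDimensional ℝ E]

theorem Multivector.IsSmooth.differentiableAt_loc {X : Multivector E M} (hX : X.IsSmooth) {x : M}
    {y : E} (hy : y ∈ (extChartAt 𝓘(ℝ, E) x).target) (φ : ExteriorAlgebra ℝ E →ₗ[ℝ] ℝ) :
    DifferentiableAt ℝ (fun y => φ (X.loc x y)) y :=
  (((Multivector.isSmooth_iff X).1 hX x φ).differentiableOn (by simp)).differentiableAt
    ((isOpen_extChartAt_target x).mem_nhds hy)

/-- The Schouten bracket of two multivector fields of parities `r` and `s`. -/
def schoutenBracket (r s : ℤ) (X Y : Multivector E M) : Multivector E M := fun k m =>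
  (components (ExteriorAlgebra.map
    (chartSymmDeriv m (extChartAt 𝓘(ℝ, E) m m)).toLinearMap
      (localBracket r s (X.loc m) (Y.loc m) (extChartAt 𝓘(ℝ, E) m m))) k : ⋀[ℝ]^k E)

theorem tot_schoutenBracket (r s : ℤ) (X Y : Multivector E M) (m : M) :
    (schoutenBracket r s X Y).tot m = ExteriorAlgebra.map
      (chartSymmDeriv m (extChartAt 𝓘(ℝ, E) m m)).toLinearMap
        (localBracket r s (X.loc m) (Y.loc m) (extChartAt 𝓘(ℝ, E) m m)) :=
  total_components _

theorem flip_schoutenBracket {r s : ℤ} {X Y : Multivector E M} (hX : X.IsSmooth)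
    (hY : Y.IsSmooth) (hr : X.flip = sgn r • X) (hs : Y.flip = sgn s • Y) :
    (schoutenBracket r s X Y).flip = sgn (r + s - 1) • schoutenBracket r s X Y := by
  refine Multivector.ext_tot fun m => ?_
  have hm := mem_extChartAt_target (I := 𝓘(ℝ, E)) m
  rw [Multivector.tot_flip, Multivector.tot_smul, tot_schoutenBracket, involute_map,
    involute_localBracket (fun φ => hX.differentiableAt_loc hm φ)
      (fun φ => hY.differentiableAt_loc hm φ)
      (Filter.Eventually.of_forall (Multivector.involute_loc hr m))
      (Filter.Eventually.of_forall (Multivector.involute_loc hs m)), map_smul]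

end

variable [IsManifold 𝓘(ℝ, E) (⊤ : ℕ∞) M]

theorem constForm_inChart (x : M) (l : (r : ℕ) → E [⋀^Fin r]→L[ℝ] ℝ) (r : ℕ) {y : E}
    (hy : y ∈ (extChartAt 𝓘(ℝ, E) x).target) :
    FormSection.inChart (constForm x l r) x y = l r := by
  have h := chartDeriv_comp_chartSymmDeriv hy
  ext v
  change l r (fun i => (chartDeriv x ((extChartAt 𝓘(ℝ, E) x).symm y) ∘L chartSymmDeriv x y) (v i))
    = l r v
  rw [h]
  rfl

theorem Form.pair_eq_loc (α : Form E M) {x : M} {y : E} (hy : y ∈ (extChartAt 𝓘(ℝ, E) x).target)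
    (w : ExteriorAlgebra ℝ E) :
    α.pair ((extChartAt 𝓘(ℝ, E) x).symm y) w = α.loc x y
      (ExteriorAlgebra.map (chartDeriv x ((extChartAt 𝓘(ℝ, E) x).symm y)).toLinearMap w) := by
  rw [Form.loc_apply, map_chartSymmDeriv_chartDeriv hy]

/-- `constForm` is controlled in its own chart only, whereas d at a point is defined by the
preferred chart of that point; the smooth coordinate change connects the two. -/
theorem differentiableAt_inChart_of_chart {α : Form E M} {x : M} {y : E}
    (hy : y ∈ (extChartAt 𝓘(ℝ, E) x).target) {r : ℕ} (hα : DifferentiableAt ℝ ((α r).inChart x) y) :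
    DifferentiableAt ℝ ((α r).inChart ((extChartAt 𝓘(ℝ, E) x).symm y))
      (extChartAt 𝓘(ℝ, E) ((extChartAt 𝓘(ℝ, E) x).symm y) ((extChartAt 𝓘(ℝ, E) x).symm y)) := by
  set m := (extChartAt 𝓘(ℝ, E) x).symm y with hm
  have hms : m ∈ (extChartAt 𝓘(ℝ, E) x).source := (extChartAt 𝓘(ℝ, E) x).map_target hy
  have hmt : extChartAt 𝓘(ℝ, E) m m ∈ (extChartAt 𝓘(ℝ, E) m).target := mem_extChartAt_target m
  have hmi : (extChartAt 𝓘(ℝ, E) m).symm (extChartAt 𝓘(ℝ, E) m m) = m := extChartAt_to_inv m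
  have hyy : (extChartAt 𝓘(ℝ, E) x ∘ (extChartAt 𝓘(ℝ, E) m).symm) (extChartAt 𝓘(ℝ, E) m m) = y := by
    rw [Function.comp_apply, hmi, hm, (extChartAt 𝓘(ℝ, E) x).right_inv hy]
  have h1 : ∀ᶠ y' in nhds (extChartAt 𝓘(ℝ, E) m m), y' ∈ (extChartAt 𝓘(ℝ, E) m).target :=
    extChartAt_target_mem_nhds m
  have h2 : ∀ᶠ y' in nhds (extChartAt 𝓘(ℝ, E) m m),
      (extChartAt 𝓘(ℝ, E) m).symm y' ∈ (extChartAt 𝓘(ℝ, E) x).source :=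
    (continuousAt_extChartAt_symm m).eventually_mem
      (by rw [hmi]; exact (isOpen_extChartAt_source x).mem_nhds hms)
  have hc := contDiffAt_coordChange (x := x) hmt (by rwa [hmi])
  refine DifferentiableAt.congr_of_eventuallyEq (f := fun y' => ((α r).inChart x
      ((extChartAt 𝓘(ℝ, E) x ∘ (extChartAt 𝓘(ℝ, E) m).symm) y')).compContinuousLinearMap
        (fderiv ℝ (extChartAt 𝓘(ℝ, E) x ∘ (extChartAt 𝓘(ℝ, E) m).symm) y')) ?_ ?_
  · refine DifferentiableAt.continuousAlternatingMapCompContinuousLinearMap ?_ ?_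
    · exact DifferentiableAt.comp _ (by rwa [hyy]) (hc.differentiableAt (by simp))
    · exact (hc.fderiv_right (m := 1) (WithTop.coe_le_coe.2 le_top)).differentiableAt (by simp)
  · filter_upwards [h1, h2] with y' h1 h2
    exact (α r).inChart_eq_pullback h1 h2

variable [FiniteDimensional ℝ E]

theorem Form.differentiableAt_contract {α : Form E M} {X : Multivector E M} (hX : X.IsSmooth)
    {x : M} {y : E} (hy : y ∈ (extChartAt 𝓘(ℝ, E) x).target)
    (hα : ∀ r, DifferentiableAt ℝ ((α r).inChart x) y) (r : ℕ) :
    DifferentiableAt ℝ ((Form.contract X α r).inChart x) y := by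
  revert r
  refine differentiableAt_pairing_iff.2 fun z => ?_
  refine DifferentiableAt.congr_of_eventuallyEq
    (f := fun y => α.loc x y (X.loc x y * z)) ?_ ?_
  · exact differentiableAt_dual_apply (differentiableAt_pairing_iff.1 hα)
      fun φ => hX.differentiableAt_loc hy (φ ∘ₗ LinearMap.mulRight ℝ z)
  · filter_upwards [(isOpen_extChartAt_target x).mem_nhds hy] with y' hy'
    exact Form.loc_contract X α hy' z

theorem loc_derivedBracket {r s : ℤ} {X Y : Multivector E M} (hX : X.IsSmooth) (hY : Y.IsSmooth)
    (hr : X.flip = sgn r • X) (hs : Y.flip = sgn s • Y) {α : Form E M} {x : M} {y : E}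
    (hy : y ∈ (extChartAt 𝓘(ℝ, E) x).target)
    (hα : ∀ r, DifferentiableAt ℝ ((α r).inChart x) y) (z : ExteriorAlgebra ℝ E) :
    (derivedBracket r s X Y α).loc x y z
      = α.loc x y (localBracket r s (X.loc x) (Y.loc x) y * z) := by
  have hev : ∀ᶠ y' in nhds y, y' ∈ (extChartAt 𝓘(ℝ, E) x).target :=
    (isOpen_extChartAt_target x).mem_nhds hy
  have hYα := Form.differentiableAt_contract hY hy hα
  have hXα := Form.differentiableAt_contract hX hy hα
  have hXYα := Form.differentiableAt_contract hX hy hYα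
  simp only [derivedBracket, Form.loc_sub, Form.loc_smul, Form.loc_contract _ _ hy]
  rw [Form.loc_d hy hXYα, Form.loc_d hy hYα, Form.loc_d hy hXα, Form.loc_d hy hα,
    ← dualExtDeriv_bracket (A := α.loc x) (differentiableAt_pairing_iff.1 hα)
      (fun φ => hX.differentiableAt_loc hy φ) (fun φ => hY.differentiableAt_loc hy φ)
      (Filter.Eventually.of_forall (Multivector.involute_loc hr x)) (Multivector.involute_loc hs x y)]
  congr 1
  · congr 1
    · refine dualExtDeriv_congr (hev.mono fun y' hy' z => ?_) z
      rw [Form.loc_contract _ _ hy', Form.loc_contract _ _ hy']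
      rfl
    · congr 1
      exact dualExtDeriv_congr (hev.mono fun y' hy' z => Form.loc_contract _ _ hy' z) _
  · congr 2
    exact dualExtDeriv_congr (hev.mono fun y' hy' z => Form.loc_contract _ _ hy' z) _

/-- Differentiability is assumed at one point only, so that the result also applies to `constForm`,
which is not known to be smooth off its chart. -/
theorem pair_derivedBracket {r s : ℤ} {X Y : Multivector E M} (hX : X.IsSmooth) (hY : Y.IsSmooth)
    (hr : X.flip = sgn r • X) (hs : Y.flip = sgn s • Y) {α : Form E M} {m : M}
    (hα : ∀ r, DifferentiableAt ℝ ((α r).inChart m) (extChartAt 𝓘(ℝ, E) m m))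
    (w : ExteriorAlgebra ℝ E) :
    (derivedBracket r s X Y α).pair m w
      = α.pair m ((schoutenBracket r s X Y).tot m * w) := by
  have hm := mem_extChartAt_target (I := 𝓘(ℝ, E)) m
  have h1 := Form.pair_eq_loc (derivedBracket r s X Y α) hm w
  rw [loc_derivedBracket hX hY hr hs hm hα, Form.loc_apply, map_mul (ExteriorAlgebra.map _),
    map_chartSymmDeriv_chartDeriv hm, extChartAt_to_inv] at h1
  rw [h1, tot_schoutenBracket]

/-- Chart independence without transforming the local formula: both sides are tested against forms
constant in the chart at x. Their contractions are the derived bracket, which does not refer to the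
chart at x. Smoothness of the bracket follows, since each of its values was defined in a different
chart. -/
theorem loc_schoutenBracket {r s : ℤ} {X Y : Multivector E M} (hX : X.IsSmooth) (hY : Y.IsSmooth)
    (hr : X.flip = sgn r • X) (hs : Y.flip = sgn s • Y) {x : M} {y : E}
    (hy : y ∈ (extChartAt 𝓘(ℝ, E) x).target) :
    (schoutenBracket r s X Y).loc x y = localBracket r s (X.loc x) (Y.loc x) y := by
  refine sub_eq_zero.1 ((Module.forall_dual_apply_eq_zero_iff ℝ _).1 fun φ => ?_)
  obtain ⟨l, rfl⟩ := pairing_surjective φ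
  have hl : ∀ y ∈ (extChartAt 𝓘(ℝ, E) x).target, (constForm x l).loc x y = pairing l :=
    fun y hy => congrArg pairing (funext fun r => constForm_inChart x l r hy)
  have hα : ∀ r, DifferentiableAt ℝ (FormSection.inChart (constForm x l r) x) y := fun r => by
    refine DifferentiableAt.congr_of_eventuallyEq (f := fun _ => l r)
      (differentiableAt_const _) ?_
    filter_upwards [(isOpen_extChartAt_target x).mem_nhds hy] with y' hy'
    exact constForm_inChart x l r hy'
  have h1 := loc_derivedBracket hX hY hr hs hy hα 1
  rw [mul_one, hl y hy, Form.loc_apply, pair_derivedBracket hX hY hr hs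
    (fun r => differentiableAt_inChart_of_chart hy (hα r)), map_one, mul_one, Form.pair_eq_loc _ hy,
    hl y hy, ← Multivector.loc_eq] at h1
  rw [map_sub, h1, sub_self]

theorem isSmooth_schoutenBracket {r s : ℤ} {X Y : Multivector E M} (hX : X.IsSmooth)
    (hY : Y.IsSmooth) (hr : X.flip = sgn r • X) (hs : Y.flip = sgn s • Y) :
    (schoutenBracket r s X Y).IsSmooth := by
  rw [Multivector.isSmooth_iff]
  intro x φ
  refine ContDiffOn.congr ?_ fun y hy => congrArg φ (loc_schoutenBracket hX hY hr hs hy)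
  exact contDiffOn_localBracket r s (isOpen_extChartAt_target x)
    ((Multivector.isSmooth_iff X).1 hX x) ((Multivector.isSmooth_iff Y).1 hY x) φ

theorem contract_schoutenBracket {r s : ℤ} {X Y : Multivector E M} (hX : X.IsSmooth)
    (hY : Y.IsSmooth) (hr : X.flip = sgn r • X) (hs : Y.flip = sgn s • Y) {α : Form E M}
    (hα : α.IsSmooth) :
    Form.contract (schoutenBracket r s X Y) α = derivedBracket r s X Y α :=
  Form.ext_pair fun m z => by
    rw [Form.pair_contract, pair_derivedBracket hX hY hr hs
      (hα.differentiableAt (mem_extChartAt_target (I := 𝓘(ℝ, E)) m))]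

end Bracket

/-! ### Cartan calculus -/

/-- A module with a differential `d` and a graded-commutative family of operators (contractions)
that is closed under the derived bracket `[[d, S], T]`. -/
structure CartanCalculus (Ω : Type u) [AddCommGroup Ω] [Module ℝ Ω] where
  /-- The differential. -/
  d : Ω →ₗ[ℝ] Ω
  d_d : ∀ α, d (d α) = 0
  /-- The contractions of parity `r`. -/
  C : ℤ → Submodule ℝ (Ω →ₗ[ℝ] Ω)
  comm : ∀ {r s S T}, S ∈ C r → T ∈ C s → ∀ α, S (T α) = sgn (r * s) • T (S α)
  exists_bracket : ∀ {r s S T}, S ∈ C r → T ∈ C s → ∃ Z ∈ C (r + s - 1), ∀ α,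
    Z α = (d (S (T α)) - sgn r • S (d (T α)))
      - sgn ((r - 1) * s) • (T (d (S α)) - sgn r • T (S (d α)))

namespace CartanCalculus

variable {Ω : Type u} [AddCommGroup Ω] [Module ℝ Ω] (K : CartanCalculus Ω)

/-- The Lie derivative along a contraction of parity `r`. -/
def lie (r : ℤ) (S : Ω →ₗ[ℝ] Ω) : Ω →ₗ[ℝ] Ω := K.d ∘ₗ S - sgn r • (S ∘ₗ K.d)

theorem lie_apply (r : ℤ) (S : Ω →ₗ[ℝ] Ω) (α : Ω) :
    K.lie r S α = K.d (S α) - sgn r • S (K.d α) := rfl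

theorem d_lie (r : ℤ) (S : Ω →ₗ[ℝ] Ω) (α : Ω) : K.d (K.lie r S α) = -sgn r • K.d (S (K.d α)) := by
  rw [lie_apply, map_sub, K.d_d, map_smul, zero_sub, neg_smul]

variable {K}

/-- The Lie derivative along a derived bracket is a graded commutator of Lie derivatives; once d² =
0 is used, the two expansions agree term by term. -/
theorem lie_bracket {r s : ℤ} {S T Z : Ω →ₗ[ℝ] Ω}
    (hZ : ∀ α, Z α = (K.d (S (T α)) - sgn r • S (K.d (T α)))
      - sgn ((r - 1) * s) • (T (K.d (S α)) - sgn r • T (S (K.d α)))) (α : Ω) :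
    K.lie (r + s - 1) Z α = -sgn r • K.lie r S (K.lie s T α)
      - sgn ((r - 1) * s) • K.lie s T (K.lie r S α) := by
  simp only [lie_apply, hZ, map_sub, map_smul, K.d_d, map_zero, smul_zero, sub_zero, zero_sub,
    sgn_sub, sgn_add, sgn_one]
  have h1 := sgn_mul_self r
  match_scalars <;> linear_combination (exp := 1) (0 : ℝ) * h1

section

variable {ω : Ω}

theorem apply_apply_eq_zero {r t : ℤ} {T S : Ω →ₗ[ℝ] Ω} (hT : T ∈ K.C t) (hS : S ∈ K.C r)
    (h : T ω = 0) : T (S ω) = 0 := by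
  rw [K.comm hT hS, h, map_zero, smul_zero]

/-- The Lie derivative of a Hamiltonian form only depends on the contraction of `ω`. -/
theorem lie_eq_zero {t r s : ℤ} {T X Y : Ω →ₗ[ℝ] Ω} {f : Ω} (hT : T ∈ K.C t) (hX : X ∈ K.C r)
    (hY : Y ∈ K.C s) (h : T ω = 0) (hXf : X ω = -K.d f) (hYf : Y ω = -f) : K.lie t T f = 0 := by
  have h1 : f = -Y ω := by rw [hYf, neg_neg]
  have h2 : K.d f = -X ω := by rw [hXf, neg_neg]
  rw [lie_apply, h2, map_neg, apply_apply_eq_zero hT hX h, h1, map_neg,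
    apply_apply_eq_zero hT hY h]
  simp

variable (K) in
/-- The 2-bracket of forms of symmetric parities `r` and `s`. -/
def bracket (r s : ℤ) (X Y : Ω →ₗ[ℝ] Ω) (f g : Ω) : Ω :=
  sgn r • K.lie r X g + (sgn (r * s) * sgn s) • K.lie s Y f

variable {r s : ℤ} {X Y : Ω →ₗ[ℝ] Ω} {f g : Ω}

/-- Applying d to a Lie derivative leaves only ± d X (d g) = ± d X (Y ω). The two halves of the
bracket contribute the same form because X and Y commute up to sign, whence the factor 2. -/
theorem d_bracket (hX : X ∈ K.C r) (hY : Y ∈ K.C s) (hXf : X ω = -K.d f) (hYg : Y ω = -K.d g) :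
    K.d (K.bracket r s X Y f g) = (2 : ℝ) • K.d (X (Y ω)) := by
  have h1 : K.d f = -X ω := by rw [hXf, neg_neg]
  have h2 : K.d g = -Y ω := by rw [hYg, neg_neg]
  rw [bracket, map_add, map_smul, map_smul, d_lie, d_lie, h1, h2, map_neg, map_neg, map_neg,
    map_neg, K.comm hY hX, map_smul]
  have h3 := sgn_mul_self r
  have h4 := sgn_mul_self s
  have h5 := sgn_mul_self (r * s)
  rw [sgn_mul_comm s r]
  match_scalars
  linear_combination h3 + h4 + h5 * sgn s * sgn s

theorem exists_semiHamiltonian_bracket (hω : K.d ω = 0) (hX : X ∈ K.C r) (hY : Y ∈ K.C s)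
    (hXf : X ω = -K.d f) (hYg : Y ω = -K.d g) :
    ∃ Z ∈ K.C (r + s - 1), Z ω = -K.d (K.bracket r s X Y f g) ∧ ∀ α,
      K.lie (r + s - 1) Z α = (2 * sgn r) • K.lie r X (K.lie s Y α)
        + (2 * (sgn (r * s) * sgn s)) • K.lie s Y (K.lie r X α) := by
  obtain ⟨Z, hZ, hZα⟩ := K.exists_bracket hX hY
  -- On ω the derived bracket reduces to d (X (Y ω)), because ω, X ω and Y ω are closed. This is
  -- half of d of the 2-bracket, and the fundamental equation carries a minus sign.
  refine ⟨(-2 : ℝ) • Z, (K.C _).smul_mem _ hZ, ?_, fun α => ?_⟩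
  · rw [d_bracket hX hY hXf hYg, LinearMap.smul_apply, hZα, hXf, hYg, hω]
    simp only [map_neg, K.d_d, map_zero, smul_zero, neg_zero, sub_zero, neg_smul]
  · have h : K.lie (r + s - 1) ((-2 : ℝ) • Z) α = (-2 : ℝ) • K.lie (r + s - 1) Z α := by
      simp only [lie_apply, LinearMap.smul_apply, map_smul, smul_sub]
      rw [smul_comm]
    rw [h, lie_bracket hZα, sub_mul, one_mul, sgn_sub]
    module

/-- With g = -Y' ω, the derived bracket of X and Y' applied to ω is the Lie derivative of Y' ω along
X, that is -L_X g; its parity is r + (s + 1) - 1. The other half of the 2-bracket is symmetric. -/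
theorem exists_hamiltonian_bracket {X' Y' : Ω →ₗ[ℝ] Ω} (hX : X ∈ K.C r) (hY : Y ∈ K.C s)
    (hX' : X' ∈ K.C (r + 1)) (hY' : Y' ∈ K.C (s + 1)) (hω : K.d ω = 0) (hXf : X ω = -K.d f)
    (hYg : Y ω = -K.d g) (hf : X' ω = -f) (hg : Y' ω = -g) :
    ∃ W ∈ K.C (r + s), W ω = -K.bracket r s X Y f g := by
  obtain ⟨Z₁, hZ₁, hZ₁α⟩ := K.exists_bracket hX hY'
  obtain ⟨Z₂, hZ₂, hZ₂α⟩ := K.exists_bracket hY hX'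
  have hf' : f = -X' ω := by rw [hf, neg_neg]
  have hg' : g = -Y' ω := by rw [hg, neg_neg]
  have e1 : K.lie r X g = -Z₁ ω := by
    rw [hZ₁α, hXf, hω, hg, lie_apply]
    simp only [map_neg, K.d_d, map_zero, smul_zero, neg_zero, sub_zero, smul_neg]
    abel
  have e2 : K.lie s Y f = -Z₂ ω := by
    rw [hZ₂α, hYg, hω, hf, lie_apply]
    simp only [map_neg, K.d_d, map_zero, smul_zero, neg_zero, sub_zero, smul_neg]
    abel
  have m1 : Z₁ ∈ K.C (r + s) := by convert hZ₁ using 2; ring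
  have m2 : Z₂ ∈ K.C (r + s) := by convert hZ₂ using 2; ring
  refine ⟨sgn r • Z₁ + (sgn (r * s) * sgn s) • Z₂, ?_, ?_⟩
  · exact (K.C _).add_mem ((K.C _).smul_mem _ m1) ((K.C _).smul_mem _ m2)
  · rw [bracket, e1, e2, LinearMap.add_apply, LinearMap.smul_apply, LinearMap.smul_apply]
    module

/-- An arbitrary D differs from the field of `exists_semiHamiltonian_bracket` by an operator killing
ω, whose Lie derivative vanishes on the Hamiltonian form h. -/
theorem lie_semiHamiltonian_bracket (hω : K.d ω = 0) (hX : X ∈ K.C r) (hY : Y ∈ K.C s)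
    (hXf : X ω = -K.d f) (hYg : Y ω = -K.d g) {D : Ω →ₗ[ℝ] Ω} (hD : D ∈ K.C (r + s - 1))
    (hDω : D ω = -K.d (K.bracket r s X Y f g)) {a b : ℤ} {S T : Ω →ₗ[ℝ] Ω} {h : Ω}
    (hS : S ∈ K.C a) (hT : T ∈ K.C b) (hSh : S ω = -K.d h) (hTh : T ω = -h) :
    K.lie (r + s - 1) D h = (2 * sgn r) • K.lie r X (K.lie s Y h)
        + (2 * (sgn (r * s) * sgn s)) • K.lie s Y (K.lie r X h) := by
  obtain ⟨Z, hZ, hZω, hZα⟩ := exists_semiHamiltonian_bracket hω hX hY hXf hYg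
  have h0 : K.lie (r + s - 1) (D - Z) h = 0 :=
    lie_eq_zero ((K.C _).sub_mem hD hZ) hS hT
      (by rw [LinearMap.sub_apply, hDω, hZω, sub_self]) hSh hTh
  have h1 : K.lie (r + s - 1) (D - Z) h = K.lie (r + s - 1) D h - K.lie (r + s - 1) Z h := by
    simp only [lie_apply, LinearMap.sub_apply, map_sub, smul_sub]
    abel
  rw [← hZα]
  exact sub_eq_zero.1 (h1.symm.trans h0)

end

/-- The failure of the graded Jacobi identity. -/
theorem jacobi {ω : Ω} (hω : K.d ω = 0) {r : Fin 3 → ℤ} {X Y : Fin 3 → Ω →ₗ[ℝ] Ω} {f : Fin 3 → Ω}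
    (hX : ∀ i, X i ∈ K.C (r i)) (hY : ∀ i, Y i ∈ K.C (r i + 1)) (hXf : ∀ i, X i ω = -K.d (f i))
    (hYf : ∀ i, Y i ω = -f i) {D : Fin 3 → Fin 3 → Ω →ₗ[ℝ] Ω}
    (hD : ∀ i j, D i j ∈ K.C (r i + r j - 1))
    (hDω : ∀ i j, D i j ω = -K.d (K.bracket (r i) (r j) (X i) (X j) (f i) (f j))) :
    K.bracket (r 0 + r 1 - 1) (r 2) (D 0 1) (X 2)
        (K.bracket (r 0) (r 1) (X 0) (X 1) (f 0) (f 1)) (f 2)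
      + sgn (r 2 * r 1) • K.bracket (r 0 + r 2 - 1) (r 1) (D 0 2) (X 1)
        (K.bracket (r 0) (r 2) (X 0) (X 2) (f 0) (f 2)) (f 1)
      + (sgn (r 1 * r 0) * sgn (r 2 * r 0)) • K.bracket (r 1 + r 2 - 1) (r 0) (D 1 2) (X 0)
        (K.bracket (r 1) (r 2) (X 1) (X 2) (f 1) (f 2)) (f 0)
      = -(1 / 2 : ℝ) • ((sgn (r 0) * sgn (r 1)) • K.lie (r 0 + r 1 - 1) (D 0 1) (f 2)
        + (sgn (r 2 * r 1) * sgn (r 0) * sgn (r 2)) • K.lie (r 0 + r 2 - 1) (D 0 2) (f 1)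
        + (sgn (r 1 * r 0) * sgn (r 2 * r 0) * sgn (r 1) * sgn (r 2)) •
          K.lie (r 1 + r 2 - 1) (D 1 2) (f 0)) := by
  have key : ∀ i j k, K.lie (r i + r j - 1) (D i j) (f k)
      = (2 * sgn (r i)) • K.lie (r i) (X i) (K.lie (r j) (X j) (f k))
        + (2 * (sgn (r i * r j) * sgn (r j))) • K.lie (r j) (X j) (K.lie (r i) (X i) (f k)) :=
    fun i j k => lie_semiHamiltonian_bracket hω (hX i) (hX j) (hXf i) (hXf j) (hD i j) (hDω i j)
      (hX k) (hY k) (hXf k) (hYf k)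
  simp only [bracket, key, map_add, map_smul]
  have e : ∀ i j k, sgn ((r i + r j - 1) * r k) = sgn (r i * r k) * sgn (r j * r k) * sgn (r k) :=
    fun i j k => by rw [sub_mul, add_mul, sgn_sub, sgn_add, one_mul]
  simp only [e, sgn_sub, sgn_add, sgn_one, sgn_mul_comm (r 1) (r 0), sgn_mul_comm (r 2) (r 0),
    sgn_mul_comm (r 2) (r 1)]
  have hp := fun i => sgn_mul_self (r i)
  have hc := fun i j => sgn_mul_self (r i * r j)
  have p0 := hp 0
  have p1 := hp 1
  have p2 := hp 2
  have c01 := hc 0 1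
  have c02 := hc 0 2
  have c12 := hc 1 2
  generalize sgn (r 0 * r 1) = c₀₁ at *
  generalize sgn (r 0 * r 2) = c₀₂ at *
  generalize sgn (r 1 * r 2) = c₁₂ at *
  generalize sgn (r 0) = q₀ at *
  generalize sgn (r 1) = q₁ at *
  generalize sgn (r 2) = q₂ at *
  -- Each double Lie derivative yields one polynomial identity between signs whose squares are 1.
  match_scalars
  all_goals (clear hp hc key; grind)

end CartanCalculus

/-! ### The Cartan calculus of smooth forms -/

section Flip

variable {E : Type u} [NormedAddCommGroup E] [NormedSpace ℝ E]
  {M : Type v} [TopologicalSpace M] [ChartedSpace E M]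

theorem Form.flip_neg (α : Form E M) : (-α).flip = -α.flip :=
  funext fun _ => smul_neg _ _

theorem Multivector.flip_add (X Y : Multivector E M) : (X + Y).flip = X.flip + Y.flip :=
  funext fun _ => smul_add _ _ _

theorem Multivector.flip_smul (c : ℝ) (X : Multivector E M) : (c • X).flip = c • X.flip := by
  funext r
  change (-1 : ℝ) ^ r • c • X r = c • (-1 : ℝ) ^ r • X r
  rw [smul_smul, smul_smul, mul_comm]

theorem Multivector.flip_flip (X : Multivector E M) : X.flip.flip = X := by
  funext r
  change (-1 : ℝ) ^ r • (-1 : ℝ) ^ r • X r = X r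
  rw [smul_smul, ← mul_pow]
  simp only [mul_neg, mul_one, neg_neg, one_pow]
  exact one_smul ℝ (X r)

theorem FormSection.d_smul {r : ℕ} (c : ℝ) (α : FormSection E M r) : (c • α).d = c • α.d := by
  funext m
  have h : (c • α).inChart m = c • α.inChart m := rfl
  have h' : (c • α).d.toModel m = c • α.d.toModel m := by
    rw [FormSection.toModel_d, FormSection.toModel_d, h, extDeriv_smul]
    rfl
  exact h'

theorem FormSection.d_zero {r : ℕ} : (0 : FormSection E M r).d = 0 := by
  have h := FormSection.d_smul 0 (0 : FormSection E M r)
  rwa [zero_smul ℝ (0 : FormSection E M r), zero_smul ℝ (FormSection.d (0 : FormSection E M r))] at h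

theorem Form.flip_d (α : Form E M) : (Form.d α).flip = -Form.d α.flip := by
  funext r
  match r with
  | 0 =>
    change (-1 : ℝ) ^ 0 • (0 : FormSection E M 0) = -0
    rw [smul_zero, neg_zero]
  | r + 1 =>
    change (-1 : ℝ) ^ (r + 1) • (α r).d = -FormSection.d ((-1 : ℝ) ^ r • α r)
    rw [FormSection.d_smul, pow_succ, mul_neg_one]
    exact neg_smul ((-1 : ℝ) ^ r) (α r).d

theorem Form.IsHomogeneous.flip {r : ℕ} {α : Form E M} (h : α.IsHomogeneous r) :
    α.flip = sgn r • α := by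
  funext k
  change (-1 : ℝ) ^ k • α k = sgn r • α k
  by_cases hk : k = r
  · subst hk
    rw [sgn, zpow_natCast]
  · rw [h k hk, smul_zero, smul_zero]

theorem Form.IsHomogeneous.single {r : ℕ} (α : FormSection E M r) :
    Form.IsHomogeneous r (Pi.single r α : Form E M) := fun _ hk => Pi.single_eq_of_ne hk α

theorem Multivector.loc_add (X Y : Multivector E M) (x : M) (y : E) :
    (X + Y).loc x y = X.loc x y + Y.loc x y := by
  simp only [Multivector.loc_eq, Multivector.tot_add, map_add]

theorem Multivector.loc_smul (c : ℝ) (X : Multivector E M) (x : M) (y : E) :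
    (c • X).loc x y = c • X.loc x y := by
  simp only [Multivector.loc_eq, Multivector.tot_smul, map_smul]

theorem Multivector.loc_flip (X : Multivector E M) (x : M) (y : E) :
    X.flip.loc x y = CliffordAlgebra.involute (X.loc x y) := by
  simp only [Multivector.loc_eq, Multivector.tot_flip, involute_map]

theorem Form.zero_contract (α : Form E M) : Form.contract 0 α = 0 := by
  have h := Form.smul_contract 0 (0 : Multivector E M) α
  rwa [zero_smul ℝ (0 : Multivector E M), zero_smul ℝ (Form.contract 0 α)] at h

/-- The part of parity `r` of a multivector field. -/
def Multivector.parityPart (r : ℤ) (X : Multivector E M) : Multivector E M :=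
  (1 / 2 : ℝ) • (X + sgn r • X.flip)

theorem Multivector.flip_parityPart (r : ℤ) (X : Multivector E M) :
    (X.parityPart r).flip = sgn r • X.parityPart r := by
  simp only [parityPart, Multivector.flip_smul, Multivector.flip_add, Multivector.flip_flip]
  have h := sgn_mul_self r
  rcases sgn_eq_or r with h | h <;> rw [h] <;> module

theorem Multivector.parityPart_add (X : Multivector E M) :
    X.parityPart 0 + X.parityPart 1 = X := by
  have h0 : sgn 0 = 1 := by simp [sgn]
  simp only [parityPart, h0, sgn_one]
  module

/-- A solution X may mix degrees. As ω and α have definite parity, the flipped field solves the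
equation up to sign, and averaging gives a solution of definite parity. -/
theorem Form.contract_parityPart {ω α : Form E M} {k t r : ℤ} (hω : ω.flip = sgn k • ω)
    {X : Multivector E M} (hX : Form.contract X ω = α) (hα : α.flip = sgn t • α)
    (hr : sgn r = sgn k * sgn t) : Form.contract (X.parityPart r) ω = α := by
  have h1 : Form.contract X.flip ω = (sgn k * sgn t) • α := by
    have h2 := Form.flip_contract X ω
    rw [hω, Form.contract_smul, hX, hα] at h2
    rw [mul_smul, h2, smul_smul, sgn_mul_self]
    exact (one_smul ℝ _).symm
  rw [Multivector.parityPart, Form.smul_contract, Form.add_contract, Form.smul_contract, hX, h1, hr,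
    smul_smul]
  have h3 : sgn k * sgn t * (sgn k * sgn t) = 1 := by
    linear_combination sgn t * sgn t * sgn_mul_self k + sgn_mul_self t
  rw [h3]
  module

variable (E M) [FiniteDimensional ℝ E]

/-- The smooth forms. -/
def smoothForms : Submodule ℝ (Form E M) where
  carrier := {α | α.IsSmooth}
  add_mem' h h' := h.add h'
  zero_mem' := Form.isSmooth_zero
  smul_mem' c _ h := h.smul c

/-- The smooth multivector fields. -/
def smoothMultivectors : Submodule ℝ (Multivector E M) where
  carrier := {X | X.IsSmooth}
  add_mem' {X Y} h h' := by
    change Multivector.IsSmooth _ at h h'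
    change Multivector.IsSmooth _
    rw [Multivector.isSmooth_iff] at *
    intro x φ
    simp only [Multivector.loc_add, map_add]
    exact (h x φ).add (h' x φ)
  zero_mem' := by
    change Multivector.IsSmooth _
    rw [Multivector.isSmooth_iff]
    intro x φ
    have : ∀ y, (0 : Multivector E M).loc x y = 0 := fun y => by
      have h := Multivector.loc_smul 0 (0 : Multivector E M) x y
      rwa [zero_smul ℝ (0 : Multivector E M), zero_smul] at h
    simp only [this, map_zero]
    exact contDiffOn_const
  smul_mem' c X h := by
    change Multivector.IsSmooth _ at h
    change Multivector.IsSmooth _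
    rw [Multivector.isSmooth_iff] at *
    intro x φ
    simp only [Multivector.loc_smul, map_smul, smul_eq_mul]
    exact contDiffOn_const.mul (h x φ)

variable {E M}

theorem Multivector.IsSmooth.flip {X : Multivector E M} (h : X.IsSmooth) : X.flip.IsSmooth := by
  rw [Multivector.isSmooth_iff] at *
  intro x φ
  simp only [Multivector.loc_flip]
  exact h x (φ ∘ₗ CliffordAlgebra.involute.toLinearMap)

theorem Multivector.IsSmooth.parityPart (r : ℤ) {X : Multivector E M} (h : X.IsSmooth) :
    (X.parityPart r).IsSmooth :=
  (smoothMultivectors E M).smul_mem _ ((smoothMultivectors E M).add_mem h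
    ((smoothMultivectors E M).smul_mem _ h.flip))

end Flip

/-! ### Smooth forms as an instance of `CartanCalculus` -/

section Cartan

section Types

variable (E : Type u) [NormedAddCommGroup E] [NormedSpace ℝ E] [FiniteDimensional ℝ E]
  (M : Type v) [TopologicalSpace M] [ChartedSpace E M]

/-- The space `Ω(M)` of smooth forms. -/
def SmoothForm : Type (max u v) := smoothForms E M

/-- The space `𝔛(M)` of smooth multivector fields. -/
def SmoothMultivector : Type (max u v) := smoothMultivectors E M

instance : AddCommGroup (SmoothForm E M) := (smoothForms E M).addCommGroup

instance : Module ℝ (SmoothForm E M) := (smoothForms E M).module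

instance : AddCommGroup (SmoothMultivector E M) := (smoothMultivectors E M).addCommGroup

instance : Module ℝ (SmoothMultivector E M) := (smoothMultivectors E M).module

variable {E M}

/-- The inclusion of the smooth forms. -/
def SmoothForm.val : SmoothForm E M →ₗ[ℝ] Form E M := (smoothForms E M).subtype

/-- The inclusion of the smooth multivector fields. -/
def SmoothMultivector.val : SmoothMultivector E M →ₗ[ℝ] Multivector E M :=
  (smoothMultivectors E M).subtype

theorem SmoothForm.ext {α β : SmoothForm E M} (h : α.val = β.val) : α = β := Subtype.ext h

theorem SmoothMultivector.ext {X Y : SmoothMultivector E M} (h : X.val = Y.val) : X = Y :=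
  Subtype.ext h

theorem SmoothForm.isSmooth (α : SmoothForm E M) : α.val.IsSmooth := α.2

theorem SmoothMultivector.isSmooth (X : SmoothMultivector E M) : X.val.IsSmooth := X.2

/-- A smooth form, as an element of `Ω(M)`. -/
def SmoothForm.mk (α : Form E M) (h : α.IsSmooth) : SmoothForm E M := ⟨α, h⟩

/-- A smooth multivector field, as an element of `𝔛(M)`. -/
def SmoothMultivector.mk (X : Multivector E M) (h : X.IsSmooth) : SmoothMultivector E M := ⟨X, h⟩

theorem SmoothMultivector.val_mk (X : Multivector E M) (h : X.IsSmooth) :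
    (SmoothMultivector.mk X h).val = X := rfl

/-- The parity operator on smooth multivector fields. -/
def SmoothMultivector.flip (X : SmoothMultivector E M) : SmoothMultivector E M :=
  .mk X.val.flip X.isSmooth.flip

/-- The parity operator on smooth multivector fields, as a linear map. -/
def smoothFlip : SmoothMultivector E M →ₗ[ℝ] SmoothMultivector E M where
  toFun X := X.flip
  map_add' X Y := SmoothMultivector.ext (Multivector.flip_add X.val Y.val)
  map_smul' c X := SmoothMultivector.ext (Multivector.flip_smul c X.val)

variable (E M) in
/-- The multivector fields of parity `r`. -/
def parityFields (r : ℤ) : Submodule ℝ (SmoothMultivector E M) :=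
  LinearMap.ker (smoothFlip - sgn r • LinearMap.id)

theorem mem_parityFields {r : ℤ} {X : SmoothMultivector E M} :
    X ∈ parityFields E M r ↔ X.val.flip = sgn r • X.val := by
  rw [parityFields, LinearMap.mem_ker, LinearMap.sub_apply, sub_eq_zero]
  exact ⟨fun h => congrArg SmoothMultivector.val h, fun h => SmoothMultivector.ext h⟩

end Types

variable {E : Type u} [NormedAddCommGroup E] [NormedSpace ℝ E] [FiniteDimensional ℝ E]
  {M : Type v} [TopologicalSpace M] [ChartedSpace E M] [IsManifold 𝓘(ℝ, E) (⊤ : ℕ∞) M]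

/-- The exterior derivative on smooth forms. -/
def smoothD : SmoothForm E M →ₗ[ℝ] SmoothForm E M where
  toFun α := .mk (Form.d α.val) α.isSmooth.d
  map_add' α β := SmoothForm.ext (Form.d_add α.2 β.2)
  map_smul' c α := SmoothForm.ext (Form.d_smul α.2 c)

/-- The contraction along a smooth multivector field, on smooth forms. -/
def smoothContract : SmoothMultivector E M →ₗ[ℝ] SmoothForm E M →ₗ[ℝ] SmoothForm E M :=
  LinearMap.mk₂ ℝ (fun X α => .mk (Form.contract X.val α.val) (α.isSmooth.contract X.isSmooth))
    (fun X Y α => SmoothForm.ext (Form.add_contract X.val Y.val α.val))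
    (fun c X α => SmoothForm.ext (Form.smul_contract c X.val α.val))
    (fun X α β => SmoothForm.ext (Form.contract_add X.val α.val β.val))
    (fun c X α => SmoothForm.ext (Form.contract_smul X.val c α.val))

theorem val_smoothContract (X : SmoothMultivector E M) (α : SmoothForm E M) :
    (smoothContract X α).val = Form.contract X.val α.val := rfl

/-- The Lie derivative, as a bilinear map. -/
def smoothLie : SmoothMultivector E M →ₗ[ℝ] SmoothForm E M →ₗ[ℝ] SmoothForm E M :=
  smoothContract.compr₂ smoothD - (smoothContract.comp smoothFlip).compl₂ smoothD

variable (E M) in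
/-- The Cartan calculus of smooth forms on a manifold. -/
def cartanCalculus : CartanCalculus (SmoothForm E M) where
  d := smoothD
  d_d α := SmoothForm.ext (Form.d_d α.isSmooth)
  C r := (parityFields E M r).map smoothContract
  comm := by
    rintro r s _ _ ⟨X, hX, rfl⟩ ⟨Y, hY, rfl⟩ α
    exact SmoothForm.ext (contract_comm_of_parity (mem_parityFields.1 hX)
      (mem_parityFields.1 hY) α.val)
  exists_bracket := by
    rintro r s _ _ ⟨X, hX, rfl⟩ ⟨Y, hY, rfl⟩
    have hX' := mem_parityFields.1 hX
    have hY' := mem_parityFields.1 hY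
    refine ⟨_, ⟨.mk (schoutenBracket r s X.val Y.val)
      (isSmooth_schoutenBracket X.isSmooth Y.isSmooth hX' hY'), ?_, rfl⟩,
      fun α => SmoothForm.ext
        (contract_schoutenBracket X.isSmooth Y.isSmooth hX' hY' α.isSmooth)⟩
    exact mem_parityFields.2 (flip_schoutenBracket X.isSmooth Y.isSmooth hX' hY')

theorem smoothContract_mem {r : ℤ} {X : SmoothMultivector E M} (h : X ∈ parityFields E M r) :
    smoothContract X ∈ (cartanCalculus E M).C r := ⟨X, h, rfl⟩

theorem cartanCalculus_lie {r : ℤ} {X : SmoothMultivector E M} (h : X ∈ parityFields E M r)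
    (α : SmoothForm E M) : (cartanCalculus E M).lie r (smoothContract X) α = smoothLie X α := by
  have h' : smoothFlip X = sgn r • X := SmoothMultivector.ext (mem_parityFields.1 h)
  change smoothD (smoothContract X α) - sgn r • smoothContract X (smoothD α)
    = smoothD (smoothContract X α) - smoothContract (smoothFlip X) (smoothD α)
  rw [h', map_smul, LinearMap.smul_apply]

end Cartan

/-! ### The three (2,1)-shuffles and their Koszul signs -/

theorem shuffles_two_one :
    shuffles 2 1 = {1, Equiv.swap 1 2, (Equiv.swap 0 2 * Equiv.swap 0 1 : Equiv.Perm (Fin 3))} := by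
  decide

theorem sum_shuffles_two_one {A : Type u} [AddCommMonoid A] (F : Equiv.Perm (Fin 3) → A) :
    ∑ s ∈ shuffles 2 1, F s = F 1 + F (Equiv.swap 1 2) + F (Equiv.swap 0 2 * Equiv.swap 0 1) := by
  rw [shuffles_two_one, Finset.sum_insert (by decide), Finset.sum_insert (by decide),
    Finset.sum_singleton, add_assoc]

theorem koszulSign_one (deg : Fin 3 → ℤ) : koszulSign 1 deg = 1 := by
  simp [koszulSign, Fintype.prod_prod_type, Fin.prod_univ_three]

theorem koszulSign_swap (deg : Fin 3 → ℤ) :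
    koszulSign (Equiv.swap 1 2) deg = sgn (deg 2 * deg 1) := by
  have h : ∀ i : Fin 3, Equiv.swap (1 : Fin 3) 2 i = ![0, 2, 1] i := by decide
  simp [koszulSign, Fintype.prod_prod_type, Fin.prod_univ_three, h, sgn, sgn₂]

theorem koszulSign_rotate (deg : Fin 3 → ℤ) :
    koszulSign (Equiv.swap 0 2 * Equiv.swap 0 1) deg
      = sgn (deg 1 * deg 0) * sgn (deg 2 * deg 0) := by
  have h : ∀ i : Fin 3, (Equiv.swap 0 2 * Equiv.swap 0 1 : Equiv.Perm (Fin 3)) i = ![1, 2, 0] i := by decide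
  simp only [koszulSign, Fintype.prod_prod_type, Fin.prod_univ_three, h]
  simp [sgn, sgn₂]

/-! ### Homogeneous components of Hamiltonian forms -/

section Components

variable {E : Type u} [NormedAddCommGroup E] [NormedSpace ℝ E]
  {M : Type v} [TopologicalSpace M] [ChartedSpace E M] {n : ℕ}

theorem Form.component_self (α : Form E M) (r : ℕ) : α.component r r = α r :=
  Pi.single_eq_same r (α r)

theorem Form.component_of_ne (α : Form E M) {r k : ℕ} (h : k ≠ r) : α.component r k = 0 :=
  Pi.single_eq_of_ne h (α r)

theorem Form.component_neg (α : Form E M) (r : ℕ) : (-α).component r = -α.component r :=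
  Pi.single_neg r (α r)

theorem Form.d_component (α : Form E M) (r : ℕ) :
    Form.d (α.component r) = (Form.d α).component (r + 1) := by
  funext k
  match k with
  | 0 => exact (Form.component_of_ne _ (by omega)).symm
  | k + 1 =>
    change FormSection.d (α.component r k) = _
    by_cases h : k = r
    · subst h
      rw [Form.component_self, Form.component_self]
      rfl
    · rw [Form.component_of_ne _ h, Form.component_of_ne _ (by omega), FormSection.d_zero]

theorem Form.flip_component (α : Form E M) (r : ℕ) :
    (α.component r).flip = sgn r • α.component r :=
  (Form.IsHomogeneous.single (α r)).flip

theorem Form.component_eq_zero {α : Form E M} {a : ℤ} (h : α.flip = sgn a • α) {r : ℕ}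
    (hr : sgn r ≠ sgn a) : α.component r = 0 := by
  have h1 : (sgn r - sgn a) • α r = 0 := by
    have h2 : (-1 : ℝ) ^ r • α r = sgn a • α r := congrFun h r
    rw [sub_smul (sgn r) (sgn a) (α r), ← h2, sgn, zpow_natCast]
    exact sub_self ((-1 : ℝ) ^ r • α r)
  have h3 : α r = 0 := (smul_eq_zero.1 h1).resolve_left (sub_ne_zero.2 hr)
  rw [Form.component, h3]
  exact Pi.single_zero r

theorem FormSection.eq_zero_of_lt [FiniteDimensional ℝ E] {r : ℕ} (α : FormSection E M r)
    (h : Module.finrank ℝ E < r) : α = 0 := by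
  funext m
  have h' : α.toModel m = 0 := by
    ext v
    refine AlternatingMap.map_linearDependent (α.toModel m).toAlternatingMap v fun hv => ?_
    have := hv.fintype_card_le_finrank
    rw [Fintype.card_fin] at this
    omega
  exact h'

theorem Form.sum_component [FiniteDimensional ℝ E] (α : Form E M) :
    ∑ r ∈ Finset.range (Module.finrank ℝ E + 1), α.component r = α := by
  funext k
  rw [Finset.sum_apply]
  by_cases hk : k ∈ Finset.range (Module.finrank ℝ E + 1)
  · rw [Finset.sum_eq_single_of_mem k hk fun r _ hr => Form.component_of_ne _ (Ne.symm hr),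
      Form.component_self]
  · rw [FormSection.eq_zero_of_lt (α k) (by rw [Finset.mem_range] at hk; omega)]
    exact Finset.sum_eq_zero fun r hr => Form.component_of_ne _ fun h => hk (h ▸ hr)

theorem Form.IsSmooth.component [FiniteDimensional ℝ E] {α : Form E M} (h : α.IsSmooth) (r : ℕ) :
    (α.component r).IsSmooth := by
  intro k
  by_cases hk : k = r
  · subst hk
    rw [Form.component_self]
    exact h k
  · rw [Form.component_of_ne _ hk]
    exact Form.isSmooth_zero k

theorem FormSection.IsSmooth.toForm [FiniteDimensional ℝ E] {r : ℕ} {α : FormSection E M r} (h : α.IsSmooth) :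
    Form.IsSmooth α.toForm := by
  intro k
  by_cases hk : k = r
  · subst hk
    rw [FormSection.toForm, Pi.single_eq_same]
    exact h
  · rw [FormSection.toForm, Pi.single_eq_of_ne hk]
    exact Form.isSmooth_zero k

theorem contract_zero_right {V : Type u} [AddCommGroup V] [Module ℝ V] [TopologicalSpace V]
    [IsTopologicalAddGroup V] [ContinuousSMul ℝ V] {r k : ℕ} (x : ⋀[ℝ]^r V) :
    contract x (0 : V [⋀^Fin (r + k)]→L[ℝ] ℝ) = 0 := by
  have h : contractAlternating (0 : V [⋀^Fin (r + k)]→L[ℝ] ℝ) = 0 := rfl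
  rw [contract, h, map_zero, LinearMap.zero_apply]

theorem contract_zero_left {V : Type u} [AddCommGroup V] [Module ℝ V] [TopologicalSpace V]
    [IsTopologicalAddGroup V] [ContinuousSMul ℝ V] {r k : ℕ} (α : V [⋀^Fin (r + k)]→L[ℝ] ℝ) :
    contract (0 : ⋀[ℝ]^r V) α = 0 := map_zero _

/-- The components of `i_X ω` are contractions of `ω`. -/
theorem Multivector.exists_contract_component [FiniteDimensional ℝ E] (ω : FormSection E M n)
    {X : Multivector E M} (hX : X.IsSmooth) (k : ℕ) : ∃ X' : Multivector E M, X'.IsSmooth ∧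
      Form.contract X' ω.toForm = (Form.contract X ω.toForm).component k := by
  -- Only the part of X in the degree r with r + k = n contributes to the component of degree k.
  obtain ⟨X', hp, hn⟩ : ∃ X' : Multivector E M,
      (∀ r, r + k = n → X' r = X r) ∧ ∀ r, r + k ≠ n → X' r = 0 :=
    ⟨fun r => if r + k = n then X r else 0, fun r h => if_pos h, fun r h => if_neg h⟩
  refine ⟨X', fun r => ?_, ?_⟩
  · by_cases h : r + k = n
    · rw [hp r h]
      exact hX r
    · rw [hn r h]
      exact (smoothMultivectors E M).zero_mem r
  · have h0 : ∀ {r j : ℕ}, r + j ≠ n → ω.toForm (r + j) = 0 := fun h => Pi.single_eq_of_ne h ω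
    funext j m
    by_cases hj : j = k
    · subst hj
      rw [Form.component_self]
      refine Finset.sum_congr rfl fun r _ => ?_
      by_cases h : r + j = n
      · rw [hp r h]
      · rw [h0 h]
        exact (contract_zero_right _).trans (contract_zero_right _).symm
    · rw [Form.component_of_ne _ hj]
      refine Finset.sum_eq_zero fun r _ => ?_
      by_cases h : r + k = n
      · rw [h0 (by omega)]
        exact contract_zero_right _
      · rw [hn r h]
        exact contract_zero_left _

variable {ω : FormSection E M (n + 1)} {f : Form E M}

/-- An `n`-plectic form as an element of `Ω(M)`. -/
def IsNPlectic.form [FiniteDimensional ℝ E] (hω : IsNPlectic ω) : SmoothForm E M := .mk ω.toForm hω.smooth.toForm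

theorem IsNPlectic.flip_form [FiniteDimensional ℝ E] (hω : IsNPlectic ω) :
    hω.form.val.flip = sgn (n + 1) • hω.form.val := by
  have h := (Form.IsHomogeneous.single ω).flip
  push_cast at h
  exact h

theorem IsHamiltonian.component [FiniteDimensional ℝ E] (h : IsHamiltonian ω f) (r : ℕ) :
    IsHamiltonian ω (f.component r) := by
  obtain ⟨hf, ⟨X, hX, hXf⟩, Y, hY, hYf⟩ := h
  obtain ⟨X', hX', hXf'⟩ := Multivector.exists_contract_component ω hX (r + 1)
  obtain ⟨Y', hY', hYf'⟩ := Multivector.exists_contract_component ω hY r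
  refine ⟨hf.component r, ⟨X', hX', ?_⟩, Y', hY', ?_⟩
  · rw [hXf', hXf, Form.component_neg, Form.d_component]
  · rw [hYf', hYf, Form.component_neg]

theorem IsHamiltonian.semiHamiltonianField (h : IsHamiltonian ω f) :
    IsSemiHamiltonianField ω f (semiHamiltonianField ω f) := by
  rw [NPlectic.semiHamiltonianField, dif_pos h.2.1]
  exact h.2.1.choose_spec

end Components

/-! ### Hamiltonian forms and the 2-bracket -/

theorem sgn_mul_congr {a a' b b' : ℤ} (h : sgn a = sgn a') (h' : sgn b = sgn b') :
    sgn (a * b) = sgn (a' * b') := by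
  have e : ∀ a b : ℤ, sgn (a * b) = sgn a ^ b := fun a b => zpow_mul _ _ _
  rw [e, h, ← e, mul_comm, e, h', ← e, mul_comm]

section Hamiltonian

variable {E : Type u} [NormedAddCommGroup E] [NormedSpace ℝ E] [FiniteDimensional ℝ E]
  {M : Type v} [TopologicalSpace M] [ChartedSpace E M] [IsManifold 𝓘(ℝ, E) (⊤ : ℕ∞) M] {n : ℕ}

/-- The form `F` has a semi-Hamiltonian field `X` of parity `r` and a Hamiltonian field `Y` of
parity `r + 1` with respect to `ω`. -/
structure HamiltonianPair (ω F : SmoothForm E M) (r : ℤ) (X Y : SmoothMultivector E M) : Prop where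
  mem : X ∈ parityFields E M r
  mem' : Y ∈ parityFields E M (r + 1)
  contract_eq : smoothContract X ω = -smoothD F
  contract_eq' : smoothContract Y ω = -F

/-- The Lie derivative of a Hamiltonian form along `Z` is determined by `i_Z ω`. -/
theorem HamiltonianPair.lie_eq {ω F : SmoothForm E M} {r k : ℤ} {X Y : SmoothMultivector E M}
    (h : HamiltonianPair ω F r X Y) (hω : ω.val.flip = sgn k • ω.val)
    {Z Z' : SmoothMultivector E M} (hZ : smoothContract Z ω = smoothContract Z' ω) :
    smoothLie Z F = smoothLie Z' F := by
  -- `CartanCalculus.lie_eq_zero` requires definite parity, so the even and odd parts of the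
  -- difference are treated separately.
  have key : ∀ t : ℤ, smoothLie (.mk ((Z - Z').val.parityPart t)
      ((Z - Z').isSmooth.parityPart t)) F = 0 := by
    intro t
    have ht : SmoothMultivector.mk _ ((Z - Z').isSmooth.parityPart t) ∈ parityFields E M t :=
      mem_parityFields.2 (Multivector.flip_parityPart t _)
    rw [← cartanCalculus_lie ht]
    refine CartanCalculus.lie_eq_zero (smoothContract_mem ht) (smoothContract_mem h.mem)
      (smoothContract_mem h.mem') ?_ h.contract_eq h.contract_eq'
    refine SmoothForm.ext ?_
    rw [val_smoothContract, SmoothMultivector.val_mk]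
    -- The contraction is the zero form, which has every parity; t - k is the one that matches a
    -- field of parity t and ω of parity k.
    refine Form.contract_parityPart (t := t - k) hω ?_ ?_ ?_
    · rw [← val_smoothContract, map_sub, LinearMap.sub_apply, hZ, sub_self]
    · rw [map_zero, smul_zero]
      exact funext fun r => smul_zero _
    · rw [← sgn_add]
      congr 1
      ring
  have h1 : SmoothMultivector.mk _ ((Z - Z').isSmooth.parityPart 0)
      + SmoothMultivector.mk _ ((Z - Z').isSmooth.parityPart 1) = Z - Z' :=
    SmoothMultivector.ext (Multivector.parityPart_add _)
  have h2 : smoothLie (Z - Z') F = 0 := by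
    rw [← h1, map_add, LinearMap.add_apply, key, key, add_zero]
  rw [map_sub, LinearMap.sub_apply] at h2
  exact sub_eq_zero.1 h2

variable {ω : FormSection E M (n + 1)}

theorem IsNPlectic.d_form (hω : IsNPlectic ω) : smoothD hω.form = 0 := by
  refine SmoothForm.ext (funext fun k => ?_)
  match k with
  | 0 => rfl
  | k + 1 =>
    change FormSection.d (ω.toForm k) = 0
    by_cases hk : k = n + 1
    · subst hk
      rw [FormSection.toForm, Pi.single_eq_same]
      exact hω.closed
    · rw [FormSection.toForm, Pi.single_eq_of_ne hk, FormSection.d_zero]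

/-- Given fields are projected to the parity forced by the equations: ω has parity n + 1, df has n -
r + 1 and f has n - r, which leaves r for X and r + 1 for Y. -/
theorem IsHamiltonian.exists_pair {f : Form E M} (hf : IsHamiltonian ω f) (hω : IsNPlectic ω)
    {r : ℤ} (hr : f.flip = sgn (n - r) • f) :
    ∃ X Y, HamiltonianPair hω.form (.mk f hf.1) r X Y := by
  obtain ⟨hf1, ⟨X, hX, hXf⟩, Y, hY, hYf⟩ := hf
  refine ⟨.mk (X.parityPart r) (hX.parityPart r), .mk (Y.parityPart (r + 1)) (hY.parityPart _),
    mem_parityFields.2 (Multivector.flip_parityPart _ _),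
    mem_parityFields.2 (Multivector.flip_parityPart _ _), SmoothForm.ext ?_, SmoothForm.ext ?_⟩
  · refine Form.contract_parityPart (t := n - r + 1) hω.flip_form hXf ?_ ?_
    · change Form.flip (-Form.d f) = sgn (n - r + 1) • (-Form.d f)
      rw [Form.flip_neg, Form.flip_d, hr, Form.d_smul hf1, sgn_add, sgn_one]
      module
    · simp only [sgn_add, sgn_sub, sgn_one]
      linear_combination -sgn r * sgn_mul_self n
  · refine Form.contract_parityPart (t := n - r) hω.flip_form hYf ?_ ?_
    · change Form.flip (-f) = sgn (n - r) • (-f)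
      rw [Form.flip_neg, hr]
      module
    · simp only [sgn_add, sgn_sub, sgn_one]
      linear_combination sgn r * sgn_mul_self n

theorem IsSemiHamiltonianField.contract_form {f : Form E M} {X : Multivector E M}
    (hω : IsNPlectic ω) (hf : f.IsSmooth) (h : IsSemiHamiltonianField ω f X) :
    smoothContract (.mk X h.1) hω.form = -smoothD (.mk f hf) := SmoothForm.ext h.2

/-- Independence of the Lie derivative of the choice of the semi-Hamiltonian field. -/
theorem IsHamiltonian.lieDeriv_eq {f g : Form E M} (hf : IsHamiltonian ω f) (hω : IsNPlectic ω)
    {r : ℤ} (hr : f.flip = sgn (n - r) • f) {X X' : Multivector E M}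
    (hX : IsSemiHamiltonianField ω g X) (hX' : IsSemiHamiltonianField ω g X') :
    Form.lieDeriv X f = Form.lieDeriv X' f := by
  obtain ⟨_, _, h⟩ := hf.exists_pair hω hr
  have h1 : smoothContract (.mk X hX.1) hω.form = smoothContract (.mk X' hX'.1) hω.form :=
    SmoothForm.ext (hX.2.trans hX'.2.symm)
  exact congrArg SmoothForm.val (h.lie_eq hω.flip_form h1)

/-- The sum over homogeneous components of Lie derivatives. -/
theorem sum_lieDeriv_component {f g : Form E M} (hf : IsHamiltonian ω f) (hg : IsHamiltonian ω g)
    (hω : IsNPlectic ω) {X : Multivector E M} (hX : IsSemiHamiltonianField ω f X) :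
    ∑ b ∈ Finset.range (Module.finrank ℝ E + 1), ∑ a ∈ Finset.range (Module.finrank ℝ E + 1),
      Form.lieDeriv (semiHamiltonianField ω (f.component a)) (g.component b)
      = Form.lieDeriv X g := by
  let Z : ℕ → SmoothMultivector E M := fun a => .mk _ (hf.component a).semiHamiltonianField.1
  let F : ℕ → SmoothForm E M := fun a => .mk _ (hf.1.component a)
  let G : ℕ → SmoothForm E M := fun b => .mk _ (hg.1.component b)
  have hF : ∑ a ∈ Finset.range (Module.finrank ℝ E + 1), F a = .mk f hf.1 := by
    refine SmoothForm.ext ?_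
    rw [map_sum]
    exact Form.sum_component f
  have hG : ∑ a ∈ Finset.range (Module.finrank ℝ E + 1), G a = .mk g hg.1 := by
    refine SmoothForm.ext ?_
    rw [map_sum]
    exact Form.sum_component g
  -- The fields chosen for the components need not be components of X, but their sum has the same
  -- contraction with ω, and the Lie derivative sees nothing else.
  have h1 : smoothContract (∑ a ∈ Finset.range (Module.finrank ℝ E + 1), Z a) hω.form
      = smoothContract (.mk X hX.1) hω.form := by
    rw [hX.contract_form hω hf.1, ← hF, map_sum, map_sum, LinearMap.sum_apply,
      ← Finset.sum_neg_distrib]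
    exact Finset.sum_congr rfl fun a _ =>
      (hf.component a).semiHamiltonianField.contract_form hω (hf.1.component a)
  have h2 : ∀ b, smoothLie (∑ a ∈ Finset.range (Module.finrank ℝ E + 1), Z a) (G b)
      = smoothLie (.mk X hX.1) (G b) := by
    intro b
    obtain ⟨_, _, h⟩ := (hg.component b).exists_pair hω (r := n - b)
      (by rw [sub_sub_cancel]; exact Form.flip_component g b)
    exact h.lie_eq hω.flip_form h1
  have h3 : ∑ b ∈ Finset.range (Module.finrank ℝ E + 1),
      ∑ a ∈ Finset.range (Module.finrank ℝ E + 1), smoothLie (Z a) (G b)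
      = smoothLie (.mk X hX.1) (.mk g hg.1) := by
    rw [← hG, map_sum]
    refine Finset.sum_congr rfl fun b _ => ?_
    rw [← h2, map_sum, LinearMap.sum_apply]
  have h4 := congrArg SmoothForm.val h3
  rw [map_sum] at h4
  simp only [map_sum] at h4
  exact h4

/-- The field chosen for the zero form need not vanish. It contracts ω to zero, which suffices. -/
theorem lieDeriv_component_eq_zero {f g : Form E M} (hf : IsHamiltonian ω f)
    (hg : IsHamiltonian ω g) (hω : IsNPlectic ω) {a b : ℕ}
    (h : f.component a = 0 ∨ g.component b = 0) :
    Form.lieDeriv (semiHamiltonianField ω (f.component a)) (g.component b) = 0 := by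
  have hX := (hf.component a).semiHamiltonianField
  rcases h with h | h
  · have h0 : IsSemiHamiltonianField ω (f.component a) 0 := by
      refine ⟨(smoothMultivectors E M).zero_mem, ?_⟩
      rw [Form.zero_contract, h, Form.d_zero, neg_zero]
    rw [(hg.component b).lieDeriv_eq hω (r := n - b)
      (by rw [sub_sub_cancel]; exact Form.flip_component g b) hX h0]
    exact congrArg SmoothForm.val (LinearMap.map_zero₂ smoothLie (.mk _ (hg.1.component b)))
  · rw [h]
    exact congrArg SmoothForm.val (map_zero (smoothLie (.mk _ hX.1)))

/-- The 2-bracket of forms of symmetric parities `r`, `s`, for any choice of semi-Hamiltonian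
fields. -/
theorem D₂_eq {f g : Form E M} (hf : IsHamiltonian ω f) (hg : IsHamiltonian ω g)
    (hω : IsNPlectic ω) {r s : ℤ} (hr : f.flip = sgn (n - r) • f) (hs : g.flip = sgn (n - s) • g)
    {X Y : Multivector E M} (hX : IsSemiHamiltonianField ω f X)
    (hY : IsSemiHamiltonianField ω g Y) :
    D₂ ω f g = sgn r • Form.lieDeriv X g + (sgn (r * s) * sgn s) • Form.lieDeriv Y f := by
  rw [← sum_lieDeriv_component hf hg hω hX, ← sum_lieDeriv_component hg hf hω hY,
    Finset.sum_comm, D₂, Finset.smul_sum, Finset.smul_sum, ← Finset.sum_add_distrib]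
  refine Finset.sum_congr rfl fun a _ => ?_
  rw [Finset.smul_sum, Finset.smul_sum, ← Finset.sum_add_distrib]
  refine Finset.sum_congr rfl fun b _ => ?_
  -- The signs in `D₂` come from the degrees a and b. They agree with those of r and s on components
  -- of the right parity, and all other components vanish.
  by_cases ha : f.component a = 0
  · rw [lieDeriv_component_eq_zero hf hg hω (Or.inl ha),
      lieDeriv_component_eq_zero hg hf hω (Or.inr ha)]
    simp only [smul_zero]
  by_cases hb : g.component b = 0
  · rw [lieDeriv_component_eq_zero hf hg hω (Or.inr hb),
      lieDeriv_component_eq_zero hg hf hω (Or.inl hb)]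
    simp only [smul_zero]
  have ha' : sgn a = sgn (n - r) := not_not.1 fun h => ha (Form.component_eq_zero hr h)
  have hb' : sgn b = sgn (n - s) := not_not.1 fun h => hb (Form.component_eq_zero hs h)
  have ea : sgn (symDeg n a) = sgn r := by
    rw [symDeg, sgn_sub, ha', sgn_sub, ← mul_assoc, sgn_mul_self, one_mul]
  have eb : sgn (symDeg n b) = sgn s := by
    rw [symDeg, sgn_sub, hb', sgn_sub, ← mul_assoc, sgn_mul_self, one_mul]
  have eab : sgn₂ (symDeg n a) (symDeg n b) = sgn (r * s) := by
    rw [← sgn_mul_congr ea eb]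
    rfl
  rw [ea, eb, eab]

theorem HamiltonianPair.isSemiHamiltonianField {hω : IsNPlectic ω} {f : Form E M}
    {hf : f.IsSmooth} {r : ℤ} {X Y : SmoothMultivector E M}
    (h : HamiltonianPair hω.form (.mk f hf) r X Y) : IsSemiHamiltonianField ω f X.val :=
  ⟨X.isSmooth, congrArg SmoothForm.val h.contract_eq⟩

theorem D₂_eq_bracket {f g : Form E M} (hf : IsHamiltonian ω f) (hg : IsHamiltonian ω g)
    (hω : IsNPlectic ω) {r s : ℤ} (hr : f.flip = sgn (n - r) • f)
    (hs : g.flip = sgn (n - s) • g)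
    {X Y : SmoothMultivector E M} (hX : IsSemiHamiltonianField ω f X.val)
    (hY : IsSemiHamiltonianField ω g Y.val) (hXr : X ∈ parityFields E M r)
    (hYs : Y ∈ parityFields E M s) :
    D₂ ω f g = ((cartanCalculus E M).bracket r s (smoothContract X) (smoothContract Y)
      (.mk f hf.1) (.mk g hg.1)).val := by
  rw [D₂_eq hf hg hω hr hs hX hY, CartanCalculus.bracket, cartanCalculus_lie hXr,
    cartanCalculus_lie hYs]
  rfl

/-- Gives the right-hand side of the first fundamental equation of a 2-bracket from explicit fields,
without computing the 2-bracket. -/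
theorem d_D₂ {f g : Form E M} (hf : IsHamiltonian ω f) (hg : IsHamiltonian ω g)
    (hω : IsNPlectic ω) {r s : ℤ} (hr : f.flip = sgn (n - r) • f)
    (hs : g.flip = sgn (n - s) • g) {X Y : Multivector E M} (hX : IsSemiHamiltonianField ω f X)
    (hY : IsSemiHamiltonianField ω g Y) (hXr : X.flip = sgn r • X) (hYs : Y.flip = sgn s • Y) :
    Form.d (D₂ ω f g) = (2 : ℝ) • Form.d (Form.contract X (Form.contract Y ω.toForm)) := by
  have hXr' : SmoothMultivector.mk X hX.1 ∈ parityFields E M r := mem_parityFields.2 hXr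
  have hYs' : SmoothMultivector.mk Y hY.1 ∈ parityFields E M s := mem_parityFields.2 hYs
  rw [D₂_eq_bracket hf hg hω hr hs (X := .mk X hX.1) (Y := .mk Y hY.1) hX hY hXr' hYs']
  exact congrArg SmoothForm.val (CartanCalculus.d_bracket (K := cartanCalculus E M)
    (ω := hω.form) (smoothContract_mem hXr') (smoothContract_mem hYs')
    (hX.contract_form hω hf.1) (hY.contract_form hω hg.1))

theorem isHamiltonian_D₂ {f g : Form E M} (hf : IsHamiltonian ω f) (hg : IsHamiltonian ω g)
    (hω : IsNPlectic ω) {r s : ℤ} (hr : f.flip = sgn (n - r) • f)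
    (hs : g.flip = sgn (n - s) • g) :
    IsHamiltonian ω (D₂ ω f g) := by
  obtain ⟨X, Y, h⟩ := hf.exists_pair hω hr
  obtain ⟨X', Y', h'⟩ := hg.exists_pair hω hs
  obtain ⟨_, ⟨Z, -, rfl⟩, hZ, -⟩ := CartanCalculus.exists_semiHamiltonian_bracket
    (K := cartanCalculus E M) hω.d_form (smoothContract_mem h.mem) (smoothContract_mem h'.mem)
    h.contract_eq h'.contract_eq
  obtain ⟨_, ⟨W, -, rfl⟩, hW⟩ := CartanCalculus.exists_hamiltonian_bracket
    (K := cartanCalculus E M) (smoothContract_mem h.mem) (smoothContract_mem h'.mem)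
    (smoothContract_mem h.mem') (smoothContract_mem h'.mem') hω.d_form
    h.contract_eq h'.contract_eq h.contract_eq' h'.contract_eq'
  rw [D₂_eq_bracket hf hg hω hr hs h.isSemiHamiltonianField
    h'.isSemiHamiltonianField h.mem h'.mem]
  exact ⟨SmoothForm.isSmooth _, ⟨Z.val, Z.isSmooth, congrArg SmoothForm.val hZ⟩,
    W.val, W.isSmooth, congrArg SmoothForm.val hW⟩

/-- The parity is read off from D₂(f, g) = -i_W ω with W of parity r + s and ω of parity n + 1. The
outer bracket in the Jacobi expression needs no finer information on degrees. -/
theorem flip_D₂ {f g : Form E M} (hf : IsHamiltonian ω f) (hg : IsHamiltonian ω g)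
    (hω : IsNPlectic ω) {r s : ℤ} (hr : f.flip = sgn (n - r) • f)
    (hs : g.flip = sgn (n - s) • g) :
    (D₂ ω f g).flip = sgn (n - (r + s - 1)) • D₂ ω f g := by
  obtain ⟨X, Y, h⟩ := hf.exists_pair hω hr
  obtain ⟨X', Y', h'⟩ := hg.exists_pair hω hs
  obtain ⟨_, ⟨W, hW, rfl⟩, hWω⟩ := CartanCalculus.exists_hamiltonian_bracket
    (K := cartanCalculus E M) (smoothContract_mem h.mem) (smoothContract_mem h'.mem)
    (smoothContract_mem h.mem') (smoothContract_mem h'.mem') hω.d_form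
    h.contract_eq h'.contract_eq h.contract_eq' h'.contract_eq'
  have e : D₂ ω f g = -Form.contract W.val hω.form.val := by
    rw [D₂_eq_bracket hf hg hω hr hs h.isSemiHamiltonianField
    h'.isSemiHamiltonianField h.mem h'.mem, ← val_smoothContract, hWω, map_neg, neg_neg]
  rw [e, Form.flip_neg, Form.flip_contract, hω.flip_form, mem_parityFields.1 hW,
    Form.contract_smul, Form.smul_contract]
  simp only [sgn_add, sgn_sub, sgn_one]
  module

/-- The formula for the graded Jacobi expression. -/
theorem jacobiator_eq (hω : IsNPlectic ω) {a : Fin 3 → ℕ} {f : Fin 3 → Form E M}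
    (hf : ∀ i, IsHamiltonian ω (f i)) (ha : ∀ i, (f i).IsHomogeneous (a i))
    {XD : Fin 3 → Fin 3 → Multivector E M}
    (hXD : ∀ i j, IsSemiHamiltonianField ω (D₂ ω (f i) (f j)) (XD i j)) :
    jacobiator ω a f = -(1 / 2 : ℝ) • ∑ s ∈ shuffles 2 1,
      (koszulSign s (fun i => symDeg n (a i)) *
          sgn (symDeg n (a (s 0))) * sgn (symDeg n (a (s 1)))) •
        Form.lieDeriv (XD (s 0) (s 1)) (f (s 2)) := by
  have hr : ∀ i, (f i).flip = sgn (n - symDeg n (a i)) • f i := fun i => by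
    rw [symDeg, sub_sub_cancel]
    exact (ha i).flip
  choose X Y hXY using fun i => (hf i).exists_pair hω (hr i)
  have hD := fun i j => isHamiltonian_D₂ (hf i) (hf j) hω (hr i) (hr j)
  have hDr := fun i j => flip_D₂ (hf i) (hf j) hω (hr i) (hr j)
  choose D D' hDD using fun i j => (hD i j).exists_pair hω (hDr i j)
  have hDb := fun i j => D₂_eq_bracket (hf i) (hf j) hω (hr i) (hr j)
    (hXY i).isSemiHamiltonianField (hXY j).isSemiHamiltonianField (hXY i).mem (hXY j).mem
  have hDF : ∀ i j, SmoothForm.mk _ (hD i j).1 = _ := fun i j => SmoothForm.ext (hDb i j)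
  -- The fields `XD` need not have definite parity; by independence of the choice they may be
  -- exchanged for the fields `D`.
  have hlie : ∀ i j k, Form.lieDeriv (XD i j) (f k)
      = ((cartanCalculus E M).lie (symDeg n (a i) + symDeg n (a j) - 1)
        (smoothContract (D i j)) (.mk (f k) (hf k).1)).val := fun i j k => by
    rw [cartanCalculus_lie (hDD i j).mem]
    exact (hf k).lieDeriv_eq hω (hr k) (hXD i j) (hDD i j).isSemiHamiltonianField
  have hDDb := fun i j k => D₂_eq_bracket (hD i j) (hf k) hω (hDr i j) (hr k)
    (hDD i j).isSemiHamiltonianField (hXY k).isSemiHamiltonianField (hDD i j).mem (hXY k).mem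
  have key := CartanCalculus.jacobi (K := cartanCalculus E M) hω.d_form
    (fun i => smoothContract_mem (hXY i).mem) (fun i => smoothContract_mem (hXY i).mem')
    (fun i => (hXY i).contract_eq) (fun i => (hXY i).contract_eq')
    (fun i j => smoothContract_mem (hDD i j).mem)
    (fun i j => (hDD i j).contract_eq.trans (by rw [hDF]; rfl))
  simp only [← hDF] at key
  have key' := congrArg SmoothForm.val key
  simp only [map_add, map_smul, ← hlie, ← hDDb] at key'
  rw [jacobiator, sum_shuffles_two_one, sum_shuffles_two_one, koszulSign_one, koszulSign_swap,
    koszulSign_rotate, one_mul]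
  refine Eq.trans ?_ (key'.trans ?_)
  · rw [one_smul ℝ]
    rfl
  · rfl

end Hamiltonian

/-! ### Forms and multivector fields on a vector space -/

section ModelSpace

variable {V : Type u} [NormedAddCommGroup V] [NormedSpace ℝ V] {r : ℕ}

theorem Form.contract_zero {M : Type v} [TopologicalSpace M] [ChartedSpace V M]
    (X : Multivector V M) : Form.contract X 0 = 0 := by
  have h := Form.contract_smul X 0 (0 : Form V M)
  rwa [zero_smul ℝ (0 : Form V M), zero_smul ℝ (Form.contract X 0)] at h

theorem chartDeriv_self (x m : V) : chartDeriv x m = ContinuousLinearMap.id ℝ V := by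
  rw [chartDeriv, extChartAt_model_space_eq_id]
  exact mfderiv_id

theorem chartSymmDeriv_self (x m : V) : chartSymmDeriv x m = ContinuousLinearMap.id ℝ V := by
  rw [chartSymmDeriv, extChartAt_model_space_eq_id]
  exact mfderiv_id

theorem FormSection.inChart_self (α : FormSection V V r) (x : V) : α.inChart x = α.toModel := by
  funext y
  rw [inChart_apply, chartSymmDeriv_self, extChartAt_model_space_eq_id]
  rfl

theorem FormSection.toModel_d_self (α : FormSection V V r) (m : V) :
    α.d.toModel m = extDeriv α.toModel m := by
  rw [toModel_d, chartDeriv_self, inChart_self, extChartAt_model_space_eq_id]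
  rfl

theorem MultivectorSection.inChart_self (X : MultivectorSection V V r) (x y : V) :
    X.inChart x y = X.toModel y := by
  rw [inChart_apply, chartDeriv_self, extChartAt_model_space_eq_id]
  exact LinearMap.congr_fun exteriorPower.map_id (X.toModel y)

/-- The section `φ c` for a function `φ` and a constant form `c`. -/
def scaledSection (φ : V → ℝ) (c : V [⋀^Fin r]→L[ℝ] ℝ) : FormSection V V r := fun m => φ m • c

/-- The form `φ c` for a function `φ` and a constant form `c`. -/
def scaledForm (φ : V → ℝ) (c : V [⋀^Fin r]→L[ℝ] ℝ) : Form V V :=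
  (scaledSection φ c).toForm

/-- The section `φ (w_1 ∧ ⋯ ∧ w_r)` for a function `φ` and vectors `w_i`. -/
def scaledMultivectorSection (φ : V → ℝ) (w : Fin r → V) : MultivectorSection V V r :=
  fun m => φ m • exteriorPower.ιMulti ℝ r w

/-- The multivector field `φ (w_1 ∧ ⋯ ∧ w_r)` for a function `φ` and vectors `w_i`. -/
def scaledField (φ : V → ℝ) (w : Fin r → V) : Multivector V V :=
  Pi.single r (scaledMultivectorSection φ w)

theorem neg_scaledForm (φ : V → ℝ) (c : V [⋀^Fin r]→L[ℝ] ℝ) :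
    -scaledForm φ c = scaledForm (fun m => -φ m) c := by
  rw [scaledForm, scaledForm, FormSection.toForm, FormSection.toForm, ← Pi.single_neg]
  congr 1
  funext m
  exact (neg_smul (φ m) c).symm

theorem smul_scaledForm (a : ℝ) (φ : V → ℝ) (c : V [⋀^Fin r]→L[ℝ] ℝ) :
    a • scaledForm φ c = scaledForm (fun m => a * φ m) c := by
  rw [scaledForm, scaledForm, FormSection.toForm, FormSection.toForm, ← Pi.single_smul]
  congr 1
  funext m
  exact (mul_smul a (φ m) c).symm

theorem isSmooth_scaledSection {φ : V → ℝ} (hφ : ContDiff ℝ (⊤ : ℕ∞) φ)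
    (c : V [⋀^Fin r]→L[ℝ] ℝ) : (scaledSection φ c).IsSmooth := by
  intro x
  rw [FormSection.inChart_self]
  exact (hφ.smul contDiff_const).contDiffOn

/-- The hypothesis `h` is dφ ∧ c = ψ c' evaluated on vectors, so that exterior derivatives of
explicit forms reduce to polynomial identities. -/
theorem d_scaledSection {φ : V → ℝ} {φ' : V → V →L[ℝ] ℝ} (hφ : ∀ m, HasFDerivAt φ (φ' m) m)
    {c : V [⋀^Fin r]→L[ℝ] ℝ} {ψ : V → ℝ} {c' : V [⋀^Fin (r + 1)]→L[ℝ] ℝ}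
    (h : ∀ m v, ∑ i : Fin (r + 1), (-1 : ℝ) ^ (i : ℕ) * (φ' m (v i) * c (i.removeNth v))
      = ψ m * c' v) : (scaledSection φ c).d = scaledSection ψ c' := by
  funext m
  have h' : (scaledSection φ c).d.toModel m = ψ m • c' := by
    rw [FormSection.toModel_d_self]
    have hd : HasFDerivAt (scaledSection φ c).toModel ((φ' m).smulRight c) m :=
      (hφ m).smul_const c
    ext v
    rw [extDeriv_apply hd.differentiableAt]
    refine Eq.trans (Finset.sum_congr rfl fun i _ => ?_) (h m v)
    have hi : HasFDerivAt (fun x => (scaledSection φ c).toModel x (i.removeNth v))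
        ((φ' m).smulRight (c (i.removeNth v))) m := (hφ m).smul_const (c (i.removeNth v))
    rw [hi.fderiv, ContinuousLinearMap.smulRight_apply, smul_eq_mul, zsmul_eq_mul]
    push_cast
    rfl
  exact h'

theorem d_scaledForm {φ : V → ℝ} {φ' : V → V →L[ℝ] ℝ} (hφ : ∀ m, HasFDerivAt φ (φ' m) m)
    {c : V [⋀^Fin r]→L[ℝ] ℝ} {ψ : V → ℝ} {c' : V [⋀^Fin (r + 1)]→L[ℝ] ℝ}
    (h : ∀ m v, ∑ i : Fin (r + 1), (-1 : ℝ) ^ (i : ℕ) * (φ' m (v i) * c (i.removeNth v))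
      = ψ m * c' v) : Form.d (scaledForm φ c) = scaledForm ψ c' := by
  have h1 := Form.d_component (scaledForm φ c) r
  have h2 : (scaledForm φ c).component r = scaledForm φ c := by
    rw [Form.component, scaledForm, FormSection.toForm, Pi.single_eq_same]
  have h3 : Form.d (scaledForm φ c) (r + 1) = scaledSection ψ c' := by
    rw [← d_scaledSection hφ h]
    change FormSection.d ((scaledSection φ c).toForm r) = _
    rw [FormSection.toForm, Pi.single_eq_same]
  rw [h2, Form.component, h3] at h1
  exact h1

theorem flip_scaledField (φ : V → ℝ) (w : Fin r → V) :
    (scaledField φ w).flip = sgn r • scaledField φ w := by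
  funext k
  change (-1 : ℝ) ^ k • scaledField φ w k = sgn r • scaledField φ w k
  by_cases hk : k = r
  · subst hk
    rw [sgn, zpow_natCast]
  · rw [scaledField, Pi.single_eq_of_ne hk, smul_zero, smul_zero]

theorem contract_scaledField [FiniteDimensional ℝ V] {k l : ℕ} (h : r + k = l)
    (hr : r ≤ Module.finrank ℝ V) (φ ψ : V → ℝ) {w : Fin r → V} {c : V [⋀^Fin l]→L[ℝ] ℝ}
    {c' : V [⋀^Fin k]→L[ℝ] ℝ} (hc : ∀ z, c (fun i => Fin.append w z (Fin.cast h.symm i)) = c' z) :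
    Form.contract (scaledField φ w) (scaledForm ψ c) = scaledForm (fun m => φ m * ψ m) c' := by
  subst h
  funext j m
  have h1 : Form.contract (scaledField φ w) (scaledForm ψ c) j m
      = contract (scaledField φ w r m) (scaledForm ψ c (r + j) m) := by
    refine Finset.sum_eq_single_of_mem r (Finset.mem_range.2 (by omega)) fun i _ hi => ?_
    rw [scaledField, Pi.single_eq_of_ne hi]
    exact contract_zero_left _
  rw [h1]
  by_cases hj : j = k
  · subst hj
    rw [scaledField, scaledForm, scaledForm, FormSection.toForm, FormSection.toForm,
      Pi.single_eq_same, Pi.single_eq_same, Pi.single_eq_same]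
    change contract (φ m • exteriorPower.ιMulti ℝ r w) (ψ m • c) = (φ m * ψ m) • c'
    rw [contract, map_smul, exteriorPower.alternatingMapLinearEquiv_apply_ιMulti]
    ext z
    change φ m * (ψ m * c (Fin.append w z)) = φ m * ψ m * c' z
    rw [← hc z, mul_assoc]
    rfl
  · rw [scaledForm, scaledForm, FormSection.toForm, FormSection.toForm, Pi.single_eq_of_ne hj,
      Pi.single_eq_of_ne (by omega)]
    exact contract_zero_right _

theorem isSmooth_scaledField [FiniteDimensional ℝ V] {φ : V → ℝ} (hφ : ContDiff ℝ (⊤ : ℕ∞) φ)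
    (w : Fin r → V) : (scaledField φ w).IsSmooth := by
  intro k
  by_cases hk : k = r
  · subst hk
    rw [scaledField, Pi.single_eq_same]
    intro x l
    simp only [MultivectorSection.inChart_self]
    have : ∀ y, exteriorPower.alternatingMapLinearEquiv l
        ((scaledMultivectorSection φ w).toModel y) = φ y * l w := fun y => by
      change exteriorPower.alternatingMapLinearEquiv l (φ y • exteriorPower.ιMulti ℝ k w) = _
      rw [map_smul, exteriorPower.alternatingMapLinearEquiv_apply_ιMulti, smul_eq_mul]
    simp only [this]
    exact (hφ.mul contDiff_const).contDiffOn
  · rw [scaledField, Pi.single_eq_of_ne hk]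
    exact (smoothMultivectors V V).zero_mem k

end ModelSpace

/-! ### Failure of the graded Jacobi identity on the plane -/

namespace PlaneArea

/-- The plane. -/
abbrev Plane : Type := EuclideanSpace ℝ (Fin 2)

/-- The constant function `1`, as a form on the tangent spaces. -/
def one : Plane [⋀^Fin 0]→L[ℝ] ℝ := ContinuousAlternatingMap.constOfIsEmpty ℝ Plane (Fin 0) 1

/-- The form `dy`. -/
def dy : Plane [⋀^Fin 1]→L[ℝ] ℝ :=
  ContinuousAlternatingMap.ofSubsingleton ℝ Plane ℝ (0 : Fin 1) (EuclideanSpace.proj 1)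

/-- The area form `dx ∧ dy`. -/
def area : Plane [⋀^Fin 2]→L[ℝ] ℝ :=
  { (EuclideanSpace.basisFun (Fin 2) ℝ).toBasis.det with
    cont := by
      have : ∀ v : Fin 2 → Plane, (EuclideanSpace.basisFun (Fin 2) ℝ).toBasis.det v
          = v 0 0 * v 1 1 - v 1 0 * v 0 1 := fun v => by
        rw [Module.Basis.det_apply, Matrix.det_fin_two]
        simp [Module.Basis.toMatrix_apply]
      change Continuous fun v => (EuclideanSpace.basisFun (Fin 2) ℝ).toBasis.det v
      simp only [this]
      fun_prop }

theorem area_apply (v : Fin 2 → Plane) : area v = v 0 0 * v 1 1 - v 1 0 * v 0 1 := by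
  change (EuclideanSpace.basisFun (Fin 2) ℝ).toBasis.det v = _
  rw [Module.Basis.det_apply, Matrix.det_fin_two]
  simp [Module.Basis.toMatrix_apply]

theorem dy_apply (v : Fin 1 → Plane) : dy v = v 0 1 := rfl

theorem one_apply (v : Fin 0 → Plane) : one v = 1 := rfl

/-- The vector `∂x`. -/
def ex : Plane := EuclideanSpace.single 0 1

/-- The vector `∂y`. -/
def ey : Plane := EuclideanSpace.single 1 1

theorem ex_zero : ex 0 = 1 := by simp [ex]
theorem ex_one : ex 1 = 0 := by simp [ex]
theorem ey_zero : ey 0 = 0 := by simp [ey]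
theorem ey_one : ey 1 = 1 := by simp [ey]

theorem hasFDerivAt_coord (i : Fin 2) (m : Plane) :
    HasFDerivAt (fun m : Plane => m i) (EuclideanSpace.proj i : Plane →L[ℝ] ℝ) m :=
  (EuclideanSpace.proj i : Plane →L[ℝ] ℝ).hasFDerivAt

theorem contract_function {k : ℕ} (φ ψ : Plane → ℝ) (c : Plane [⋀^Fin k]→L[ℝ] ℝ) :
    Form.contract (scaledField φ ![]) (scaledForm ψ c) = scaledForm (fun m => φ m * ψ m) c :=
  contract_scaledField (Nat.zero_add k) (Nat.zero_le _) φ ψ fun z => by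
    congr 1
    funext i
    simp [Fin.append, Fin.addCases]

theorem contract_ex_area (φ ψ : Plane → ℝ) :
    Form.contract (scaledField φ ![ex]) (scaledForm ψ area) = scaledForm (fun m => φ m * ψ m) dy :=
  contract_scaledField (r := 1) (k := 1) (l := 2) rfl (by simp) φ ψ fun z => by
    rw [area_apply, dy_apply]
    simp [Fin.append, Fin.addCases, ex_zero, ex_one]

theorem contract_ex_ey_area (φ ψ : Plane → ℝ) :
    Form.contract (scaledField φ ![ex, ey]) (scaledForm ψ area)
      = scaledForm (fun m => φ m * ψ m) one :=
  contract_scaledField (r := 2) (k := 0) (l := 2) rfl (by simp) φ ψ fun z => by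
    rw [area_apply, one_apply]
    simp [Fin.append, Fin.addCases, ex_zero, ex_one, ey_zero, ey_one]

/-- The area form as a field of forms. -/
abbrev ω : FormSection Plane Plane (1 + 1) := scaledSection (fun _ => 1) area

theorem eq_of_area_eq {v v' : Plane}
    (h : ∀ z : Fin 1 → Plane, area (Matrix.vecCons v z) = area (Matrix.vecCons v' z)) :
    v = v' := by
  have h0 := h ![ex]
  have h1 := h ![ey]
  simp only [area_apply, Matrix.cons_val_zero, Matrix.cons_val_one, ex_zero, ex_one, ey_zero,
    ey_one] at h0 h1
  ext i
  fin_cases i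
  · change v 0 = v' 0
    linarith
  · change v 1 = v' 1
    linarith

theorem isNPlectic_ω : IsNPlectic ω where
  one_le := le_rfl
  smooth := isSmooth_scaledSection contDiff_const area
  closed := by
    rw [d_scaledSection (φ' := fun _ => 0) (ψ := fun _ => 0) (c' := 0)
      (fun m => hasFDerivAt_const 1 m) fun m v => by simp]
    funext m
    exact zero_smul ℝ _
  nondegenerate m v v' h := by
    refine eq_of_area_eq fun z => ?_
    have := DFunLike.congr_fun h z
    change (1 : ℝ) * area (Matrix.vecCons v z) = 1 * area (Matrix.vecCons v' z) at this
    rwa [one_mul, one_mul] at this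

/-- The forms `-(x² / 2) dy`, `y²` and `1`. -/
def f : Fin 3 → Form Plane Plane :=
  ![scaledForm (fun m => -(m 0 ^ 2 / 2)) dy, scaledForm (fun m => m 1 ^ 2) one,
    scaledForm (fun _ => 1) one]

theorem d_f_zero : Form.d (f 0) = scaledForm (fun m => -m 0) area :=
  d_scaledForm (φ' := fun m => (-m 0) • EuclideanSpace.proj 0)
    (fun m => by
      have h := (((hasFDerivAt_coord 0 m).pow 2).mul_const (1 / 2)).neg
      refine (h.congr_of_eventuallyEq (Filter.Eventually.of_forall fun m => ?_)).congr_fderiv ?_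
      · simp [div_eq_mul_inv]
      · ext v; simp; ring)
    fun m v => by
      rw [Fin.sum_univ_two, area_apply, dy_apply, dy_apply]
      simp [Fin.removeNth]
      ring

theorem d_f_one : Form.d (f 1) = scaledForm (fun m => 2 * m 1) dy :=
  d_scaledForm (φ' := fun m => (2 * m 1) • EuclideanSpace.proj 1)
    (fun m => by
      refine ((hasFDerivAt_coord 1 m).pow 2).congr_fderiv ?_
      ext v; simp)
    fun m v => by
      rw [Fin.sum_univ_one, dy_apply, one_apply]
      simp

theorem d_f_two : Form.d (f 2) = 0 := by
  have h : Form.d (f 2) = scaledForm (fun _ => 0) dy :=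
    d_scaledForm (φ' := fun _ => 0) (fun m => hasFDerivAt_const 1 m) fun m v => by simp
  rw [h, ← zero_smul ℝ (scaledForm (fun _ => 0) dy), smul_scaledForm]
  simp only [zero_mul]

/-- Semi-Hamiltonian multivector fields for `f`. -/
def X : Fin 3 → Multivector Plane Plane :=
  ![scaledField (fun m => m 0) ![], scaledField (fun m => -(2 * m 1)) ![ex], 0]

/-- Hamiltonian multivector fields for `f`. -/
def Y : Fin 3 → Multivector Plane Plane :=
  ![scaledField (fun m => m 0 ^ 2 / 2) ![ex], scaledField (fun m => -(m 1 ^ 2)) ![ex, ey],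
    scaledField (fun _ => -1) ![ex, ey]]

theorem contDiff_coord (i : Fin 2) : ContDiff ℝ (⊤ : ℕ∞) fun m : Plane => m i :=
  (EuclideanSpace.proj i : Plane →L[ℝ] ℝ).contDiff

theorem isSemiHamiltonianField_X : ∀ i, IsSemiHamiltonianField ω (f i) (X i) := by
  refine Fin.forall_fin_succ.2 ⟨⟨isSmooth_scaledField (contDiff_coord 0) _, ?_⟩,
    Fin.forall_fin_two.2 ⟨⟨isSmooth_scaledField (contDiff_const.mul (contDiff_coord 1)).neg _, ?_⟩,
      (smoothMultivectors Plane Plane).zero_mem, ?_⟩⟩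
  · rw [d_f_zero, neg_scaledForm]
    exact (contract_function (fun m => m 0) (fun _ => 1) area).trans
      (congrArg (fun φ => scaledForm φ area) (funext fun m => by simp))
  · refine Eq.trans ?_ (congrArg Neg.neg d_f_one).symm
    rw [neg_scaledForm]
    exact (contract_ex_area (fun m => -(2 * m 1)) (fun _ => 1)).trans
      (congrArg (fun φ => scaledForm φ dy) (funext fun m => by simp))
  · refine Eq.trans (Form.zero_contract _) (Eq.trans ?_ (congrArg Neg.neg d_f_two).symm)
    exact neg_zero.symm

theorem isHamiltonianField_Y : ∀ i, IsHamiltonianField ω (f i) (Y i) := by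
  refine Fin.forall_fin_succ.2 ⟨⟨isSmooth_scaledField
      (((contDiff_coord 0).pow 2).div_const 2) _, ?_⟩,
    Fin.forall_fin_two.2 ⟨⟨isSmooth_scaledField ((contDiff_coord 1).pow 2).neg _, ?_⟩,
      ⟨isSmooth_scaledField contDiff_const _, ?_⟩⟩⟩
  · refine Eq.trans ?_ (neg_scaledForm _ _).symm
    exact (contract_ex_area (fun m => m 0 ^ 2 / 2) (fun _ => 1)).trans
      (congrArg (fun φ => scaledForm φ dy) (funext fun m => by simp))
  · refine Eq.trans ?_ (neg_scaledForm _ _).symm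
    exact (contract_ex_ey_area (fun m => -(m 1 ^ 2)) (fun _ => 1)).trans
      (congrArg (fun φ => scaledForm φ one) (funext fun m => by simp))
  · refine Eq.trans ?_ (neg_scaledForm _ _).symm
    exact (contract_ex_ey_area (fun _ => -1) (fun _ => 1)).trans
      (congrArg (fun φ => scaledForm φ one) (funext fun m => by simp))

theorem isSmooth_f : ∀ i, (f i).IsSmooth := by
  refine Fin.forall_fin_succ.2 ⟨(isSmooth_scaledSection
      (((contDiff_coord 0).pow 2).div_const 2).neg _).toForm,
    Fin.forall_fin_two.2 ⟨(isSmooth_scaledSection ((contDiff_coord 1).pow 2) _).toForm,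
      (isSmooth_scaledSection contDiff_const _).toForm⟩⟩

theorem isHamiltonian_f (i : Fin 3) : IsHamiltonian ω (f i) :=
  ⟨isSmooth_f i, ⟨X i, isSemiHamiltonianField_X i⟩, Y i, isHamiltonianField_Y i⟩

theorem isHomogeneous_f : ∀ i, (f i).IsHomogeneous (![1, 0, 0] i) :=
  Fin.forall_fin_succ.2 ⟨Form.IsHomogeneous.single _, Fin.forall_fin_two.2
    ⟨Form.IsHomogeneous.single _, Form.IsHomogeneous.single _⟩⟩

theorem flip_f (i : Fin 3) :
    (f i).flip = sgn ((1 : ℕ) - symDeg 1 (![1, 0, 0] i)) • f i := by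
  rw [symDeg, sub_sub_cancel]
  exact (isHomogeneous_f i).flip

theorem flip_X : ∀ i, (X i).flip = sgn (symDeg 1 (![1, 0, 0] i)) • X i := by
  refine Fin.forall_fin_succ.2 ⟨?_, Fin.forall_fin_two.2 ⟨?_, ?_⟩⟩
  · exact flip_scaledField _ _
  · exact flip_scaledField _ _
  · refine Eq.trans (funext fun r => smul_zero _) (smul_zero _).symm

theorem d_D₂_f (i j : Fin 3) : Form.d (D₂ ω (f i) (f j))
    = (2 : ℝ) • Form.d (Form.contract (X i) (Form.contract (X j) ω.toForm)) :=
  d_D₂ (isHamiltonian_f i) (isHamiltonian_f j) isNPlectic_ω (flip_f i) (flip_f j)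
    (isSemiHamiltonianField_X i) (isSemiHamiltonianField_X j) (flip_X i) (flip_X j)

/-- Since d(-2xy dy) = -2y dx ∧ dy, the 2-bracket has differential -4y dx ∧ dy, and the function 4y,
as a multivector field of degree zero, contracts the area form to its negative. -/
theorem isSemiHamiltonianField_D₂_zero_one :
    IsSemiHamiltonianField ω (D₂ ω (f 0) (f 1)) (scaledField (fun m => 4 * m 1) ![]) := by
  refine ⟨isSmooth_scaledField (contDiff_const.mul (contDiff_coord 1)) _, ?_⟩
  have h1 : Form.contract (X 0) (Form.contract (X 1) ω.toForm)
      = scaledForm (fun m => m 0 * (-(2 * m 1) * 1)) dy :=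
    (congrArg _ (contract_ex_area _ _)).trans (contract_function _ _ _)
  have h2 : Form.d (scaledForm (fun m : Plane => m 0 * (-(2 * m 1) * 1)) dy)
      = scaledForm (fun m => -(2 * m 1)) area :=
    d_scaledForm (φ' := fun m => (-(2 * m 1)) • EuclideanSpace.proj 0
        + (-(2 * m 0)) • EuclideanSpace.proj 1)
      (fun m => by
        have h := ((hasFDerivAt_coord 0 m).mul (hasFDerivAt_coord 1 m)).mul_const (-2)
        refine (h.congr_of_eventuallyEq (Filter.Eventually.of_forall fun m => ?_)).congr_fderiv ?_
        · simp; ring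
        · ext v; simp; ring)
      fun m v => by
        rw [Fin.sum_univ_two, area_apply, dy_apply, dy_apply]
        simp [Fin.removeNth]
        ring
  rw [d_D₂_f, h1, h2, smul_scaledForm, neg_scaledForm]
  refine (contract_function _ _ _).trans (congrArg (fun φ => scaledForm φ area) (funext fun m => ?_))
  ring

/-- The constant 1 has semi-Hamiltonian field 0, so 2-brackets with it are closed by `d_D₂_f`. -/
theorem isSemiHamiltonianField_D₂_two (i : Fin 3) :
    IsSemiHamiltonianField ω (D₂ ω (f i) (f 2)) 0 := by
  refine ⟨(smoothMultivectors Plane Plane).zero_mem, ?_⟩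
  have h2 : Form.contract (X 2) ω.toForm = 0 := Form.zero_contract _
  rw [d_D₂_f, h2, Form.contract_zero, Form.d_zero, Form.zero_contract, smul_zero, neg_zero]

theorem lieDeriv_zero (α : Form Plane Plane) (hα : α.IsSmooth) : Form.lieDeriv 0 α = 0 :=
  congrArg SmoothForm.val (LinearMap.map_zero₂ smoothLie (SmoothForm.mk α hα))

/-- The source of the failure: a multivector field h of degree zero acts on the constant 1 by dh,
which need not vanish. -/
theorem lieDeriv_f_two :
    Form.lieDeriv (scaledField (fun m => 4 * m 1) ![]) (f 2) = scaledForm (fun _ => 4) dy := by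
  have h1 : Form.contract (scaledField (fun m => 4 * m 1) ![]) (f 2)
      = scaledForm (fun m => 4 * m 1 * 1) one := contract_function _ _ _
  rw [Form.lieDeriv_eq, d_f_two, Form.contract_zero, sub_zero, h1]
  refine d_scaledForm (φ' := fun m => (4 : ℝ) • EuclideanSpace.proj 1) (fun m => ?_) fun m v => ?_
  · have h := (hasFDerivAt_coord 1 m).const_mul 4
    refine h.congr_of_eventuallyEq (Filter.Eventually.of_forall fun m => ?_)
    simp
  · rw [Fin.sum_univ_one, dy_apply, one_apply]
    simp

/-- By `jacobiator_eq`, the shuffles with the constant in the inner bracket contribute nothing. The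
identity shuffle gives -1/2 · e(f 0) e(f 1) · 4 dy, and the symmetric degrees 0 and 1 turn this into
2 dy. -/
theorem jacobiator_ne_zero : jacobiator ω ![1, 0, 0] f ≠ 0 := by
  have hD : ∀ i j, IsSemiHamiltonianField ω (D₂ ω (f i) (f j))
      (semiHamiltonianField ω (D₂ ω (f i) (f j))) := fun i j =>
    (isHamiltonian_D₂ (isHamiltonian_f i) (isHamiltonian_f j) isNPlectic_ω (flip_f i)
      (flip_f j)).semiHamiltonianField
  have h01 : Form.lieDeriv (semiHamiltonianField ω (D₂ ω (f 0) (f 1))) (f 2)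
      = scaledForm (fun _ => 4) dy :=
    ((isHamiltonian_f 2).lieDeriv_eq isNPlectic_ω (flip_f 2) (hD 0 1)
      isSemiHamiltonianField_D₂_zero_one).trans lieDeriv_f_two
  have h2 : ∀ i k, Form.lieDeriv (semiHamiltonianField ω (D₂ ω (f i) (f 2))) (f k) = 0 :=
    fun i k => ((isHamiltonian_f k).lieDeriv_eq isNPlectic_ω (flip_f k) (hD i 2)
      (isSemiHamiltonianField_D₂_two i)).trans (lieDeriv_zero _ (isSmooth_f k))
  have key : jacobiator ω ![1, 0, 0] f = scaledForm (fun _ => 2) dy := by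
    rw [jacobiator_eq isNPlectic_ω isHamiltonian_f isHomogeneous_f hD, sum_shuffles_two_one]
    have e1 : Equiv.swap (1 : Fin 3) 2 1 = 2 := by decide
    have e2 : (Equiv.swap 0 2 * Equiv.swap 0 1 : Equiv.Perm (Fin 3)) 1 = 2 := by decide
    rw [e1, e2, h2, h2]
    simp only [Equiv.Perm.coe_one, id, h01, koszulSign_one, smul_zero, add_zero]
    rw [smul_scaledForm, smul_scaledForm]
    congr 1
    funext m
    simp [symDeg, sgn]
    norm_num
  intro h
  have h3 := congrFun (congrFun (key.symm.trans h) 1) 0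
  have h4 : (2 : ℝ) * dy (fun _ => ey) = 0 := by
    rw [scaledForm, FormSection.toForm, Pi.single_eq_same] at h3
    exact DFunLike.congr_fun h3 (fun _ => ey)
  rw [dy_apply, ey_one] at h4
  norm_num at h4

end PlaneArea

end NPlectic

end

open NPlectic in
theorem mainTheorem3 :
    -- the graded Jacobi identity fails in general
    (∃ (d n : ℕ)
        (ω : FormSection (EuclideanSpace ℝ (Fin d)) (EuclideanSpace ℝ (Fin d)) (n + 1))
        (a : Fin 3 → ℕ)
        (f : Fin 3 → Form (EuclideanSpace ℝ (Fin d)) (EuclideanSpace ℝ (Fin d))),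
      IsNPlectic ω ∧ (∀ i, IsHamiltonian ω (f i)) ∧ (∀ i, (f i).IsHomogeneous (a i)) ∧
        jacobiator ω a f ≠ 0) ∧
    (∀ (E : Type*) [NormedAddCommGroup E] [NormedSpace ℝ E] [FiniteDimensional ℝ E]
        (M : Type*) [TopologicalSpace M] [ChartedSpace E M]
        [IsManifold 𝓘(ℝ, E) (⊤ : ℕ∞) M] [T2Space M] [SecondCountableTopology M]
        (n : ℕ) (ω : FormSection E M (n + 1)) (_ : IsNPlectic ω)
        (a : Fin 3 → ℕ) (f : Fin 3 → Form E M)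
        (_ : ∀ i, IsHamiltonian ω (f i)) (_ : ∀ i, (f i).IsHomogeneous (a i)),
      -- `D₂` does not depend on the choice of associated semi-Hamiltonian multivector fields
      (∀ i j, ∀ X₁ X₂ : Multivector E M,
        IsSemiHamiltonianField ω (f i) X₁ → IsSemiHamiltonianField ω (f j) X₂ →
        D₂ ω (f i) (f j) =
          sgn (symDeg n (a i)) • Form.lieDeriv X₁ (f j)
            + (sgn₂ (symDeg n (a i)) (symDeg n (a j)) * sgn (symDeg n (a j))) •
              Form.lieDeriv X₂ (f i)) ∧
      -- `D₂` takes values in Hamiltonian forms, so the fields `X_{D₂}(f i, f j)` exist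
      (∀ i j, IsHamiltonian ω (D₂ ω (f i) (f j))) ∧
      -- the formula for the graded Jacobi expression, for all such fields
      ∀ XD : Fin 3 → Fin 3 → Multivector E M,
        (∀ i j, IsSemiHamiltonianField ω (D₂ ω (f i) (f j)) (XD i j)) →
        jacobiator ω a f =
          -(1 / 2 : ℝ) • ∑ s ∈ shuffles 2 1,
            (koszulSign s (fun i => symDeg n (a i)) *
                sgn (symDeg n (a (s 0))) * sgn (symDeg n (a (s 1)))) •
              Form.lieDeriv (XD (s 0) (s 1)) (f (s 2))) := by
  refine ⟨⟨2, 1, PlaneArea.ω, ![1, 0, 0], PlaneArea.f, PlaneArea.isNPlectic_ω,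
    PlaneArea.isHamiltonian_f, PlaneArea.isHomogeneous_f, PlaneArea.jacobiator_ne_zero⟩, ?_⟩
  intro E _ _ _ M _ _ _ _ _ n ω hω a f hf ha
  have hr : ∀ i, (f i).flip = sgn (n - symDeg n (a i)) • f i := fun i => by
    rw [symDeg, sub_sub_cancel]
    exact (ha i).flip
  exact ⟨fun i j _ _ hX hY => D₂_eq (hf i) (hf j) hω (hr i) (hr j) hX hY,
    fun i j => isHamiltonian_D₂ (hf i) (hf j) hω (hr i) (hr j),
    fun _ hXD => jacobiator_eq hω hf ha hXD⟩
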